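/- Let $Y$ be a closed, oriented, connected smooth $3$-manifold with a contact form $a$ and an adapted Riemannian metric, i.e. $|a|=1$ and $\mathrm{d}a=2*a$. Let $e_3$ be the Reeb vector field, and let $K^{-1}=\ker a$, oriented by $\mathrm{d}a$ and regarded as a Hermitian line bundle with complex structure the rotation by a right angle. Let Clifford multiplication on $\underline{\mathbb{C}}\oplus K^{-1}$ be given, for each oriented orthonormal frame $(e_1,e_2)$ of $\ker a$ and the induced unit section of $K^{-1}$, by $$\mathrm{cl}(e_1)=\begin{pmatrix}0&-1\\1&0\end{pmatrix},\quad \mathrm{cl}(e_2)=\begin{pmatrix}0&i\\i&0\end{pmatrix},\quad \mathrm{cl}(e_3)=\begin{pmatrix}i&0\\0&-i\end{pmatrix}.$$ Let $\nabla_0$ be the canonical connection, that is, the Hermitian connection on $\underline{\mathbb{C}}\oplus K^{-1}$ that is compatible with Clifford multiplication and the Levi-Civita connection and whose Dirac operator $D_0$ annihilates $(1,0)$. For real $r$ put $D_r=D_0+\mathrm{cl}(-\tfrac{ir}{2}a)$ and $\nabla_r=\nabla_0-\tfrac{ir}{2}a$. An eigensection is a smooth section $\psi=(\alpha,\beta)$,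 not identically zero, with $D_r\psi=\lambda\psi$, $\lambda\in\mathbb{R}$; $\beta$ is identified with the section $(0,\beta)$. For every $\delta_1\ge 0$ there is a constant $c>0$, depending only on $\delta_1$, the contact form and the metric, such that the following hold for all $r\ge c$. (i) If $\psi=(\alpha,\beta)$ is an eigensection of $D_r$ with eigenvalue $\lambda$ and $|\lambda|\le\delta_1$, then $$\int_Y|\beta|^2+r^{-1}\int_Y|\nabla_r\beta|^2\le c\,r^{-1}\int_Y|\alpha|^2\qquad\text{and}\qquad \int_Y|D_r\beta|^2\le c\int_Y|\alpha|^2 .$$ (ii) If $D_{r+s}\psi(s)=\lambda(s)\psi(s)$ is a $\mathcal{C}^1$-family of eigensections and eigenvalues, defined for $s$ near $0$, with $|\lambda(0)|\le\delta_1$, then $|\lambda'(0)-\tfrac12|\le \tfrac{c}{r}$. (iii) There are only positive zero crossings for the spectral flow at $r$: if a family as in (ii) has $\lambda(0)=0$, then $\lambda(s)<0$ for all small $s<0$ and $\lambda(s)>0$ for all small $s>0$; and $\int_Y\langle\psi,\mathrm{cl}(-\tfrac i2a)\psi\rangle>0$ for every smooth section $\psi\ne0$ with $D_r\psi=0$.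 -/

import Mathlib

open scoped Manifold ContDiff Topology Bundle InnerProductSpace
open Bundle MeasureTheory Filter Set

noncomputable section

namespace ContactDirac

/-- The model space of a `3`-manifold. -/
abbrev E3 : Type := EuclideanSpace ℝ (Fin 3)

section Manifold

variable {Y : Type*} [TopologicalSpace Y] [ChartedSpace E3 Y]

instance instFiniteDimensionalTangentSpace (p : Y) :
    FiniteDimensional ℝ (TangentSpace (𝓡 3) p) :=
  inferInstanceAs (FiniteDimensional ℝ E3)

instance instFactFinrankTangentSpace (p : Y) :
    Fact (Module.finrank ℝ (TangentSpace (𝓡 3) p) = 3) :=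
  ⟨(finrank_euclideanSpace_fin : Module.finrank ℝ E3 = 3)⟩

/-! ### One-forms, exterior derivative, contact forms -/

/-- A (not necessarily continuous) real-valued one-form on `Y`. -/
abbrev OneForm (Y : Type*) [TopologicalSpace Y] [ChartedSpace E3 Y] : Type _ :=
  (p : Y) → TangentSpace (𝓡 3) p →L[ℝ] ℝ

/-- A smooth vector field on `Y`. -/
def IsSmoothVectorField [IsManifold (𝓡 3) ∞ Y] (X : (p : Y) → TangentSpace (𝓡 3) p) : Prop :=
  ContMDiff (𝓡 3) (𝓡 3).tangent ∞ (fun p => (⟨p, X p⟩ : TangentBundle (𝓡 3) Y))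

theorem isSmoothVectorField_zero [IsManifold (𝓡 3) ∞ Y] :
    IsSmoothVectorField (fun p : Y => (0 : TangentSpace (𝓡 3) p)) :=
  Bundle.contMDiff_zeroSection ℝ (TangentSpace (𝓡 3) : Y → Type _)

/-- A one-form is smooth if it is a smooth section of the cotangent bundle `Hom(TY, ℝ)`. -/
def IsSmoothOneForm [IsManifold (𝓡 3) ∞ Y] (a : OneForm Y) : Prop :=
  ContMDiff (𝓡 3) ((𝓡 3).prod 𝓘(ℝ, E3 →L[ℝ] ℝ)) ∞
    (fun p => TotalSpace.mk' (E3 →L[ℝ] ℝ)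
      (E := fun p : Y => TangentSpace (𝓡 3) p →L[ℝ] Bundle.Trivial Y ℝ p) p (a p))

/-- Cartan's formula `X (a(Z)) - Z (a(X)) - a([X, Z])` for `(da)(X, Z)` at the point `p`,
where `X`, `Z` are vector fields that are differentiable at `p`. -/
def cartanDeriv (a : OneForm Y) (X Z : (p : Y) → TangentSpace (𝓡 3) p) (p : Y) : ℝ :=
  mvfderiv (𝓡 3) (fun q => a q (Z q)) p (X p)
    - mvfderiv (𝓡 3) (fun q => a q (X q)) p (Z p)
    - a p (VectorField.mlieBracket (𝓡 3) X Z p)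

/-- The exterior derivative `da` of a one-form, as a function of two tangent vectors at `p`:
extend the vectors to vector fields near `p` and apply Cartan's formula. -/
def extDerivAt [IsManifold (𝓡 3) ∞ Y] (a : OneForm Y) (p : Y) (u v : TangentSpace (𝓡 3) p) : ℝ :=
  cartanDeriv a (FiberBundle.extend E3 u) (FiberBundle.extend E3 v) p

/-- The three-form `a ∧ da`. -/
def wedgeExtDerivAt [IsManifold (𝓡 3) ∞ Y] (a : OneForm Y) (p : Y)
    (u v w : TangentSpace (𝓡 3) p) : ℝ :=
  a p u * extDerivAt a p v w - a p v * extDerivAt a p u w + a p w * extDerivAt a p u v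

/-- A contact form: a smooth one-form `a` such that `a ∧ da` vanishes nowhere. -/
structure IsContactForm [IsManifold (𝓡 3) ∞ Y] (a : OneForm Y) : Prop where
  smooth : IsSmoothOneForm a
  nondegenerate : ∀ p, ∃ u v w : TangentSpace (𝓡 3) p, wedgeExtDerivAt a p u v w ≠ 0

/-- An orientation of the `3`-manifold `Y`: an orientation of every tangent space which is locally
constant when read in the local trivializations of the tangent bundle. -/
structure ManifoldOrientation (Y : Type*) [TopologicalSpace Y] [ChartedSpace E3 Y]
    [IsManifold (𝓡 3) ∞ Y] where
  at' (p : Y) : Orientation ℝ (TangentSpace (𝓡 3) p) (Fin 3)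
  locally_constant (p : Y) : ∃ o : Orientation ℝ E3 (Fin 3), ∀ᶠ q in 𝓝 p,
    ∀ hq : q ∈ (trivializationAt E3 (TangentSpace (𝓡 3)) p).baseSet,
      Orientation.map (Fin 3) ((trivializationAt E3 (TangentSpace (𝓡 3)) p).linearEquivAt ℝ q hq)
        (at' q) = o

/-! ### The Riemannian volume measure -/

section Volume

/-- A sequence of points whose preferred charts cover `Y`. -/
theorem exists_chart_cover (Y : Type*) [TopologicalSpace Y] [ChartedSpace E3 Y] [CompactSpace Y]
    [Nonempty Y] : ∃ x : ℕ → Y, ⋃ n, (chartAt E3 (x n)).source = univ := by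
  obtain ⟨t, ht, hcov⟩ := _root_.countable_cover_nhds
    (fun x : Y => chart_source_mem_nhds E3 x)
  have hne : t.Nonempty := by
    by_contra h
    rw [Set.not_nonempty_iff_eq_empty] at h
    subst h
    simp only [mem_empty_iff_false, iUnion_of_empty, iUnion_empty] at hcov
    exact Set.univ_nonempty.ne_empty hcov.symm
  obtain ⟨x, rfl⟩ := ht.exists_eq_range hne
  exact ⟨x, by simpa using hcov⟩

variable [RiemannianBundle (fun p : Y => TangentSpace (𝓡 3) p)]

/-- The density `√(det gᵢⱼ)` of the Riemannian volume in the preferred chart around `x`, where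
`gᵢⱼ = ⟨∂ᵢ, ∂ⱼ⟩` and the `∂ᵢ` are the coordinate vector fields of that chart. -/
def volumeDensity (x : Y) (z : E3) : ℝ :=
  Real.sqrt (Matrix.det (Matrix.of fun i j : Fin 3 =>
    ⟪mfderiv 𝓘(ℝ, E3) (𝓡 3) (extChartAt (𝓡 3) x).symm z
        (EuclideanSpace.single i (1 : ℝ) : E3),
      mfderiv 𝓘(ℝ, E3) (𝓡 3) (extChartAt (𝓡 3) x).symm z
        (EuclideanSpace.single j (1 : ℝ) : E3)⟫_ℝ))

variable [MeasurableSpace Y]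

/-- The measure `√(det gᵢⱼ) dz₁ dz₂ dz₃` of the preferred chart around `x`, on the domain of that
chart (and zero outside). -/
def chartVolume (x : Y) : Measure Y :=
  ((volume.restrict (extChartAt (𝓡 3) x).target).withDensity
    (fun z => ENNReal.ofReal (volumeDensity x z))).map (extChartAt (𝓡 3) x).symm

/-- The Riemannian volume measure of `Y`: cut `Y` into countably many disjoint pieces, each
contained in the domain of a chart, and use the measure `√(det gᵢⱼ) dz` on each piece. By the change
of variables formula the result does not depend on the charts and pieces. -/
def riemannianVolume (Y : Type*) [TopologicalSpace Y] [ChartedSpace E3 Y] [CompactSpace Y]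
    [Nonempty Y] [RiemannianBundle (fun p : Y => TangentSpace (𝓡 3) p)] [MeasurableSpace Y] :
    Measure Y :=
  let x : ℕ → Y := (exists_chart_cover Y).choose
  Measure.sum fun n => (chartVolume (x n)).restrict
    (disjointed (fun k => (chartAt E3 (x k)).source) n)

end Volume

/-! ### Adapted metrics and linear algebra of the canonical Spin^c structure -/

section Spin

variable [RiemannianBundle (fun p : Y => TangentSpace (𝓡 3) p)]

instance instCompleteSpaceTangentSpace (p : Y) : CompleteSpace (TangentSpace (𝓡 3) p) :=
  FiniteDimensional.complete ℝ _

/-- An orthonormal basis of the tangent space at `p`. -/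
def orthoBasis (p : Y) : OrthonormalBasis (Fin 3) ℝ (TangentSpace (𝓡 3) p) :=
  (stdOrthonormalBasis ℝ (TangentSpace (𝓡 3) p)).reindex (finCongr Fact.out)

/-- The vector `e₃` that is metrically dual to the one-form `a`. For an adapted metric this is the
Reeb vector field of `a`. -/
def dualVector (a : OneForm Y) (p : Y) : TangentSpace (𝓡 3) p :=
  (InnerProductSpace.toDual ℝ (TangentSpace (𝓡 3) p)).symm (a p)

variable [IsManifold (𝓡 3) ∞ Y]

/-- The Hodge star of a one-form in dimension three, `(*a)(u, v) = vol(a^♯, u, v)`. -/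
def hodgeStar (o : ManifoldOrientation Y) (a : OneForm Y) (p : Y)
    (u v : TangentSpace (𝓡 3) p) : ℝ :=
  (o.at' p).volumeForm ![dualVector a p, u, v]

/-- The Riemannian metric is adapted to the one-form `a`: `|a| = 1` and `da = 2 * a`, where `*` is
the Hodge star. -/
structure IsAdapted (o : ManifoldOrientation Y) (a : OneForm Y) : Prop where
  unit_length : ∀ p, ‖a p‖ = 1
  extDeriv_eq : ∀ p (u v : TangentSpace (𝓡 3) p), extDerivAt a p u v = 2 * hodgeStar o a p u v

/-- The vector `J v = e₃ × v`, determined by `⟨J v, w⟩ = vol(e₃, v, w)`. On the contact plane `ker a`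
it is the rotation by a right angle, for the orientation given by `da`; it is the complex structure
that makes `ker a` the Hermitian line bundle `K⁻¹`. -/
def rotate (o : ManifoldOrientation Y) (a : OneForm Y) (p : Y) (v : TangentSpace (𝓡 3) p) :
    TangentSpace (𝓡 3) p :=
  ∑ i, (o.at' p).volumeForm ![dualVector a p, v, orthoBasis p i] • orthoBasis p i

/-- The orthogonal projection `v - a(v) e₃` of a tangent vector to the contact plane. -/
def planePart (a : OneForm Y) (p : Y) (v : TangentSpace (𝓡 3) p) : TangentSpace (𝓡 3) p :=
  v - a p v • dualVector a p

/-- The fibre of `ℂ ⊕ K⁻¹` at `p` consists of the pairs `(z, v)` with `z` a complex number and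
`v` a tangent vector with `a(v) = 0`. We work with all pairs `(z, v)` and impose the condition
`a(v) = 0` on spinor fields. A unit vector `e₁` in `ker a` corresponds to the unit vector
`(e₁ - i e₂)/√2`, where `e₂ = J e₁`. -/
abbrev SpinorAt (p : Y) : Type := ℂ × TangentSpace (𝓡 3) p

/-- Multiplication of a vector by a complex number, `(x + i y) v = x v + y J v`. -/
def complexSmul (o : ManifoldOrientation Y) (a : OneForm Y) (p : Y) (z : ℂ)
    (v : TangentSpace (𝓡 3) p) : TangentSpace (𝓡 3) p :=
  z.re • v + z.im • rotate o a p v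

/-- The Hermitian inner product `⟨v, w⟩ + i ⟨v, J w⟩` of `K⁻¹`, complex linear in the first
variable. -/
def planeHerm (o : ManifoldOrientation Y) (a : OneForm Y) (p : Y)
    (v w : TangentSpace (𝓡 3) p) : ℂ :=
  (⟪v, w⟫_ℝ : ℂ) + Complex.I * (⟪v, rotate o a p w⟫_ℝ : ℂ)

/-- Multiplication of a spinor by a complex number. -/
def spinorSmul (o : ManifoldOrientation Y) (a : OneForm Y) (p : Y) (z : ℂ) (s : SpinorAt p) :
    SpinorAt p :=
  (z * s.1, complexSmul o a p z s.2)

/-- The Hermitian inner product of `ℂ ⊕ K⁻¹`, complex linear in the first variable. -/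
def spinorHerm (o : ManifoldOrientation Y) (a : OneForm Y) (p : Y) (s t : SpinorAt p) : ℂ :=
  s.1 * (starRingEnd ℂ) t.1 + planeHerm o a p s.2 t.2

/-- The squared length of a spinor. -/
def spinorNormSq (p : Y) (s : SpinorAt p) : ℝ := ‖s.1‖ ^ 2 + ‖s.2‖ ^ 2

/-- Clifford multiplication by a tangent vector `u = a(u) e₃ + u'` with `u'` in `ker a`:
`cl(u)(α, β) = (i a(u) α - ⟨β, u'⟩, α u' - i a(u) β)`.
In the basis `1, e₁` of `ℂ ⊕ K⁻¹`, with `e₁, e₂ = J e₁` an oriented orthonormal basis of `ker a`,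
`cl(e₁)`, `cl(e₂)`, `cl(e₃)` have the matrices `[0, -1; 1, 0]`, `[0, i; i, 0]`, `[i, 0; 0, -i]`. -/
def clifford (o : ManifoldOrientation Y) (a : OneForm Y) (p : Y) (u : TangentSpace (𝓡 3) p)
    (s : SpinorAt p) : SpinorAt p :=
  (Complex.I * (a p u : ℂ) * s.1 - planeHerm o a p s.2 (planePart a p u),
    complexSmul o a p s.1 (planePart a p u) - complexSmul o a p (Complex.I * (a p u : ℂ)) s.2)

/-! ### Spinor fields, Spin^c connections, Dirac operators -/

/-- A smooth section `ψ = (α, β)` of `ℂ ⊕ K⁻¹`: a smooth complex function `α` and a smooth vector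
field `β` that is tangent to the contact planes. -/
structure SpinorField (a : OneForm Y) where
  fst : Y → ℂ
  snd : (p : Y) → TangentSpace (𝓡 3) p
  smooth_fst : ContMDiff (𝓡 3) 𝓘(ℝ, ℂ) ∞ fst
  smooth_snd : IsSmoothVectorField snd
  tangent_snd : ∀ p, a p (snd p) = 0

/-- The value of a spinor field at a point. -/
def SpinorField.val {a : OneForm Y} (ψ : SpinorField a) (p : Y) : SpinorAt p := (ψ.fst p, ψ.snd p)

/-- The spinor field `(1, 0)`. -/
def unitSpinor (a : OneForm Y) : SpinorField a where
  fst _ := 1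
  snd _ := 0
  smooth_fst := contMDiff_const
  smooth_snd := isSmoothVectorField_zero
  tangent_snd p := map_zero (a p)

/-- The second component of a spinor field, seen as the spinor field `(0, β)`. -/
def SpinorField.sndPart {a : OneForm Y} (ψ : SpinorField a) : SpinorField a where
  fst _ := 0
  snd := ψ.snd
  smooth_fst := contMDiff_const
  smooth_snd := ψ.smooth_snd
  tangent_snd := ψ.tangent_snd

variable [IsContMDiffRiemannianBundle (𝓡 3) ∞ E3 (fun p : Y => TangentSpace (𝓡 3) p)]

instance instRiemannianOne :
    IsContMDiffRiemannianBundle (𝓡 3) 1 E3 (fun p : Y => TangentSpace (𝓡 3) p) :=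
  IsContMDiffRiemannianBundle.of_le (n := ∞) (by norm_num)

/-- A connection on the tangent bundle is the Levi-Civita connection of the Riemannian metric if it
is torsion free and compatible with the metric. -/
def IsLeviCivita (D : CovariantDerivative (𝓡 3) E3 (fun p : Y => TangentSpace (𝓡 3) p)) : Prop :=
  D.torsion = 0 ∧ D.IsMetricCompatible

/-- A Spin^c connection on `ℂ ⊕ K⁻¹`: a Hermitian connection compatible with Clifford
multiplication and with the Levi-Civita connection `D` of `Y`. Here `cov ψ p u` is the covariant
derivative of `ψ` at the point `p` in the direction `u`. -/
structure SpincConnection (o : ManifoldOrientation Y) (a : OneForm Y)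
    (D : CovariantDerivative (𝓡 3) E3 (fun p : Y => TangentSpace (𝓡 3) p)) where
  cov : SpinorField a → (p : Y) → TangentSpace (𝓡 3) p →ₗ[ℝ] SpinorAt p
  /-- the derivative takes values in `ℂ ⊕ K⁻¹` -/
  tangent : ∀ ψ p u, a p (cov ψ p u).2 = 0
  /-- the derivative of a smooth section along a smooth vector field is smooth -/
  smooth_fst : ∀ ψ X, IsSmoothVectorField X →
    ContMDiff (𝓡 3) 𝓘(ℝ, ℂ) ∞ (fun p => (cov ψ p (X p)).1)
  smooth_snd : ∀ ψ X, IsSmoothVectorField X → IsSmoothVectorField (fun p => (cov ψ p (X p)).2)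
  /-- `∇ (ψ + φ) = ∇ ψ + ∇ φ` -/
  additive : ∀ ψ φ χ : SpinorField a, (∀ p, χ.val p = ψ.val p + φ.val p) →
    ∀ p u, cov χ p u = cov ψ p u + cov φ p u
  /-- `∇ (f ψ) = df ⊗ ψ + f ∇ ψ` for smooth complex functions `f` -/
  leibniz : ∀ (f : Y → ℂ) (ψ χ : SpinorField a), ContMDiff (𝓡 3) 𝓘(ℝ, ℂ) ∞ f →
    (∀ p, χ.val p = spinorSmul o a p (f p) (ψ.val p)) →
    ∀ p u, cov χ p u =
      spinorSmul o a p (mvfderiv (𝓡 3) f p u) (ψ.val p) + spinorSmul o a p (f p) (cov ψ p u)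
  /-- `d ⟨ψ, φ⟩ = ⟨∇ ψ, φ⟩ + ⟨ψ, ∇ φ⟩` -/
  hermitian : ∀ (ψ φ : SpinorField a) p u,
    mvfderiv (𝓡 3) (fun q => spinorHerm o a q (ψ.val q) (φ.val q)) p u =
      spinorHerm o a p (cov ψ p u) (φ.val p) + spinorHerm o a p (ψ.val p) (cov φ p u)
  /-- `∇ (cl(X) ψ) = cl(∇ X) ψ + cl(X) ∇ ψ` for smooth vector fields `X` -/
  clifford_compatible : ∀ X, IsSmoothVectorField X → ∀ ψ χ : SpinorField a,
    (∀ p, χ.val p = clifford o a p (X p) (ψ.val p)) →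
    ∀ p u, cov χ p u =
      clifford o a p (D X p u) (ψ.val p) + clifford o a p (X p) (cov ψ p u)

variable {o : ManifoldOrientation Y} {a : OneForm Y}
  {D : CovariantDerivative (𝓡 3) E3 (fun p : Y => TangentSpace (𝓡 3) p)}

/-- The Dirac operator `∑ᵢ cl(eᵢ) ∇_{eᵢ} ψ` of a Spin^c connection (with `e₁, e₂, e₃` an
orthonormal basis of the tangent space; its choice does not matter). -/
def diracZero (A : SpincConnection o a D) (ψ : SpinorField a) (p : Y) : SpinorAt p :=
  ∑ i, clifford o a p (orthoBasis p i) (A.cov ψ p (orthoBasis p i))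

/-- The canonical connection: the Spin^c connection whose Dirac operator annihilates `(1, 0)`. -/
def IsCanonical (A : SpincConnection o a D) : Prop :=
  ∀ p, diracZero A (unitSpinor a) p = 0

/-- The zeroth order operator `cl(- (i/2) a)`. -/
def halfClifford (o : ManifoldOrientation Y) (a : OneForm Y) (p : Y) (s : SpinorAt p) :
    SpinorAt p :=
  spinorSmul o a p (-Complex.I / 2) (clifford o a p (dualVector a p) s)

/-- The Dirac operator `D_r = D_0 + cl(- (i r / 2) a)`. -/
def dirac (A : SpincConnection o a D) (r : ℝ) (ψ : SpinorField a) (p : Y) : SpinorAt p :=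
  diracZero A ψ p + r • halfClifford o a p (ψ.val p)

/-- The covariant derivative `∇_r = ∇_0 - (i r / 2) a`, whose Dirac operator is `D_r`. -/
def covR (A : SpincConnection o a D) (r : ℝ) (ψ : SpinorField a) (p : Y)
    (u : TangentSpace (𝓡 3) p) : SpinorAt p :=
  A.cov ψ p u + spinorSmul o a p (-Complex.I * (r : ℂ) / 2 * (a p u : ℂ)) (ψ.val p)

/-- The squared length `|∇_r ψ|²`. -/
def covNormSq (A : SpincConnection o a D) (r : ℝ) (ψ : SpinorField a) (p : Y) : ℝ :=
  ∑ i, spinorNormSq p (covR A r ψ p (orthoBasis p i))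

/-- `ψ` is an eigensection of `D_r` with eigenvalue `lam`. -/
structure IsEigensection (A : SpincConnection o a D) (r lam : ℝ) (ψ : SpinorField a) : Prop where
  nonzero : ∃ p, ψ.val p ≠ 0
  eigen : ∀ p, dirac A r ψ p = lam • ψ.val p

variable [CompactSpace Y] [Nonempty Y] [MeasurableSpace Y]

/-- A family `s ↦ ψ(s)` of spinor fields is of class `C¹` on the interval `(-ε, ε)`, with respect to
the `L²` norm: it has an `L²`-continuous derivative `s ↦ ψ'(s)`, where `ψ'(s)` is a continuous
section, in the `L²` sense. (Families that are `C¹` in a finer topology have this property.) -/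
def IsC1Family (ψ : ℝ → SpinorField a) (ε : ℝ) : Prop :=
  ∃ (α' : ℝ → Y → ℂ) (β' : ℝ → (p : Y) → TangentSpace (𝓡 3) p),
    (∀ s ∈ Ioo (-ε) ε, Continuous (α' s) ∧
      Continuous (fun p => (⟨p, β' s p⟩ : TangentBundle (𝓡 3) Y))) ∧
    (∀ s ∈ Ioo (-ε) ε, Tendsto (fun h : ℝ => ∫ p, spinorNormSq p
      (h⁻¹ • ((ψ (s + h)).val p - (ψ s).val p) - (α' s p, β' s p)) ∂(riemannianVolume Y))
      (𝓝[≠] 0) (𝓝 0)) ∧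
    ∀ s ∈ Ioo (-ε) ε, Tendsto (fun t : ℝ => ∫ p, spinorNormSq p
      ((α' t p, β' t p) - (α' s p, β' s p)) ∂(riemannianVolume Y)) (𝓝 s) (𝓝 0)

/-- A `C¹` family of eigensections `D_{r+s} ψ(s) = lam(s) ψ(s)`, for `s` in `(-ε, ε)`. -/
structure IsEigenBranch (A : SpincConnection o a D) (r ε : ℝ) (lam : ℝ → ℝ)
    (ψ : ℝ → SpinorField a) : Prop where
  pos : 0 < ε
  smooth_eigenvalue : ContDiffOn ℝ 1 lam (Ioo (-ε) ε)
  smooth_section : IsC1Family ψ ε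
  eigen : ∀ s ∈ Ioo (-ε) ε, IsEigensection A (r + s) (lam s) (ψ s)

/-- The crossing form `∫ ⟨ψ, cl(-(i/2) a) ψ⟩` of the family `D_r`, for `ψ` in the kernel of `D_r`: the
quantity whose sign is the sign with which the zero eigenvalue of `ψ` contributes to the spectral
flow. -/
def crossingForm (o : ManifoldOrientation Y) (ψ : SpinorField a) : ℝ :=
  ∫ p, (spinorHerm o a p (ψ.val p) (halfClifford o a p (ψ.val p))).re ∂(riemannianVolume Y)

end Spin

end Manifold

end ContactDirac

end

/-!
For an eigensection `ψ = (α, β)` put `φ = (0, β)` and `η = (α, 0)`. The estimates come from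
computing `∫ |D_r φ|²` in two ways.

* The twisted Weitzenböck formula. Passing from `D₀` to `D_r` changes `|D φ|² - |∇ φ|²` by exactly
  `r |β|²` (`SpincConnection.spinorNormSq_dirac_sub`); this is where `da = 2 * a` enters, through
  the trace identity `IsAdapted.sum_inner_rotate`. Hence
  `∫ |D_r φ|² = ∫ |∇_r φ|² + r ∫ |β|² + O(∫ |β|²)` (`SpincConnection.pairing_diracR_self`). The
  error is the operator `D₀² - ∇*∇`. Its curvature terms are never computed: it is linear over the
  smooth functions (`SpincConnection.weitz_smul`), hence a bounded endomorphism by compactness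
  (`SpincConnection.exists_weitz_bound`).
* The eigenvalue equation. Since `D₀` is symmetric (`SpincConnection.pairing_diracField`) and
  `cl(-(i/2) a)` acts by `±1/2` on the two summands, the terms containing `r` cancel and
  `∫ |D_r φ|² = λ² ∫ |β|² - ∫ ⟨D₀ φ, D₀ η⟩` (`SpincConnection.pairing_diracR_sndPart`).

The interaction `∫ ⟨D₀ φ, D₀ η⟩` is, up to the bounded operator above, `∫ ⟨∇φ, ∇η⟩`. Differentiating
`cl(e₃) φ = -i φ` and `cl(e₃) η = i η` shows that the part of `∇` that mixes the two summands is the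
zeroth order term `± (i/2) cl(∇ e₃)` (`SpincConnection.cov_fst`, `SpincConnection.cov_snd`). After
one integration by parts, only `η` and first derivatives of `φ` remain
(`SpincConnection.sum_pairing_along`), and since the Reeb field is geodesic, `∇ φ` may be replaced
by `∇_r φ` there (`SpincConnection.sum_twist_cov`). So the interaction is at most
`½ ∫ |∇_r φ|² + ½ ∫ |β|² + K ∫ |α|²` with `K` independent of `r`
(`SpincConnection.exists_abs_pairing_le`). Comparing the two expressions for `∫ |D_r φ|²` bounds
`r ∫ |β|² + ∫ |∇_r φ|²` by a multiple of `∫ |α|²` (`SpincConnection.exists_eigensection_bound`).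

The statements on families follow from the first variation formula
`λ'(0) ∫ |ψ|² = ½ ∫ |α|² - ½ ∫ |β|²` (`IsEigenBranch.deriv_mul_pairing`), because
`∫ |β|² ≤ (c / r) ∫ |α|²`.

All of this is written in a finite family of global vector fields `Xₖ` with `∑ₖ ⟨u, Xₖ⟩ Xₖ = u`
(`IsParsevalFrame`), which exists on every closed manifold, in place of local orthonormal frames.
Integration by parts rests on the divergence theorem (`integral_divergence`), proved by a partition
of unity and the formula `√g div V = ∑ᵢ ∂ᵢ (√g Vⁱ)` in charts.
-/

set_option linter.unusedSectionVars false

noncomputable section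

namespace ContactDirac

variable {Y : Type*} [TopologicalSpace Y] [ChartedSpace E3 Y] [IsManifold (𝓡 3) ∞ Y]

/-! ### Smooth vector fields and smooth functions -/

/-- A vector field is smooth at a point. -/
abbrev SmoothFieldAt (X : (p : Y) → TangentSpace (𝓡 3) p) (p : Y) : Prop :=
  ContMDiffAt (𝓡 3) (𝓡 3).tangent ∞ (fun q => (⟨q, X q⟩ : TangentBundle (𝓡 3) Y)) p

/-- Smooth real-valued functions. -/
abbrev SmoothFun (f : Y → ℝ) : Prop := ContMDiff (𝓡 3) 𝓘(ℝ, ℝ) ∞ f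

/-- The derivative `X f` of a function along a vector field. -/
def lieD {F : Type*} [NormedAddCommGroup F] [NormedSpace ℝ F] (X : (p : Y) → TangentSpace (𝓡 3) p)
    (f : Y → F) (p : Y) : F :=
  mvfderiv (𝓡 3) f p (X p)

theorem SmoothFieldAt.mdiff {X : (p : Y) → TangentSpace (𝓡 3) p} {p : Y} (h : SmoothFieldAt X p) :
    MDifferentiableAt (𝓡 3) (𝓡 3).tangent (fun q => (⟨q, X q⟩ : TangentBundle (𝓡 3) Y)) p :=
  h.mdifferentiableAt (by simp)

theorem IsSmoothVectorField.mdiff {X : (p : Y) → TangentSpace (𝓡 3) p} (h : IsSmoothVectorField X)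
    (p : Y) :
    MDifferentiableAt (𝓡 3) (𝓡 3).tangent (fun q => (⟨q, X q⟩ : TangentBundle (𝓡 3) Y)) p :=
  h.contMDiffAt.mdifferentiableAt (by simp)

theorem SmoothFun.mdiff {f : Y → ℝ} (h : SmoothFun f) (p : Y) :
    MDifferentiableAt (𝓡 3) 𝓘(ℝ, ℝ) f p :=
  h.contMDiffAt.mdifferentiableAt (by simp)

theorem IsSmoothVectorField.add {X Z : (p : Y) → TangentSpace (𝓡 3) p} (hX : IsSmoothVectorField X)
    (hZ : IsSmoothVectorField Z) : IsSmoothVectorField (fun p => X p + Z p) :=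
  ContMDiff.add_section hX hZ

theorem IsSmoothVectorField.sub {X Z : (p : Y) → TangentSpace (𝓡 3) p} (hX : IsSmoothVectorField X)
    (hZ : IsSmoothVectorField Z) : IsSmoothVectorField (fun p => X p - Z p) :=
  ContMDiff.sub_section hX hZ

theorem IsSmoothVectorField.smul {f : Y → ℝ} {X : (p : Y) → TangentSpace (𝓡 3) p}
    (hX : IsSmoothVectorField X) (hf : SmoothFun f) : IsSmoothVectorField (fun p => f p • X p) :=
  ContMDiff.smul_section hf hX

theorem IsSmoothVectorField.sum {ι : Type*} {s : Finset ι} {X : ι → (p : Y) → TangentSpace (𝓡 3) p}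
    (hX : ∀ i ∈ s, IsSmoothVectorField (X i)) : IsSmoothVectorField (fun p => ∑ i ∈ s, X i p) :=
  ContMDiff.sum_section hX

theorem SmoothFun.lieD_smooth {F : Type*} [NormedAddCommGroup F] [NormedSpace ℝ F] {f : Y → F}
    {X : (p : Y) → TangentSpace (𝓡 3) p} (hf : ContMDiff (𝓡 3) 𝓘(ℝ, F) ∞ f)
    (hX : IsSmoothVectorField X) : ContMDiff (𝓡 3) 𝓘(ℝ, F) ∞ (lieD X f) := by
  have h1 : ContMDiff (𝓡 3).tangent (𝓘(ℝ, F)).tangent ∞ (tangentMap (𝓡 3) 𝓘(ℝ, F) f) :=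
    hf.contMDiff_tangentMap (by simp)
  have h2 := (contMDiff_snd_tangentBundle_modelSpace F 𝓘(ℝ, F) (n := ∞)).comp (h1.comp hX)
  exact h2

theorem IsSmoothVectorField.mlieBracket {X Z : (p : Y) → TangentSpace (𝓡 3) p}
    (hX : IsSmoothVectorField X) (hZ : IsSmoothVectorField Z) :
    IsSmoothVectorField (VectorField.mlieBracket (𝓡 3) X Z) := by
  intro p
  have : IsManifold (𝓡 3) (minSmoothness ℝ 2) Y := by
    rw [minSmoothness_of_isRCLikeNormedField]; infer_instance
  have : IsManifold (𝓡 3) (((⊤ : ℕ∞) : WithTop ℕ∞) + 1) Y := by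
    simpa using! (inferInstance : IsManifold (𝓡 3) ∞ Y)
  exact ContMDiffAt.mlieBracket_vectorField (n := ⊤) (m := ⊤) hX.contMDiffAt hZ.contMDiffAt
    (by rw [minSmoothness_of_isRCLikeNormedField]; simp)

/-- The Lie bracket is the commutator of derivations. This is read off from the Jacobi identity for
`X`, `Z` and `f W`, and therefore appears multiplied by the vector `W p`. -/
theorem lieD_mlieBracket {X Z : (p : Y) → TangentSpace (𝓡 3) p} (hX : IsSmoothVectorField X)
    (hZ : IsSmoothVectorField Z) {W : (p : Y) → TangentSpace (𝓡 3) p} (hW : IsSmoothVectorField W)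
    {f : Y → ℝ} (hf : SmoothFun f) (p : Y) :
    lieD (VectorField.mlieBracket (𝓡 3) X Z) f p • W p
      = (lieD X (lieD Z f) p - lieD Z (lieD X f) p) • W p := by
  have : IsManifold (𝓡 3) (minSmoothness ℝ 3) Y := by
    rw [minSmoothness_of_isRCLikeNormedField]; infer_instance
  have aux : ∀ {V : (p : Y) → TangentSpace (𝓡 3) p}, IsSmoothVectorField V →
      ContMDiffAt (𝓡 3) (𝓡 3).tangent (minSmoothness ℝ 2)
        (fun x => (⟨x, V x⟩ : TangentBundle (𝓡 3) Y)) p := by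
    intro V hV
    rw [minSmoothness_of_isRCLikeNormedField]
    exact hV.contMDiffAt.of_le ENat.LEInfty.out
  have key : ∀ {V : (p : Y) → TangentSpace (𝓡 3) p}, IsSmoothVectorField V →
      VectorField.mlieBracket (𝓡 3) V (f • W) =
        lieD V f • W + f • VectorField.mlieBracket (𝓡 3) V W := by
    intro V hV
    funext q
    rw [VectorField.mlieBracket_smul_right (hf.mdiff q) (hW.mdiff q)]
    rfl
  have key2 : ∀ {V U : (p : Y) → TangentSpace (𝓡 3) p},
      IsSmoothVectorField V → IsSmoothVectorField U →
      VectorField.mlieBracket (𝓡 3) V (VectorField.mlieBracket (𝓡 3) U (f • W)) p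
        = lieD V (lieD U f) p • W p + lieD U f p • VectorField.mlieBracket (𝓡 3) V W p
          + (lieD V f p • VectorField.mlieBracket (𝓡 3) U W p
            + f p • VectorField.mlieBracket (𝓡 3) V (VectorField.mlieBracket (𝓡 3) U W) p) := by
    intro V U hV hU
    have hUf : SmoothFun (lieD U f) := SmoothFun.lieD_smooth hf hU
    have hUW := hU.mlieBracket hW
    rw [key hU, VectorField.mlieBracket_add_right (W := lieD U f • W)
        (W₁ := f • VectorField.mlieBracket (𝓡 3) U W) ((hW.smul hUf).mdiff p)
        ((hUW.smul hf).mdiff p),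
      VectorField.mlieBracket_smul_right (hUf.mdiff p) (hW.mdiff p),
      VectorField.mlieBracket_smul_right (hf.mdiff p) (hUW.mdiff p)]
    rfl
  have J1 := VectorField.leibniz_identity_mlieBracket_apply (aux hX) (aux hZ) (aux (hW.smul hf))
  have J2 := VectorField.leibniz_identity_mlieBracket_apply (aux hX) (aux hZ) (aux hW)
  change VectorField.mlieBracket (𝓡 3) X (VectorField.mlieBracket (𝓡 3) Z (f • W)) p =
    VectorField.mlieBracket (𝓡 3) _ (f • W) p + VectorField.mlieBracket (𝓡 3) Z
      (VectorField.mlieBracket (𝓡 3) X (f • W)) p at J1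
  rw [key2 hX hZ, key2 hZ hX, key (hX.mlieBracket hZ), J2] at J1
  simp only [Pi.add_apply, Pi.smul_apply'] at J1
  rw [sub_smul]
  generalize VectorField.mlieBracket (𝓡 3) (VectorField.mlieBracket (𝓡 3) X Z) W p = a1 at *
  linear_combination (norm := module) (-1 : ℝ) • J1

/-- A finite smooth partition of unity subordinate to a cover by charts. -/
theorem exists_chart_partition (Y : Type*) [TopologicalSpace Y] [ChartedSpace E3 Y]
    [IsManifold (𝓡 3) ∞ Y] [CompactSpace Y] [T2Space Y] :
    ∃ (t : Finset Y) (f : t → Y → ℝ), (∀ x, SmoothFun (f x)) ∧ (∀ p, ∑ x, f x p = 1) ∧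
      ∀ x : t, tsupport (f x) ⊆ (chartAt E3 (x : Y)).source := by
  obtain ⟨t, ht⟩ := isCompact_univ.elim_finite_subcover (fun x : Y => (chartAt E3 x).source)
    (fun x => (chartAt E3 x).open_source)
    (fun x _ => mem_iUnion.2 ⟨x, mem_chart_source E3 x⟩)
  obtain ⟨f, hf⟩ := SmoothPartitionOfUnity.exists_isSubordinate (𝓡 3) isClosed_univ
    (fun x : t => (chartAt E3 (x : Y)).source) (fun x => (chartAt E3 (x : Y)).open_source)
    (by
      intro p hp
      obtain ⟨x, hx⟩ := mem_iUnion.1 (ht hp)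
      obtain ⟨hxt, hx⟩ := mem_iUnion.1 hx
      exact mem_iUnion.2 ⟨⟨x, hxt⟩, hx⟩)
  refine ⟨t, fun x => f x, fun x => (f x).contMDiff, fun p => ?_, hf⟩
  rw [← finsum_eq_sum_of_fintype]
  exact f.sum_eq_one (mem_univ p)

/-- Connections on the tangent bundle. -/
abbrev TangentConnection (Y : Type*) [TopologicalSpace Y] [ChartedSpace E3 Y]
    [IsManifold (𝓡 3) ∞ Y] : Type _ :=
  CovariantDerivative (𝓡 3) E3 (fun p : Y => TangentSpace (𝓡 3) p)

/-- The Riemannian metric of `Y` is smooth. -/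
abbrev IsSmoothMetric (Y : Type*) [TopologicalSpace Y] [ChartedSpace E3 Y] [IsManifold (𝓡 3) ∞ Y]
    [RiemannianBundle (fun p : Y => TangentSpace (𝓡 3) p)] : Prop :=
  IsContMDiffRiemannianBundle (𝓡 3) ∞ E3 (fun p : Y => TangentSpace (𝓡 3) p)

variable [RiemannianBundle (fun p : Y => TangentSpace (𝓡 3) p)] [IsSmoothMetric Y]

/-! ### Parseval frames -/

theorem smoothFieldAt_gramSchmidt {U : Set Y} {f : Fin 3 → (p : Y) → TangentSpace (𝓡 3) p}
    (hf : ∀ i, ∀ p ∈ U, SmoothFieldAt (f i) p)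
    (hli : ∀ p ∈ U, LinearIndependent ℝ (fun i => f i p)) (i : Fin 3) :
    ∀ p ∈ U, SmoothFieldAt (fun q => InnerProductSpace.gramSchmidt ℝ (fun j => f j q) i) p := by
  induction i using WellFoundedLT.induction with
  | ind i ih =>
    intro p hp
    -- the recursion with inner products in place of norms, which are smooth only away from zero
    have hdef : (fun q => InnerProductSpace.gramSchmidt ℝ (fun j => f j q) i) = fun q =>
        f i q - ∑ j ∈ Finset.Iio i, (⟪InnerProductSpace.gramSchmidt ℝ (fun j => f j q) j, f i q⟫_ℝ
          / ⟪InnerProductSpace.gramSchmidt ℝ (fun j => f j q) j,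
            InnerProductSpace.gramSchmidt ℝ (fun j => f j q) j⟫_ℝ) •
          InnerProductSpace.gramSchmidt ℝ (fun j => f j q) j := by
      funext q
      have h := InnerProductSpace.gramSchmidt_def'' ℝ (fun j => f j q) i
      simp only [real_inner_self_eq_norm_sq]
      exact eq_sub_of_add_eq h.symm
    rw [hdef]
    refine ContMDiffAt.sub_section (hf i p hp) (ContMDiffAt.sum_section fun j hj => ?_)
    have hj' := ih j (by simpa using hj) p hp
    have h0 : ⟪InnerProductSpace.gramSchmidt ℝ (fun j => f j p) j,
        InnerProductSpace.gramSchmidt ℝ (fun j => f j p) j⟫_ℝ ≠ 0 := by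
      rw [inner_self_ne_zero]
      exact InnerProductSpace.gramSchmidt_ne_zero j (hli p hp)
    exact ContMDiffAt.smul_section
      ((ContMDiffAt.inner_bundle hj' (hf i p hp)).div₀ (ContMDiffAt.inner_bundle hj' hj') h0) hj'

/-- Around every point there is a smooth orthonormal frame. -/
theorem exists_local_orthonormal_frame (x : Y) :
    ∃ E : Fin 3 → (p : Y) → TangentSpace (𝓡 3) p,
      (∀ i, ∀ p ∈ (chartAt E3 x).source, SmoothFieldAt (E i) p) ∧
      ∀ p ∈ (chartAt E3 x).source, Orthonormal ℝ (fun i => E i p) := by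
  let b : Module.Basis (Fin 3) ℝ E3 := (EuclideanSpace.basisFun (Fin 3) ℝ).toBasis
  have hF := (trivializationAt E3 (TangentSpace (𝓡 3)) x).isLocalFrameOn_localFrame_baseSet
    (𝓡 3) ∞ b
  set s := (trivializationAt E3 (TangentSpace (𝓡 3)) x).localFrame b with hs
  have hbase : (trivializationAt E3 (TangentSpace (𝓡 3)) x).baseSet = (chartAt E3 x).source :=
    TangentBundle.trivializationAt_baseSet x
  rw [hbase] at hF
  have hsm : ∀ i, ∀ p ∈ (chartAt E3 x).source, SmoothFieldAt (s i) p := fun i p hp =>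
    hF.contMDiffAt (chartAt E3 x).open_source hp i
  have hli : ∀ p ∈ (chartAt E3 x).source, LinearIndependent ℝ (fun i => s i p) := fun p hp =>
    hF.linearIndependent hp
  refine ⟨fun i q => InnerProductSpace.gramSchmidtNormed ℝ (fun j => s j q) i, fun i p hp => ?_,
    fun p hp => InnerProductSpace.gramSchmidtNormed_orthonormal (hli p hp)⟩
  have hg := smoothFieldAt_gramSchmidt hsm hli i p hp
  have hpos : ⟪InnerProductSpace.gramSchmidt ℝ (fun j => s j p) i,
      InnerProductSpace.gramSchmidt ℝ (fun j => s j p) i⟫_ℝ ≠ 0 := by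
    rw [inner_self_ne_zero]
    exact InnerProductSpace.gramSchmidt_ne_zero i (hli p hp)
  have hsq : ContMDiffAt (𝓡 3) 𝓘(ℝ, ℝ) ∞ (fun q =>
      (Real.sqrt ⟪InnerProductSpace.gramSchmidt ℝ (fun j => s j q) i,
        InnerProductSpace.gramSchmidt ℝ (fun j => s j q) i⟫_ℝ)⁻¹) p :=
    ContMDiffAt.inv₀ ((Real.contDiffAt_sqrt hpos).contMDiffAt.comp p
      (ContMDiffAt.inner_bundle hg hg)) ((Real.sqrt_ne_zero real_inner_self_nonneg).2 hpos)
  have h2 := ContMDiffAt.smul_section hsq hg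
  refine h2.congr_of_eventuallyEq (Eventually.of_forall fun q => ?_)
  simp [InnerProductSpace.gramSchmidtNormed]

/-- A finite family of smooth vector fields with `∑ₖ ⟨u, Xₖ⟩ Xₖ = u` for all tangent vectors `u`. It
replaces a global orthonormal frame. -/
structure IsParsevalFrame {ι : Type*} [Fintype ι] (X : ι → (p : Y) → TangentSpace (𝓡 3) p) :
    Prop where
  smooth : ∀ k, IsSmoothVectorField (X k)
  sum_eq : ∀ p (u : TangentSpace (𝓡 3) p), ∑ k, ⟪u, X k p⟫_ℝ • X k p = u

/-- With a partition of unity `f_x` subordinate to charts and orthonormal frames `E_x` over them,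
the fields `f_x E_{x,i} / √(∑ f_x²)` form a Parseval frame. -/
theorem exists_parsevalFrame [CompactSpace Y] [T2Space Y] :
    ∃ (n : ℕ) (X : Fin n → (p : Y) → TangentSpace (𝓡 3) p), IsParsevalFrame X := by
  classical
  choose E hE hEo using fun x : Y => exists_local_orthonormal_frame x
  obtain ⟨t, f, hfs, hsum, hf⟩ := exists_chart_partition Y
  let S : Y → ℝ := fun p => ∑ x, f x p ^ 2
  have hS : ∀ p, 0 < S p := by
    intro p
    refine lt_of_le_of_ne (Finset.sum_nonneg fun x _ => sq_nonneg _) fun h => ?_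
    have h0 := (Finset.sum_eq_zero_iff_of_nonneg (fun x _ => sq_nonneg (f x p))).1 h.symm
    have h1 := hsum p
    rw [Finset.sum_eq_zero fun x hx => pow_eq_zero_iff two_ne_zero |>.1 (h0 x hx)] at h1
    exact zero_ne_one h1
  have hSs : ContMDiff (𝓡 3) 𝓘(ℝ, ℝ) ∞ S := ContMDiff.sum fun x _ => (hfs x).pow 2
  have hsq : ContMDiff (𝓡 3) 𝓘(ℝ, ℝ) ∞ (fun p => (Real.sqrt (S p))⁻¹) := fun p =>
    ContMDiffAt.inv₀ ((Real.contDiffAt_sqrt (hS p).ne').contMDiffAt.comp p hSs.contMDiffAt)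
      (Real.sqrt_ne_zero'.2 (hS p))
  have hloc : ∀ (x : t) i, IsSmoothVectorField (fun p => f x p • E x i p) := fun x i =>
    ContMDiffOn.smul_section_of_tsupport (hfs x).contMDiffOn (chartAt E3 (x : Y)).open_source
      (hf x) (fun p hp => (hE x i p hp).contMDiffWithinAt)
  let e := Fintype.equivFin (t × Fin 3)
  let X : t × Fin 3 → (p : Y) → TangentSpace (𝓡 3) p :=
    fun k p => (Real.sqrt (S p))⁻¹ • (f k.1 p • E k.1 k.2 p)
  refine ⟨Fintype.card (t × Fin 3), fun n => X (e.symm n),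
    ⟨fun n => (hloc (e.symm n).1 (e.symm n).2).smul hsq, fun p u => ?_⟩⟩
  rw [e.symm.sum_comp (fun k => ⟪u, X k p⟫_ℝ • X k p), Fintype.sum_prod_type]
  have hx : ∀ x : t, ∑ i, ⟪u, (Real.sqrt (S p))⁻¹ • (f x p • E x i p)⟫_ℝ •
      ((Real.sqrt (S p))⁻¹ • (f x p • E x i p)) = (f x p ^ 2 / S p) • u := by
    intro x
    by_cases hp : p ∈ (chartAt E3 (x : Y)).source
    · have hb := (OrthonormalBasis.mk (hEo x p hp) (by
        rw [(hEo x p hp).linearIndependent.span_eq_top_of_card_eq_finrank' (by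
          simp [(Fact.out : Module.finrank ℝ (TangentSpace (𝓡 3) p) = 3)])])).sum_repr' u
      simp only [OrthonormalBasis.coe_mk] at hb
      conv_rhs => rw [← hb, Finset.smul_sum]
      refine Finset.sum_congr rfl fun i _ => ?_
      rw [inner_smul_right, inner_smul_right, smul_smul, smul_smul, smul_smul,
        real_inner_comm u]
      congr 1
      have := Real.sq_sqrt (hS p).le
      have h2 : Real.sqrt (S p) ≠ 0 := Real.sqrt_ne_zero'.2 (hS p)
      have h3 := (hS p).ne'
      field_simp
      rw [this]
      ring
    · have h0 : f x p = 0 := by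
        by_contra h
        exact hp (hf x (subset_tsupport _ h))
      simp [h0]
  rw [Finset.sum_congr rfl fun x _ => hx x, ← Finset.sum_smul, ← Finset.sum_div]
  change (S p / S p) • u = u
  rw [div_self (hS p).ne', one_smul]

/-! ### The Levi-Civita connection -/

section Frame

variable {n : ℕ} {X : Fin n → (p : Y) → TangentSpace (𝓡 3) p}

theorem IsSmoothVectorField.inner {V W : (p : Y) → TangentSpace (𝓡 3) p}
    (hV : IsSmoothVectorField V) (hW : IsSmoothVectorField W) :
    SmoothFun (fun p => ⟪V p, W p⟫_ℝ) :=
  ContMDiff.inner_bundle hV hW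

theorem IsParsevalFrame.inner_eq (hX : IsParsevalFrame X) (p : Y) (u v : TangentSpace (𝓡 3) p) :
    ⟪u, v⟫_ℝ = ∑ k, ⟪u, X k p⟫_ℝ * ⟪v, X k p⟫_ℝ := by
  conv_lhs => rw [← hX.sum_eq p u, sum_inner]
  simp only [inner_smul_left, real_inner_comm]
  rfl

theorem IsParsevalFrame.smooth_of_inner (hX : IsParsevalFrame X)
    {V : (p : Y) → TangentSpace (𝓡 3) p} (h : ∀ k, SmoothFun (fun p => ⟪V p, X k p⟫_ℝ)) :
    IsSmoothVectorField V := by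
  have h2 : V = fun p => ∑ k, ⟪V p, X k p⟫_ℝ • X k p := by
    funext p
    exact (hX.sum_eq p (V p)).symm
  rw [h2]
  exact IsSmoothVectorField.sum fun k _ => (hX.smooth k).smul (h k)

theorem IsParsevalFrame.exists_field (hX : IsParsevalFrame X) (p : Y) (u : TangentSpace (𝓡 3) p) :
    ∃ U : (p : Y) → TangentSpace (𝓡 3) p, IsSmoothVectorField U ∧ U p = u :=
  ⟨fun q => ∑ k, ⟪u, X k p⟫_ℝ • X k q,
    IsSmoothVectorField.sum fun k _ => (hX.smooth k).smul contMDiff_const, hX.sum_eq p u⟩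

/-- Every sum `∑ᵢ B(eᵢ, eᵢ)` over an orthonormal basis can be computed in a Parseval frame. -/
theorem IsParsevalFrame.sum_orthonormalBasis (hX : IsParsevalFrame X) {p : Y}
    {F : Type*} [AddCommGroup F] [Module ℝ F]
    (b : OrthonormalBasis (Fin 3) ℝ (TangentSpace (𝓡 3) p))
    (B : TangentSpace (𝓡 3) p →ₗ[ℝ] TangentSpace (𝓡 3) p →ₗ[ℝ] F) :
    ∑ i, B (b i) (b i) = ∑ k, B (X k p) (X k p) := by
  have h : ∀ k, B (X k p) (X k p) = ∑ i, ⟪b i, X k p⟫_ℝ • B (b i) (X k p) := by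
    intro k
    calc B (X k p) (X k p) = B (∑ i, ⟪b i, X k p⟫_ℝ • b i) (X k p) := by rw [b.sum_repr']
      _ = _ := by simp only [map_sum, map_smul, LinearMap.sum_apply, LinearMap.smul_apply]
  have h2 : ∀ i, B (b i) (b i) = ∑ k, ⟪b i, X k p⟫_ℝ • B (b i) (X k p) := by
    intro i
    calc B (b i) (b i) = B (b i) (∑ k, ⟪b i, X k p⟫_ℝ • X k p) := by rw [hX.sum_eq]
      _ = _ := by simp only [map_sum, map_smul]
  simp only [h, h2]
  exact Finset.sum_comm

end Frame

section LeviCivita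

variable {D : TangentConnection Y}

theorem covariantDerivative_add {V W : (p : Y) → TangentSpace (𝓡 3) p}
    (hV : IsSmoothVectorField V) (hW : IsSmoothVectorField W) (p : Y) :
    D (fun q => V q + W q) p = D V p + D W p :=
  D.isCovariantDerivativeOnUniv.add (hV.mdiff p) (hW.mdiff p)

theorem covariantDerivative_smul {V : (p : Y) → TangentSpace (𝓡 3) p} {f : Y → ℝ}
    (hV : IsSmoothVectorField V) (hf : SmoothFun f) (p : Y) (u : TangentSpace (𝓡 3) p) :
    D (fun q => f q • V q) p u = f p • D V p u + mvfderiv (𝓡 3) f p u • V p := by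
  have := D.isCovariantDerivativeOnUniv.leibniz (hV.mdiff p) (hf.mdiff p)
  exact congrArg (fun L : TangentSpace (𝓡 3) p →L[ℝ] TangentSpace (𝓡 3) p => L u) this

theorem covariantDerivative_sum {ι : Type*} (s : Finset ι) {V : ι → (p : Y) → TangentSpace (𝓡 3) p}
    (hV : ∀ i ∈ s, IsSmoothVectorField (V i)) (p : Y) :
    D (fun q => ∑ i ∈ s, V i q) p = ∑ i ∈ s, D (V i) p := by
  classical
  induction s using Finset.induction_on with
  | empty =>
    simp only [Finset.sum_empty]
    exact congrFun D.zero p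
  | insert i s hi ih =>
    simp only [Finset.sum_insert hi]
    rw [covariantDerivative_add (hV i (Finset.mem_insert_self i s))
      (IsSmoothVectorField.sum fun j hj => hV j (Finset.mem_insert_of_mem hj)),
      ih fun j hj => hV j (Finset.mem_insert_of_mem hj)]

theorem IsLeviCivita.mvfderiv_inner (hD : IsLeviCivita D) {V W : (p : Y) → TangentSpace (𝓡 3) p}
    {p : Y}
    (hV : MDifferentiableAt (𝓡 3) (𝓡 3).tangent (fun q => (⟨q, V q⟩ : TangentBundle (𝓡 3) Y)) p)
    (hW : MDifferentiableAt (𝓡 3) (𝓡 3).tangent (fun q => (⟨q, W q⟩ : TangentBundle (𝓡 3) Y)) p)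
    (u : TangentSpace (𝓡 3) p) :
    mvfderiv (𝓡 3) (fun q => ⟪V q, W q⟫_ℝ) p u = ⟪D V p u, W p⟫_ℝ + ⟪V p, D W p u⟫_ℝ := by
  have h := hD.2.mvfderiv_inner_eq (FiberBundle.extend E3 u) hV hW
  simpa using! h

theorem IsLeviCivita.sub_eq (hD : IsLeviCivita D) {V W : (p : Y) → TangentSpace (𝓡 3) p}
    {p : Y}
    (hV : MDifferentiableAt (𝓡 3) (𝓡 3).tangent (fun q => (⟨q, V q⟩ : TangentBundle (𝓡 3) Y)) p)
    (hW : MDifferentiableAt (𝓡 3) (𝓡 3).tangent (fun q => (⟨q, W q⟩ : TangentBundle (𝓡 3) Y)) p) :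
    D W p (V p) - D V p (W p) = VectorField.mlieBracket (𝓡 3) V W p :=
  (CovariantDerivative.torsion_eq_zero_iff D).1 hD.1 hV hW

/-- The Koszul formula. -/
theorem IsLeviCivita.koszul (hD : IsLeviCivita D) {U V W : (p : Y) → TangentSpace (𝓡 3) p}
    (hU : IsSmoothVectorField U) (hV : IsSmoothVectorField V) (hW : IsSmoothVectorField W) (p : Y) :
    ⟪D V p (U p), W p⟫_ℝ =
      (lieD U (fun q => ⟪V q, W q⟫_ℝ) p + lieD V (fun q => ⟪U q, W q⟫_ℝ) p
        - lieD W (fun q => ⟪U q, V q⟫_ℝ) p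
        + ⟪VectorField.mlieBracket (𝓡 3) U V p, W p⟫_ℝ
        - ⟪VectorField.mlieBracket (𝓡 3) U W p, V p⟫_ℝ
        - ⟪VectorField.mlieBracket (𝓡 3) V W p, U p⟫_ℝ) / 2 := by
  simp only [lieD]
  rw [hD.mvfderiv_inner (hV.mdiff p) (hW.mdiff p), hD.mvfderiv_inner (hU.mdiff p) (hW.mdiff p),
    hD.mvfderiv_inner (hU.mdiff p) (hV.mdiff p), ← hD.sub_eq (hU.mdiff p) (hV.mdiff p),
    ← hD.sub_eq (hU.mdiff p) (hW.mdiff p), ← hD.sub_eq (hV.mdiff p) (hW.mdiff p)]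
  simp only [inner_sub_left]
  rw [real_inner_comm (D W p (U p)), real_inner_comm (D W p (V p)), real_inner_comm (D V p (W p))]
  ring

/-- Covariant derivatives of smooth fields are smooth. Nothing of the kind is required of a
connection; for the Levi-Civita connection it follows from the Koszul formula. -/
theorem IsLeviCivita.smooth (hD : IsLeviCivita D) {n : ℕ}
    {X : Fin n → (p : Y) → TangentSpace (𝓡 3) p} (hX : IsParsevalFrame X)
    {U V : (p : Y) → TangentSpace (𝓡 3) p}
    (hU : IsSmoothVectorField U) (hV : IsSmoothVectorField V) :
    IsSmoothVectorField (fun p => D V p (U p)) := by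
  refine hX.smooth_of_inner fun k => ?_
  have hW := hX.smooth k
  simp only [hD.koszul hU hV hW, div_eq_inv_mul]
  refine contMDiff_const.mul (ContMDiff.sub (ContMDiff.sub (ContMDiff.add (ContMDiff.sub
    (ContMDiff.add ?_ ?_) ?_) ?_) ?_) ?_)
  · exact SmoothFun.lieD_smooth (hV.inner hW) hU
  · exact SmoothFun.lieD_smooth (hU.inner hW) hV
  · exact SmoothFun.lieD_smooth (hU.inner hV) hW
  · exact (hU.mlieBracket hV).inner hW
  · exact (hU.mlieBracket hW).inner hV
  · exact (hV.mlieBracket hW).inner hU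

/-- The gradient of a function, written in a Parseval frame. -/
def gradient {n : ℕ} (X : Fin n → (p : Y) → TangentSpace (𝓡 3) p) (f : Y → ℝ) (p : Y) :
    TangentSpace (𝓡 3) p :=
  ∑ k, lieD (X k) f p • X k p

theorem IsParsevalFrame.smooth_gradient {n : ℕ}
    {X : Fin n → (p : Y) → TangentSpace (𝓡 3) p} (hX : IsParsevalFrame X) {f : Y → ℝ}
    (hf : SmoothFun f) : IsSmoothVectorField (gradient X f) :=
  IsSmoothVectorField.sum fun k _ => (hX.smooth k).smul (SmoothFun.lieD_smooth hf (hX.smooth k))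

theorem IsParsevalFrame.inner_gradient {n : ℕ}
    {X : Fin n → (p : Y) → TangentSpace (𝓡 3) p} (hX : IsParsevalFrame X) (f : Y → ℝ)
    (p : Y) (u : TangentSpace (𝓡 3) p) : ⟪gradient X f p, u⟫_ℝ = mvfderiv (𝓡 3) f p u := by
  conv_rhs => rw [← hX.sum_eq p u, map_sum]
  simp only [gradient, sum_inner, inner_smul_left, map_smul, lieD, smul_eq_mul]
  exact Finset.sum_congr rfl fun k _ => by rw [real_inner_comm, mul_comm]; rfl

/-- The Hessian of a function is symmetric. -/
theorem IsLeviCivita.hessian_symm (hD : IsLeviCivita D) {n : ℕ}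
    {X : Fin n → (p : Y) → TangentSpace (𝓡 3) p} (hX : IsParsevalFrame X) {f : Y → ℝ}
    (hf : SmoothFun f) (p : Y) (u v : TangentSpace (𝓡 3) p) :
    ⟪D (gradient X f) p u, v⟫_ℝ = ⟪u, D (gradient X f) p v⟫_ℝ := by
  -- `lieD_mlieBracket` is used with an extension of `u` as the field `W`, so `u = 0` is separate
  rcases eq_or_ne u 0 with rfl | hu
  · simp
  obtain ⟨U, hU, rfl⟩ := hX.exists_field p u
  obtain ⟨W, hW, rfl⟩ := hX.exists_field p v
  have hG := hX.smooth_gradient hf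
  have h1 := hD.mvfderiv_inner (hG.mdiff p) (hW.mdiff p) (U p)
  have h2 := hD.mvfderiv_inner (hG.mdiff p) (hU.mdiff p) (W p)
  have e : ∀ V : (p : Y) → TangentSpace (𝓡 3) p,
      (fun q => mvfderiv (𝓡 3) f q (V q)) = lieD V f := fun _ => rfl
  simp only [hX.inner_gradient, e] at h1 h2
  have h3 := lieD_mlieBracket hU hW hU hf p
  rw [← sub_eq_zero, ← sub_smul, smul_eq_zero, or_iff_left hu] at h3
  unfold lieD at h1 h2 h3
  rw [← hD.sub_eq (hU.mdiff p) (hW.mdiff p), map_sub] at h3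
  rw [real_inner_comm]
  rw [real_inner_comm] at h2
  rw [real_inner_comm] at h1
  linarith

end LeviCivita

/-! ### Coordinate vector fields -/

section Coordinates

theorem extChartAt_symm_mem {x : Y} {z : E3} (hz : z ∈ (extChartAt (𝓡 3) x).target) :
    (extChartAt (𝓡 3) x).symm z ∈ (chartAt E3 x).source := by
  have := (extChartAt (𝓡 3) x).map_target hz
  rwa [extChartAt_source] at this

/-- The `i`-th coordinate vector field of the preferred chart around `x`. -/
def coordField (x : Y) (i : Fin 3) (q : Y) : TangentSpace (𝓡 3) q :=
  (trivializationAt E3 (TangentSpace (𝓡 3)) x).localFrame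
    (EuclideanSpace.basisFun (Fin 3) ℝ).toBasis i q

/-- The coefficients of a tangent vector in the basis of coordinate vectors. -/
def coordCoeff (x : Y) (i : Fin 3) (q : Y) : TangentSpace (𝓡 3) q →ₗ[ℝ] ℝ :=
  (trivializationAt E3 (TangentSpace (𝓡 3)) x).localFrameCoeff (𝓡 3)
    (EuclideanSpace.basisFun (Fin 3) ℝ).toBasis i q

theorem mem_baseSet_iff {x q : Y} :
    q ∈ (trivializationAt E3 (TangentSpace (𝓡 3)) x).baseSet ↔ q ∈ (chartAt E3 x).source := by
  rw [TangentBundle.trivializationAt_baseSet]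

theorem smoothFieldAt_coordField {x q : Y} (hq : q ∈ (chartAt E3 x).source) (i : Fin 3) :
    SmoothFieldAt (coordField x i) q :=
  contMDiffAt_localFrame_of_mem (n := ∞) _ _ i (mem_baseSet_iff.2 hq)

theorem coordField_eq {x q : Y} (hq : q ∈ (chartAt E3 x).source) (i : Fin 3) :
    coordField x i q = (trivializationAt E3 (TangentSpace (𝓡 3)) x).symmL ℝ q
      (EuclideanSpace.single i (1 : ℝ)) := by
  rw [coordField, Trivialization.localFrame_apply_of_mem_baseSet _ _ (mem_baseSet_iff.2 hq)]
  simp only [Trivialization.basisAt, Module.Basis.map_apply, OrthonormalBasis.coe_toBasis,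
    EuclideanSpace.basisFun_apply]
  exact (Trivialization.symmL_apply (R := ℝ) _ (mem_baseSet_iff.2 hq) _).symm

/-- The tangent vectors in the definition of `volumeDensity` are the coordinate vectors. -/
theorem mfderiv_extChartAt_symm_single {x : Y} {z : E3} (hz : z ∈ (extChartAt (𝓡 3) x).target)
    (i : Fin 3) :
    (mfderiv 𝓘(ℝ, E3) (𝓡 3) (extChartAt (𝓡 3) x).symm z (EuclideanSpace.single i (1 : ℝ) : E3)
      : TangentSpace (𝓡 3) ((extChartAt (𝓡 3) x).symm z))
      = coordField x i ((extChartAt (𝓡 3) x).symm z) := by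
  have hs := extChartAt_symm_mem hz
  rw [coordField_eq hs, TangentBundle.symmL_trivializationAt hs]
  have key : ∀ w : E3, w = z →
      (mfderiv 𝓘(ℝ, E3) (𝓡 3) (extChartAt (𝓡 3) x).symm z (EuclideanSpace.single i (1 : ℝ) : E3)
        : E3) = (mfderivWithin 𝓘(ℝ, E3) (𝓡 3) (extChartAt (𝓡 3) x).symm (range (𝓡 3)) w
        (EuclideanSpace.single i (1 : ℝ) : E3) : E3) := by
    rintro w rfl
    rw [ModelWithCorners.Boundaryless.range_eq_univ, mfderivWithin_univ]
  exact key _ ((extChartAt (𝓡 3) x).right_inv hz)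

theorem mfderiv_extChartAt_coordField {x q : Y} (hq : q ∈ (chartAt E3 x).source) (i : Fin 3) :
    (mfderiv (𝓡 3) 𝓘(ℝ, E3) (extChartAt (𝓡 3) x) q (coordField x i q) : E3)
      = EuclideanSpace.single i (1 : ℝ) := by
  rw [coordField_eq hq, ← TangentBundle.continuousLinearMapAt_trivializationAt hq]
  exact Trivialization.continuousLinearMapAt_symmL _ (mem_baseSet_iff.2 hq) _

theorem sum_coordCoeff {x q : Y} (hq : q ∈ (chartAt E3 x).source) (v : TangentSpace (𝓡 3) q) :
    ∑ i, coordCoeff x i q v • coordField x i q = v := by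
  have h := Trivialization.eq_sum_localFrameCoeff_smul (I := 𝓡 3)
    (e := trivializationAt E3 (TangentSpace (𝓡 3)) x)
    (b := (EuclideanSpace.basisFun (Fin 3) ℝ).toBasis)
    (s := FiberBundle.extend E3 v) (mem_baseSet_iff.2 hq)
  simp only [FiberBundle.extend_apply_self] at h
  exact h.symm

theorem smoothAt_coordCoeff {x q : Y} (hq : q ∈ (chartAt E3 x).source)
    {V : (p : Y) → TangentSpace (𝓡 3) p} (hV : SmoothFieldAt V q) (i : Fin 3) :
    ContMDiffAt (𝓡 3) 𝓘(ℝ, ℝ) ∞ (fun p => coordCoeff x i p (V p)) q :=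
  contMDiffAt_localFrameCoeff (k := ∞) (EuclideanSpace.basisFun (Fin 3) ℝ).toBasis
    (mem_baseSet_iff.2 hq) hV i

/-- The coordinate vectors as a basis. -/
def coordBasis {x q : Y} (hq : q ∈ (chartAt E3 x).source) :
    Module.Basis (Fin 3) ℝ (TangentSpace (𝓡 3) q) :=
  (trivializationAt E3 (TangentSpace (𝓡 3)) x).basisAt
    (EuclideanSpace.basisFun (Fin 3) ℝ).toBasis (mem_baseSet_iff.2 hq)

theorem coordBasis_apply {x q : Y} (hq : q ∈ (chartAt E3 x).source) (i : Fin 3) :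
    coordBasis hq i = coordField x i q := by
  rw [coordField, Trivialization.localFrame_apply_of_mem_baseSet _ _ (mem_baseSet_iff.2 hq)]
  rfl

theorem coordBasis_repr {x q : Y} (hq : q ∈ (chartAt E3 x).source) (v : TangentSpace (𝓡 3) q)
    (i : Fin 3) : (coordBasis hq).repr v i = coordCoeff x i q v := by
  have h : ∑ j, coordCoeff x j q v • coordBasis hq j = v := by
    simp only [coordBasis_apply]
    exact sum_coordCoeff hq v
  conv_lhs => rw [← h]
  exact (coordBasis hq).repr_sum_self (fun j => coordCoeff x j q v) ▸ rfl

/-- A constant vector field on the model space. -/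
def constField (v : E3) (z : E3) : TangentSpace 𝓘(ℝ, E3) z := v

theorem mlieBracket_constField (v w : E3) :
    VectorField.mlieBracket 𝓘(ℝ, E3) (constField v) (constField w) = fun _ => 0 := by
  rw [← VectorField.mlieBracketWithin_univ, VectorField.mlieBracketWithin_eq_lieBracketWithin]
  funext z
  exact (show VectorField.lieBracketWithin ℝ (fun _ : E3 => v) (fun _ : E3 => w) univ z = 0 by
    simp [VectorField.lieBracketWithin])

/-- Coordinate fields commute, being pulled back from constant fields by the chart. -/
theorem mlieBracket_coordField {x q : Y} (hq : q ∈ (chartAt E3 x).source) (i j : Fin 3) :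
    VectorField.mlieBracket (𝓡 3) (coordField x i) (coordField x j) q = 0 := by
  have hpb : ∀ i, VectorField.mpullback (𝓡 3) 𝓘(ℝ, E3) (extChartAt (𝓡 3) x)
      (constField (EuclideanSpace.single i (1 : ℝ))) =ᶠ[𝓝 q] coordField x i := by
    intro i
    filter_upwards [(chartAt E3 x).open_source.mem_nhds hq] with p hp
    have hp' : p ∈ (extChartAt (𝓡 3) x).source := by rwa [extChartAt_source]
    rw [VectorField.mpullback_apply]
    have hinv := isInvertible_mfderiv_extChartAt (I := 𝓡 3) hp'
    have h := mfderiv_extChartAt_coordField hp i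
    obtain ⟨e, he⟩ := hinv
    rw [← he] at h ⊢
    rw [ContinuousLinearMap.inverse_equiv]
    exact (e.symm_apply_eq).2 h.symm
  rw [← (hpb i).mlieBracket_vectorField_eq (hpb j)]
  have hchart : ContMDiffAt (𝓡 3) 𝓘(ℝ, E3) ∞ (extChartAt (𝓡 3) x) q :=
    contMDiffAt_extChartAt' hq
  have : IsManifold (𝓡 3) (minSmoothness ℝ 3) Y := by
    rw [minSmoothness_of_isRCLikeNormedField]; infer_instance
  have hc : ∀ (v : E3) (z : E3), MDifferentiableAt 𝓘(ℝ, E3) 𝓘(ℝ, E3).tangent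
      (fun w => (⟨w, constField v w⟩ : TangentBundle 𝓘(ℝ, E3) E3)) z := fun v z =>
    (contMDiffAt_vectorSpace_iff_contDiffAt.2 contDiffAt_const).mdifferentiableAt one_ne_zero
  rw [← VectorField.mpullback_mlieBracket (n := ∞) (hc _ _) (hc _ _) hchart
    (by rw [minSmoothness_of_isRCLikeNormedField]; exact ENat.LEInfty.out)]
  rw [VectorField.mpullback_apply]
  rw [mlieBracket_constField]
  exact map_zero _

/-- The derivative of a function along a coordinate line. -/
theorem hasDerivAt_comp_extChartAt_symm {x : Y} {z : E3} (hz : z ∈ (extChartAt (𝓡 3) x).target)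
    {f : Y → ℝ} (hf : MDifferentiableAt (𝓡 3) 𝓘(ℝ, ℝ) f ((extChartAt (𝓡 3) x).symm z))
    (i : Fin 3) :
    HasDerivAt (fun t : ℝ => f ((extChartAt (𝓡 3) x).symm
      (z + t • (EuclideanSpace.single i (1 : ℝ) : E3))))
      (mvfderiv (𝓡 3) f ((extChartAt (𝓡 3) x).symm z)
        (coordField x i ((extChartAt (𝓡 3) x).symm z))) 0 := by
  have h1 : MDifferentiableAt 𝓘(ℝ, E3) (𝓡 3) (extChartAt (𝓡 3) x).symm z := by
    have := mdifferentiableWithinAt_extChartAt_symm hz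
    rwa [ModelWithCorners.Boundaryless.range_eq_univ, mdifferentiableWithinAt_univ] at this
  have h2 := mvfderiv_comp_apply z hf h1 (EuclideanSpace.single i (1 : ℝ) : E3)
  have h3 : DifferentiableAt ℝ (f ∘ (extChartAt (𝓡 3) x).symm) z :=
    (hf.comp z h1).differentiableAt
  have h4 : mvfderiv 𝓘(ℝ, E3) (f ∘ (extChartAt (𝓡 3) x).symm) z
      = fderiv ℝ (f ∘ (extChartAt (𝓡 3) x).symm) z := mfderiv_eq_fderiv
  rw [h4, mfderiv_extChartAt_symm_single hz] at h2
  rw [← h2]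
  exact h3.hasFDerivAt.hasLineDerivAt _

end Coordinates

/-! ### The Riemannian density and the divergence in coordinates -/

section Density

/-- The Gram matrix `gᵢⱼ = ⟨∂ᵢ, ∂ⱼ⟩` of the coordinate vectors. -/
def coordGram (x q : Y) : Matrix (Fin 3) (Fin 3) ℝ :=
  Matrix.gram ℝ (fun i => coordField x i q)

/-- The density `√(det gᵢⱼ)`, as a function on the domain of the chart. -/
def coordDensity (x q : Y) : ℝ := Real.sqrt (coordGram x q).det

theorem volumeDensity_eq {x : Y} {z : E3} (hz : z ∈ (extChartAt (𝓡 3) x).target) :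
    volumeDensity x z = coordDensity x ((extChartAt (𝓡 3) x).symm z) := by
  unfold volumeDensity coordDensity coordGram
  simp only [mfderiv_extChartAt_symm_single hz]
  rfl

theorem det_coordGram_pos {x q : Y} (hq : q ∈ (chartAt E3 x).source) :
    0 < (coordGram x q).det := by
  refine (Matrix.posDef_gram_of_linearIndependent ?_).det_pos
  have := (coordBasis hq).linearIndependent
  rwa [show ⇑(coordBasis hq) = fun i => coordField x i q from funext (coordBasis_apply hq)] at this

theorem coordDensity_pos {x q : Y} (hq : q ∈ (chartAt E3 x).source) : 0 < coordDensity x q :=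
  Real.sqrt_pos.2 (det_coordGram_pos hq)

theorem smoothAt_coordGram {x q : Y} (hq : q ∈ (chartAt E3 x).source) (i j : Fin 3) :
    ContMDiffAt (𝓡 3) 𝓘(ℝ, ℝ) ∞ (fun p => coordGram x p i j) q :=
  ContMDiffAt.inner_bundle (smoothFieldAt_coordField hq i) (smoothFieldAt_coordField hq j)

theorem smoothAt_coordDensity {x q : Y} (hq : q ∈ (chartAt E3 x).source) :
    ContMDiffAt (𝓡 3) 𝓘(ℝ, ℝ) ∞ (coordDensity x) q := by
  have h := fun i j => smoothAt_coordGram hq i j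
  have hdet : ContMDiffAt (𝓡 3) 𝓘(ℝ, ℝ) ∞ (fun p => (coordGram x p).det) q := by
    simp only [Matrix.det_fin_three]
    exact ((((((h 0 0).mul (h 1 1)).mul (h 2 2)).sub (((h 0 0).mul (h 1 2)).mul (h 2 1))).sub
      (((h 0 1).mul (h 1 0)).mul (h 2 2))).add (((h 0 1).mul (h 1 2)).mul (h 2 0))).add
      (((h 0 2).mul (h 1 0)).mul (h 2 1)) |>.sub (((h 0 2).mul (h 1 1)).mul (h 2 0))
  exact (Real.contDiffAt_sqrt (det_coordGram_pos hq).ne').contMDiffAt.comp q hdet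

/-- Jacobi's formula for the derivative of a `3 × 3` determinant along `G' = ΓG + GΓᵀ`. -/
theorem hasDerivAt_det_fin_three {G : ℝ → Matrix (Fin 3) (Fin 3) ℝ} {Γ : Fin 3 → Fin 3 → ℝ} {t : ℝ}
    (hG : ∀ i j, HasDerivAt (fun s => G s i j)
      (∑ m, Γ i m * G t m j + ∑ m, Γ j m * G t i m) t) :
    HasDerivAt (fun s => (G s).det) (2 * (∑ i, Γ i i) * (G t).det) t := by
  simp only [Matrix.det_fin_three]
  have h := hG
  refine (((((((h 0 0).mul (h 1 1)).mul (h 2 2)).sub (((h 0 0).mul (h 1 2)).mul (h 2 1))).sub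
      (((h 0 1).mul (h 1 0)).mul (h 2 2))).add (((h 0 1).mul (h 1 2)).mul (h 2 0))).add
      (((h 0 2).mul (h 1 0)).mul (h 2 1)) |>.sub (((h 0 2).mul (h 1 1)).mul (h 2 0))).congr_deriv ?_
  simp only [Fin.sum_univ_three, Pi.mul_apply]
  ring

variable {D : TangentConnection Y}

/-- The divergence of a vector field, the trace of its covariant derivative. -/
def divergence (D : TangentConnection Y)
    (V : (p : Y) → TangentSpace (𝓡 3) p) (p : Y) : ℝ :=
  LinearMap.trace ℝ (TangentSpace (𝓡 3) p) (D V p : _ →ₗ[ℝ] _)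

theorem trace_eq_sum_coordCoeff {x q : Y} (hq : q ∈ (chartAt E3 x).source)
    (L : TangentSpace (𝓡 3) q →ₗ[ℝ] TangentSpace (𝓡 3) q) :
    LinearMap.trace ℝ (TangentSpace (𝓡 3) q) L
      = ∑ i, coordCoeff x i q (L (coordField x i q)) := by
  rw [LinearMap.trace_eq_matrix_trace ℝ (coordBasis hq)]
  simp [Matrix.trace, LinearMap.toMatrix_apply, coordBasis_repr, coordBasis_apply]

theorem IsLeviCivita.coordField_symm (hD : IsLeviCivita D) {x q : Y}
    (hq : q ∈ (chartAt E3 x).source) (i j : Fin 3) :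
    D (coordField x i) q (coordField x j q) = D (coordField x j) q (coordField x i q) := by
  have h := hD.sub_eq (smoothFieldAt_coordField hq i).mdiff (smoothFieldAt_coordField hq j).mdiff
  rw [mlieBracket_coordField hq, sub_eq_zero] at h
  exact h.symm

theorem coordCoeff_coordField {x q : Y} (hq : q ∈ (chartAt E3 x).source) (i j : Fin 3) :
    coordCoeff x i q (coordField x j q) = if j = i then 1 else 0 := by
  rw [← coordBasis_repr hq, ← coordBasis_apply hq, Module.Basis.repr_self, Finsupp.single_apply]

/-- `∂ᵢ √g = √g div ∂ᵢ`. -/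
theorem IsLeviCivita.hasDerivAt_coordDensity (hD : IsLeviCivita D) {x : Y} {z : E3}
    (hz : z ∈ (extChartAt (𝓡 3) x).target) (i : Fin 3) :
    HasDerivAt (fun t : ℝ => coordDensity x ((extChartAt (𝓡 3) x).symm
      (z + t • (EuclideanSpace.single i (1 : ℝ) : E3))))
      (coordDensity x ((extChartAt (𝓡 3) x).symm z)
        * divergence D (coordField x i) ((extChartAt (𝓡 3) x).symm z)) 0 := by
  have hq := extChartAt_symm_mem hz
  set q := (extChartAt (𝓡 3) x).symm z with hqdef
  -- the Christoffel symbols `Γⱼᵐ` of `∇_{∂ᵢ} ∂ⱼ = ∑ₘ Γⱼᵐ ∂ₘ`, for fixed `i`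
  let Γ : Fin 3 → Fin 3 → ℝ := fun j m => coordCoeff x m q (D (coordField x j) q (coordField x i q))
  have hΓ : ∀ j, D (coordField x j) q (coordField x i q) = ∑ m, Γ j m • coordField x m q := fun j =>
    (sum_coordCoeff hq _).symm
  have hG : ∀ j k, HasDerivAt (fun t : ℝ => coordGram x ((extChartAt (𝓡 3) x).symm
      (z + t • (EuclideanSpace.single i (1 : ℝ) : E3))) j k)
      (∑ m, Γ j m * coordGram x ((extChartAt (𝓡 3) x).symm
      (z + (0 : ℝ) • (EuclideanSpace.single i (1 : ℝ) : E3))) m k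
        + ∑ m, Γ k m * coordGram x ((extChartAt (𝓡 3) x).symm
      (z + (0 : ℝ) • (EuclideanSpace.single i (1 : ℝ) : E3))) j m) 0 := by
    intro j k
    have h := hasDerivAt_comp_extChartAt_symm hz
      ((smoothAt_coordGram hq j k).mdifferentiableAt (by simp)) i
    refine h.congr_deriv ?_
    rw [zero_smul, add_zero, ← hqdef]
    have h2 := hD.mvfderiv_inner (smoothFieldAt_coordField hq j).mdiff
      (smoothFieldAt_coordField hq k).mdiff (coordField x i q)
    rw [hΓ, hΓ, sum_inner, inner_sum] at h2
    simp only [inner_smul_left, inner_smul_right] at h2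
    exact h2
  have hdet := hasDerivAt_det_fin_three hG
  rw [zero_smul, add_zero, ← hqdef] at hdet
  have hpos := det_coordGram_pos hq
  have hs := hdet.sqrt (by rw [zero_smul, add_zero, ← hqdef]; exact hpos.ne')
  refine hs.congr_deriv ?_
  rw [zero_smul, add_zero, ← hqdef]
  -- the trace of `Γ` is that of `∇ ∂ᵢ`, because `∇_{∂ᵢ} ∂ⱼ = ∇_{∂ⱼ} ∂ᵢ`
  have htr : ∑ j, Γ j j = divergence D (coordField x i) q := by
    rw [divergence, trace_eq_sum_coordCoeff hq]
    refine Finset.sum_congr rfl fun j _ => ?_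
    simp only [Γ]
    rw [hD.coordField_symm hq]
    rfl
  rw [htr]
  unfold coordDensity
  have h3 := Real.sqrt_pos.2 hpos
  have h4 := Real.sq_sqrt hpos.le
  rw [div_eq_iff (by positivity)]
  linear_combination (-2 * divergence D (coordField x i) q) * h4

/-- The divergence in coordinates: `√g div V = ∑ᵢ ∂ᵢ (√g Vⁱ)`. -/
theorem IsLeviCivita.hasDerivAt_coord (hD : IsLeviCivita D) {x : Y} {z : E3}
    (hz : z ∈ (extChartAt (𝓡 3) x).target) {V : (p : Y) → TangentSpace (𝓡 3) p}
    (hV : IsSmoothVectorField V) :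
    ∃ d : Fin 3 → ℝ, (∀ i, HasDerivAt (fun t : ℝ =>
      (fun q => coordCoeff x i q (V q) * coordDensity x q) ((extChartAt (𝓡 3) x).symm
      (z + t • (EuclideanSpace.single i (1 : ℝ) : E3)))) (d i) 0) ∧
      ∑ i, d i = coordDensity x ((extChartAt (𝓡 3) x).symm z)
        * divergence D V ((extChartAt (𝓡 3) x).symm z) := by
  have hq := extChartAt_symm_mem hz
  set q := (extChartAt (𝓡 3) x).symm z with hqdef
  have hc : ∀ i, MDifferentiableAt (𝓡 3) 𝓘(ℝ, ℝ) (fun p => coordCoeff x i p (V p)) q := fun i =>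
    (smoothAt_coordCoeff hq hV.contMDiffAt i).mdifferentiableAt (by simp)
  let c : Fin 3 → Y → ℝ := fun i p => coordCoeff x i p (V p)
  refine ⟨fun i => mvfderiv (𝓡 3) (c i) q (coordField x i q) * coordDensity x q
    + c i q * (coordDensity x q * divergence D (coordField x i) q), fun i => ?_, ?_⟩
  · have h1 := hasDerivAt_comp_extChartAt_symm (f := c i) hz (hc i) i
    refine (h1.mul (hD.hasDerivAt_coordDensity hz i)).congr_deriv ?_
    rw [zero_smul, add_zero]
  -- the Leibniz rule for `V = ∑ᵢ Vⁱ ∂ᵢ`, which holds near `q` only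
  have hloc : D V q = ∑ i, (coordCoeff x i q (V q) • D (coordField x i) q
      + (mvfderiv (𝓡 3) (fun p => coordCoeff x i p (V p)) q).smulRight (coordField x i q)) := by
    have hcov := D.isCovariantDerivativeOnUniv
    have hterm : ∀ i, MDifferentiableAt (𝓡 3) (𝓡 3).tangent (fun p =>
        (⟨p, ((fun p => coordCoeff x i p (V p)) • coordField x i) p⟩ : TangentBundle (𝓡 3) Y)) q :=
      fun i => (ContMDiffAt.smul_section (smoothAt_coordCoeff hq hV.contMDiffAt i)
        (smoothFieldAt_coordField hq i)).mdifferentiableAt (by simp)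
    have h12 := fun i => hcov.leibniz (smoothFieldAt_coordField hq i).mdiff (hc i)
    have hsum : MDifferentiableAt (𝓡 3) (𝓡 3).tangent (fun p =>
        (⟨p, ((fun p => coordCoeff x 0 p (V p)) • coordField x 0
          + ((fun p => coordCoeff x 1 p (V p)) • coordField x 1)) p⟩ : TangentBundle (𝓡 3) Y)) q :=
      mdifferentiableAt_add_section (hterm 0) (hterm 1)
    have hsum' : MDifferentiableAt (𝓡 3) (𝓡 3).tangent (fun p =>
        (⟨p, ((fun p => coordCoeff x 0 p (V p)) • coordField x 0
          + ((fun p => coordCoeff x 1 p (V p)) • coordField x 1)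
          + ((fun p => coordCoeff x 2 p (V p)) • coordField x 2)) p⟩ : TangentBundle (𝓡 3) Y)) q :=
      mdifferentiableAt_add_section hsum (hterm 2)
    rw [hcov.congr_of_eventuallyEq (hV.mdiff q) hsum' univ_mem (by
      filter_upwards [(chartAt E3 x).open_source.mem_nhds hq] with p hp
      conv_lhs => rw [← sum_coordCoeff hp (V p), Fin.sum_univ_three]
      rfl), hcov.add hsum (hterm 2), hcov.add (hterm 0) (hterm 1), h12, h12, h12,
      Fin.sum_univ_three]
  rw [divergence, hloc]
  simp only [trace_eq_sum_coordCoeff hq, ContinuousLinearMap.coe_coe, sum_apply,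
    add_apply, smul_apply, map_sum, map_add, map_smul,
    ContinuousLinearMap.smulRight_apply, coordCoeff_coordField hq, divergence, smul_eq_mul]
  simp only [Fin.sum_univ_three, c]
  simp
  ring

end Density

section Measure

variable [CompactSpace Y] [Nonempty Y] [MeasurableSpace Y] [BorelSpace Y]

/-! ### The Riemannian volume in a chart -/

section Volume

theorem measurableSet_extChartAt_target (x : Y) : MeasurableSet (extChartAt (𝓡 3) x).target :=
  (isOpen_extChartAt_target x).measurableSet

theorem continuousOn_volumeDensity (x : Y) :
    ContinuousOn (volumeDensity x) (extChartAt (𝓡 3) x).target := by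
  have h : ContinuousOn (fun z => coordDensity x ((extChartAt (𝓡 3) x).symm z))
      (extChartAt (𝓡 3) x).target := by
    intro z hz
    exact (smoothAt_coordDensity (extChartAt_symm_mem hz)).continuousAt.comp_continuousWithinAt
      (continuousOn_extChartAt_symm x z hz)
  exact h.congr fun z hz => volumeDensity_eq hz

theorem aemeasurable_volumeDensity (x : Y) :
    AEMeasurable (fun z => ENNReal.ofReal (volumeDensity x z))
      (volume.restrict (extChartAt (𝓡 3) x).target) :=
  (((continuousOn_volumeDensity x).aemeasurable (measurableSet_extChartAt_target x))).ennreal_ofReal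

theorem aemeasurable_extChartAt_symm (x : Y) :
    AEMeasurable (extChartAt (𝓡 3) x).symm
      ((volume.restrict (extChartAt (𝓡 3) x).target).withDensity
        (fun z => ENNReal.ofReal (volumeDensity x z))) :=
  ((continuousOn_extChartAt_symm x).aemeasurable (measurableSet_extChartAt_target x)).mono_ac
    (withDensity_absolutelyContinuous _ _)

theorem chartVolume_apply (x : Y) {s : Set Y} (hs : MeasurableSet s) :
    chartVolume x s = ∫⁻ z in (extChartAt (𝓡 3) x).symm ⁻¹' s ∩ (extChartAt (𝓡 3) x).target,
      ENNReal.ofReal (volumeDensity x z) := by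
  rw [chartVolume, Measure.map_apply_of_aemeasurable (aemeasurable_extChartAt_symm x) hs,
    withDensity_apply', Measure.restrict_restrict' (measurableSet_extChartAt_target x)]

theorem measurableSet_preimage_extChartAt_symm (x : Y) {s : Set Y} (hs : MeasurableSet s) :
    MeasurableSet ((extChartAt (𝓡 3) x).symm ⁻¹' s ∩ (extChartAt (𝓡 3) x).target) := by
  have h := (continuousOn_iff_continuous_domRestrict.1
    (continuousOn_extChartAt_symm (I := 𝓡 3) x)).measurable hs
  have h2 := (measurableSet_extChartAt_target x).subtype_image h
  convert h2 using 1
  ext z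
  simp

/-- The change of variables formula for the densities of two charts. -/
theorem coordDensity_change {x y : Y} {z : E3} (hz : z ∈ (extChartAt (𝓡 3) x).target)
    (hy : (extChartAt (𝓡 3) x).symm z ∈ (chartAt E3 y).source) :
    HasFDerivAt (extChartAt (𝓡 3) y ∘ (extChartAt (𝓡 3) x).symm)
      (fderiv ℝ (extChartAt (𝓡 3) y ∘ (extChartAt (𝓡 3) x).symm) z) z ∧
    coordDensity x ((extChartAt (𝓡 3) x).symm z) =
      |(fderiv ℝ (extChartAt (𝓡 3) y ∘ (extChartAt (𝓡 3) x).symm) z).det|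
        * coordDensity y ((extChartAt (𝓡 3) x).symm z) := by
  have hq := extChartAt_symm_mem hz
  have h1 : MDifferentiableAt 𝓘(ℝ, E3) (𝓡 3) (extChartAt (𝓡 3) x).symm z := by
    have := mdifferentiableWithinAt_extChartAt_symm hz
    rwa [ModelWithCorners.Boundaryless.range_eq_univ, mdifferentiableWithinAt_univ] at this
  have h2 : MDifferentiableAt (𝓡 3) 𝓘(ℝ, E3) (extChartAt (𝓡 3) y) ((extChartAt (𝓡 3) x).symm z) :=
    mdifferentiableAt_extChartAt hy
  have h3 : DifferentiableAt ℝ (extChartAt (𝓡 3) y ∘ (extChartAt (𝓡 3) x).symm) z :=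
    (h2.comp z h1).differentiableAt
  refine ⟨h3.hasFDerivAt, ?_⟩
  set T : E3 →L[ℝ] E3 := fderiv ℝ (extChartAt (𝓡 3) y ∘ (extChartAt (𝓡 3) x).symm) z with hT
  set q := (extChartAt (𝓡 3) x).symm z with hqdef
  have hTi : ∀ i, T (EuclideanSpace.single i (1 : ℝ))
      = (mfderiv (𝓡 3) 𝓘(ℝ, E3) (extChartAt (𝓡 3) y) q (coordField x i q) : E3) := by
    intro i
    have h4 := mfderiv_comp_apply (f := (extChartAt (𝓡 3) x).symm) (g := extChartAt (𝓡 3) y) z h2 h1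
      (EuclideanSpace.single i (1 : ℝ) : E3)
    rw [mfderiv_extChartAt_symm_single hz, mfderiv_eq_fderiv] at h4
    exact h4
  -- the Jacobian matrix `M` of the transition map relates the Gram matrices by `G_x = Mᵀ G_y M`
  let M : Matrix (Fin 3) (Fin 3) ℝ := Matrix.of fun j i => coordCoeff y j q (coordField x i q)
  have hM : ∀ i, coordField x i q = ∑ j, M j i • coordField y j q := fun i =>
    (sum_coordCoeff hy _).symm
  have hdet : T.det = M.det := by
    have h5 := LinearMap.det_toMatrix (EuclideanSpace.basisFun (Fin 3) ℝ).toBasis (T : E3 →ₗ[ℝ] E3)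
    rw [ContinuousLinearMap.det, ← h5]
    congr 1
    ext j i
    rw [LinearMap.toMatrix_apply]
    simp only [OrthonormalBasis.coe_toBasis, EuclideanSpace.basisFun_apply,
      ContinuousLinearMap.coe_coe, OrthonormalBasis.coe_toBasis_repr_apply,
      EuclideanSpace.basisFun_repr]
    rw [hTi, hM]
    have h6 : (mfderiv (𝓡 3) 𝓘(ℝ, E3) (extChartAt (𝓡 3) y) q (∑ j, M j i • coordField y j q) : E3)
        = ∑ j, M j i • (EuclideanSpace.single j (1 : ℝ) : E3) := by
      rw [map_sum]
      refine Finset.sum_congr rfl fun j _ => ?_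
      rw [map_smul]
      exact congrArg (fun w : E3 => M j i • w) (mfderiv_extChartAt_coordField hy j)
    rw [h6]
    simp [Finset.sum_apply, Pi.single_apply]
  have hG : coordGram x q = M.transpose * coordGram y q * M := by
    ext i k
    have h7 : coordGram x q i k = ⟪coordField x i q, coordField x k q⟫_ℝ := rfl
    rw [h7, hM i, hM k, sum_inner]
    simp only [inner_sum, inner_smul_left, inner_smul_right, Matrix.mul_apply, Finset.sum_mul,
      Matrix.transpose_apply]
    rw [Finset.sum_comm]
    refine Finset.sum_congr rfl fun j _ => Finset.sum_congr rfl fun l _ => ?_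
    simp only [coordGram, Matrix.gram_apply]
    simp
    ring
  unfold coordDensity
  rw [hG, Matrix.det_mul, Matrix.det_mul, Matrix.det_transpose, hdet,
    show M.det * (coordGram y q).det * M.det = M.det ^ 2 * (coordGram y q).det by ring,
    Real.sqrt_mul (sq_nonneg _), Real.sqrt_sq_eq_abs]

/-- The volumes defined by two charts agree on the overlap. -/
theorem chartVolume_eq_chartVolume {x y : Y} {s : Set Y} (hs : MeasurableSet s)
    (hx : s ⊆ (chartAt E3 x).source) (hy : s ⊆ (chartAt E3 y).source) :
    chartVolume x s = chartVolume y s := by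
  have himg : (extChartAt (𝓡 3) y).symm ⁻¹' s ∩ (extChartAt (𝓡 3) y).target
      = (extChartAt (𝓡 3) y ∘ (extChartAt (𝓡 3) x).symm) ''
        ((extChartAt (𝓡 3) x).symm ⁻¹' s ∩ (extChartAt (𝓡 3) x).target) := by
    ext w
    constructor
    · rintro ⟨hw, hwt⟩
      have hwx : (extChartAt (𝓡 3) y).symm w ∈ (extChartAt (𝓡 3) x).source := by
        rw [extChartAt_source]; exact hx hw
      refine ⟨extChartAt (𝓡 3) x ((extChartAt (𝓡 3) y).symm w),
        ⟨?_, (extChartAt (𝓡 3) x).map_source hwx⟩, ?_⟩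
      · rw [mem_preimage, (extChartAt (𝓡 3) x).left_inv hwx]; exact hw
      · rw [Function.comp_apply, (extChartAt (𝓡 3) x).left_inv hwx, (extChartAt (𝓡 3) y).right_inv
          hwt]
    · rintro ⟨z, ⟨hz, hzt⟩, rfl⟩
      have hzy : (extChartAt (𝓡 3) x).symm z ∈ (extChartAt (𝓡 3) y).source := by
        rw [extChartAt_source]; exact hy hz
      refine ⟨?_, (extChartAt (𝓡 3) y).map_source hzy⟩
      rw [mem_preimage, Function.comp_apply, (extChartAt (𝓡 3) y).left_inv hzy]; exact hz
  have hinj : InjOn (extChartAt (𝓡 3) y ∘ (extChartAt (𝓡 3) x).symm)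
      ((extChartAt (𝓡 3) x).symm ⁻¹' s ∩ (extChartAt (𝓡 3) x).target) := by
    rintro z ⟨hz, hzt⟩ w ⟨hw, hwt⟩ h
    refine (extChartAt (𝓡 3) x).symm.injOn hzt hwt ((extChartAt (𝓡 3) y).injOn ?_ ?_ h)
    · rw [extChartAt_source]; exact hy hz
    · rw [extChartAt_source]; exact hy hw
  have hmeas := measurableSet_preimage_extChartAt_symm x hs
  rw [chartVolume_apply x hs, chartVolume_apply y hs, himg,
    lintegral_image_eq_lintegral_abs_det_fderiv_mul volume hmeas
      (fun z hz => (coordDensity_change hz.2 (hy hz.1)).1.hasFDerivWithinAt) hinj]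
  refine setLIntegral_congr_fun hmeas fun z hz => ?_
  have hzy : (extChartAt (𝓡 3) x).symm z ∈ (extChartAt (𝓡 3) y).source := by
    rw [extChartAt_source]; exact hy hz.1
  simp only [Function.comp_apply]
  rw [volumeDensity_eq hz.2, volumeDensity_eq ((extChartAt (𝓡 3) y).map_source hzy),
    (extChartAt (𝓡 3) y).left_inv hzy, ← ENNReal.ofReal_mul (abs_nonneg _)]
  exact congrArg _ (coordDensity_change hz.2 (hy hz.1)).2

/-- The volume of a set contained in a chart can be computed in that chart, whichever charts were
used to define the measure. -/
theorem riemannianVolume_apply {x : Y} {s : Set Y} (hs : MeasurableSet s)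
    (hx : s ⊆ (chartAt E3 x).source) : riemannianVolume Y s = chartVolume x s := by
  rw [riemannianVolume]
  set xs := (exists_chart_cover Y).choose with hxs
  have hcov : ⋃ n, (chartAt E3 (xs n)).source = univ := (exists_chart_cover Y).choose_spec
  have hd : ∀ n, MeasurableSet (disjointed (fun k => (chartAt E3 (xs k)).source) n) := fun n =>
    MeasurableSet.disjointed (fun k => (chartAt E3 (xs k)).open_source.measurableSet) n
  rw [Measure.sum_apply _ hs]
  have h1 : ∀ n, ((chartVolume (xs n)).restrict
      (disjointed (fun k => (chartAt E3 (xs k)).source) n)) s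
      = chartVolume x (s ∩ disjointed (fun k => (chartAt E3 (xs k)).source) n) := fun n => by
    rw [Measure.restrict_apply hs]
    exact chartVolume_eq_chartVolume (hs.inter (hd n))
      (inter_subset_right.trans (disjointed_subset _ n)) (inter_subset_left.trans hx)
  simp only [h1]
  rw [← measure_iUnion (fun i j hij => ((disjoint_disjointed _ hij).mono inter_subset_right
    inter_subset_right)) (fun n => hs.inter (hd n)), ← inter_iUnion, iUnion_disjointed, hcov,
    inter_univ]

end Volume

/-! ### Integration over `Y` and the divergence theorem -/

section Integration

instance instIsFiniteMeasureRiemannianVolume : IsFiniteMeasure (riemannianVolume Y) := by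
  -- the density is bounded near every point, so the measure is locally finite on a compact space
  have hloc : IsLocallyFiniteMeasure (riemannianVolume Y) := by
    refine ⟨fun x => ?_⟩
    have hz := mem_extChartAt_target (I := 𝓡 3) x
    obtain ⟨K, hK, hKn, hKt⟩ := exists_mem_nhds_isCompact_mapsTo
      (f := fun z : E3 => z) continuous_id
      ((isOpen_extChartAt_target (I := 𝓡 3) x).mem_nhds hz)
    have hU : (chartAt E3 x).source ∩ extChartAt (𝓡 3) x ⁻¹' (interior K) ∈ 𝓝 x :=
      inter_mem (chart_source_mem_nhds E3 x)
        ((continuousAt_extChartAt x).preimage_mem_nhds (interior_mem_nhds.2 hK))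
    obtain ⟨U, hUs, hUo, hxU⟩ := mem_nhds_iff.1 hU
    refine ⟨U, hUo.mem_nhds hxU, ?_⟩
    rw [riemannianVolume_apply hUo.measurableSet (hUs.trans inter_subset_left),
      chartVolume_apply x hUo.measurableSet]
    obtain ⟨C, hC⟩ := hKn.bddAbove_image ((continuousOn_volumeDensity x).mono hKt)
    have hsub : (extChartAt (𝓡 3) x).symm ⁻¹' U ∩ (extChartAt (𝓡 3) x).target ⊆ K := by
      rintro z ⟨hz1, hz2⟩
      have h := (hUs hz1).2
      rw [mem_preimage, (extChartAt (𝓡 3) x).right_inv hz2] at h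
      exact interior_subset h
    calc ∫⁻ z in (extChartAt (𝓡 3) x).symm ⁻¹' U ∩ (extChartAt (𝓡 3) x).target,
          ENNReal.ofReal (volumeDensity x z)
        ≤ ∫⁻ z in K, ENNReal.ofReal (volumeDensity x z) := lintegral_mono_set hsub
      _ ≤ ∫⁻ z in K, ENNReal.ofReal C := setLIntegral_mono' hKn.measurableSet
          fun z hz => ENNReal.ofReal_le_ofReal (hC (mem_image_of_mem _ hz))
      _ < ⊤ := by
          rw [setLIntegral_const]
          exact ENNReal.mul_lt_top ENNReal.ofReal_lt_top hKn.measure_lt_top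
  exact ⟨isCompact_univ.measure_lt_top⟩

instance instIsOpenPosMeasureRiemannianVolume : (riemannianVolume Y).IsOpenPosMeasure := by
  refine ⟨fun U hU hne h0 => ?_⟩
  obtain ⟨x, hx⟩ := hne
  have hVo : IsOpen (U ∩ (chartAt E3 x).source) := hU.inter (chartAt E3 x).open_source
  have h1 : riemannianVolume Y (U ∩ (chartAt E3 x).source) = 0 :=
    measure_mono_null inter_subset_left h0
  rw [riemannianVolume_apply hVo.measurableSet inter_subset_right,
    chartVolume_apply x hVo.measurableSet] at h1
  set A := (extChartAt (𝓡 3) x).symm ⁻¹' (U ∩ (chartAt E3 x).source)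
    ∩ (extChartAt (𝓡 3) x).target with hA
  have hAo : IsOpen A := by
    rw [hA, inter_comm]
    exact (continuousOn_extChartAt_symm x).isOpen_inter_preimage (isOpen_extChartAt_target x) hVo
  have hxA : extChartAt (𝓡 3) x x ∈ A := by
    refine ⟨?_, mem_extChartAt_target x⟩
    rw [mem_preimage, extChartAt_to_inv]
    exact ⟨hx, mem_chart_source E3 x⟩
  rw [lintegral_eq_zero_iff' ((aemeasurable_volumeDensity x).mono_measure
    (Measure.restrict_mono inter_subset_right le_rfl))] at h1
  have h2 : ∀ᵐ z ∂(volume.restrict A), False := by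
    filter_upwards [h1, ae_restrict_mem hAo.measurableSet] with z hz hzA
    rw [volumeDensity_eq hzA.2] at hz
    exact (coordDensity_pos (extChartAt_symm_mem hzA.2)).not_ge (ENNReal.ofReal_eq_zero.1 hz)
  rw [ae_iff] at h2
  simp only [not_false_eq_true, ofPred_true, Measure.restrict_apply_univ] at h2
  exact (hAo.measure_pos volume ⟨_, hxA⟩).ne' h2

theorem restrict_riemannianVolume (x : Y) :
    (riemannianVolume Y).restrict (chartAt E3 x).source
      = (chartVolume x).restrict (chartAt E3 x).source := by
  have hm := (chartAt E3 x).open_source.measurableSet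
  ext s hs
  rw [Measure.restrict_apply hs, Measure.restrict_apply hs,
    riemannianVolume_apply (hs.inter hm) inter_subset_right]

theorem integral_eq_integral_chart {x : Y} {f : Y → ℝ} (hf : Continuous f)
    (h0 : ∀ q, q ∉ (chartAt E3 x).source → f q = 0) :
    ∫ q, f q ∂(riemannianVolume Y) = ∫ z in (extChartAt (𝓡 3) x).target,
      coordDensity x ((extChartAt (𝓡 3) x).symm z) * f ((extChartAt (𝓡 3) x).symm z) := by
  rw [← setIntegral_eq_integral_of_forall_compl_eq_zero h0, restrict_riemannianVolume,
    setIntegral_eq_integral_of_forall_compl_eq_zero h0, chartVolume,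
    integral_map (aemeasurable_extChartAt_symm x) hf.aestronglyMeasurable,
    integral_withDensity_eq_integral_toReal_smul₀ (aemeasurable_volumeDensity x)
      (Eventually.of_forall fun z => ENNReal.ofReal_lt_top)]
  refine setIntegral_congr_fun (measurableSet_extChartAt_target x) fun z hz => ?_
  simp only [smul_eq_mul]
  rw [volumeDensity_eq hz, ENNReal.toReal_ofReal (coordDensity_pos (extChartAt_symm_mem hz)).le]

theorem Continuous.integrable_riemannianVolume {F : Type*} [NormedAddCommGroup F] {f : Y → F}
    [SecondCountableTopologyEither Y F]
    (hf : Continuous f) : Integrable f (riemannianVolume Y) := by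
  obtain ⟨C, hC⟩ := (isCompact_range hf).isBounded.exists_norm_le
  exact Integrable.of_bound hf.aestronglyMeasurable C
    (Eventually.of_forall fun q => hC _ (mem_range_self q))

/-- The integral of a directional derivative of a compactly supported function vanishes. -/
theorem integral_fderiv_apply_eq_zero {F : E3 → ℝ} (hF : ContDiff ℝ 1 F) (hc : HasCompactSupport F)
    (v : E3) : ∫ z, fderiv ℝ F z v = 0 := by
  have hd : Continuous fun z => fderiv ℝ F z v :=
    (hF.continuous_fderiv one_ne_zero).clm_apply continuous_const
  have hdc : HasCompactSupport fun z => fderiv ℝ F z v := hc.fderiv_apply ℝ v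
  have h := integral_bilinear_hasLineDerivAt_right_eq_neg_left_of_integrable (μ := volume)
    (f := fun _ : E3 => (1 : ℝ)) (f' := fun _ => 0) (g := F) (g' := fun z => fderiv ℝ F z v)
    (v := v) (B := ContinuousLinearMap.mul ℝ ℝ) (by simp)
    (by simpa using hd.integrable_of_hasCompactSupport hdc)
    (by simpa using hF.continuous.integrable_of_hasCompactSupport hc)
    (fun z _ => by
      have := (hasFDerivAt_const (𝕜 := ℝ) (1 : ℝ) z).hasLineDerivAt v
      simpa using this)
    (fun z _ => ((hF.differentiable one_ne_zero) z).hasFDerivAt.hasLineDerivAt v)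
  simpa using h

variable {D : TangentConnection Y}

/-- The divergence in a Parseval frame, which shows that it is smooth. -/
theorem IsLeviCivita.smooth_divergence (hD : IsLeviCivita D) {n : ℕ}
    {X : Fin n → (p : Y) → TangentSpace (𝓡 3) p} (hX : IsParsevalFrame X)
    {V : (p : Y) → TangentSpace (𝓡 3) p} (hV : IsSmoothVectorField V) :
    divergence D V = (fun p => ∑ k, ⟪D V p (X k p), X k p⟫_ℝ) ∧ SmoothFun (divergence D V) := by
  have h : divergence D V = (fun p => ∑ k, ⟪D V p (X k p), X k p⟫_ℝ) := by
    funext p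
    rw [divergence, LinearMap.trace_eq_sum_inner _ (orthoBasis p)]
    let B : TangentSpace (𝓡 3) p →ₗ[ℝ] TangentSpace (𝓡 3) p →ₗ[ℝ] ℝ :=
      (innerₗ (TangentSpace (𝓡 3) p)).comp (D V p : _ →ₗ[ℝ] _)
    have h1 := hX.sum_orthonormalBasis (orthoBasis p) B
    exact (Finset.sum_congr rfl fun i _ => real_inner_comm _ _).trans h1
  refine ⟨h, ?_⟩
  rw [h]
  exact ContMDiff.sum fun k _ => (hD.smooth hX (hX.smooth k) hV).inner (hX.smooth k)

theorem divergence_eq_zero_of_eventually_eq_zero {V : (p : Y) → TangentSpace (𝓡 3) p}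
    (hV : IsSmoothVectorField V) {p : Y} (hp : ∀ᶠ q in 𝓝 p, V q = 0) : divergence D V p = 0 := by
  have h : D V p = 0 := by
    rw [D.isCovariantDerivativeOnUniv.congr_of_eventuallyEq (σ' := 0) (hV.mdiff p)
      (isSmoothVectorField_zero.mdiff p) univ_mem hp]
    exact congrFun D.zero p
  rw [divergence, h]
  simp

/-- The divergence theorem for a vector field supported in a chart: in coordinates, the integrand is
a sum of partial derivatives of the compactly supported functions `√g Vⁱ`. -/
theorem integral_divergence_chart (hD : IsLeviCivita D) {n : ℕ}
    {X : Fin n → (p : Y) → TangentSpace (𝓡 3) p} (hX : IsParsevalFrame X)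
    {V : (p : Y) → TangentSpace (𝓡 3) p} (hV : IsSmoothVectorField V) {x : Y} {K : Set Y}
    (hK : IsClosed K) (hKs : K ⊆ (chartAt E3 x).source) (hVK : ∀ q, q ∉ K → V q = 0) :
    ∫ q, divergence D V q ∂(riemannianVolume Y) = 0 := by
  classical
  have hcont : Continuous (divergence D V) := (hD.smooth_divergence hX hV).2.continuous
  have hev : ∀ q, q ∉ K → ∀ᶠ p in 𝓝 q, V p = 0 := fun q hq => by
    filter_upwards [hK.isOpen_compl.mem_nhds hq] with p hp using hVK p hp
  rw [integral_eq_integral_chart (x := x) hcont fun q hq =>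
    divergence_eq_zero_of_eventually_eq_zero hV (hev q fun h => hq (hKs h))]
  set T := (extChartAt (𝓡 3) x).target with hT
  have hTo : IsOpen T := isOpen_extChartAt_target x
  -- the coefficients `√g Vⁱ`, extended by zero
  let g : Fin 3 → Y → ℝ := fun i q => coordCoeff x i q (V q) * coordDensity x q
  let F : Fin 3 → E3 → ℝ := fun i z => if z ∈ T then g i ((extChartAt (𝓡 3) x).symm z) else 0
  have hKc : IsCompact (extChartAt (𝓡 3) x '' K) := by
    refine hK.isCompact.image_of_continuousOn ((continuousOn_extChartAt x).mono ?_)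
    rw [extChartAt_source]; exact hKs
  have hKT : extChartAt (𝓡 3) x '' K ⊆ T := by
    rintro _ ⟨q, hq, rfl⟩
    exact (extChartAt (𝓡 3) x).map_source (by rw [extChartAt_source]; exact hKs hq)
  have hF0 : ∀ i z, z ∉ extChartAt (𝓡 3) x '' K → F i z = 0 := by
    intro i z hz
    by_cases hzT : z ∈ T
    · have : (extChartAt (𝓡 3) x).symm z ∉ K := fun h =>
        hz ⟨_, h, (extChartAt (𝓡 3) x).right_inv hzT⟩
      simp only [F, if_pos hzT, g, hVK _ this, map_zero, zero_mul]
    · simp only [F, if_neg hzT]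
  have hFs : ∀ i, ContDiff ℝ 1 (F i) := by
    intro i
    rw [contDiff_iff_contDiffAt]
    intro z
    by_cases hz : z ∈ T
    · have hq := extChartAt_symm_mem hz
      have h1 : ContMDiffAt (𝓡 3) 𝓘(ℝ, ℝ) ∞ (g i) ((extChartAt (𝓡 3) x).symm z) :=
        (smoothAt_coordCoeff hq hV.contMDiffAt i).mul (smoothAt_coordDensity hq)
      have h2 : ContMDiffAt 𝓘(ℝ, E3) (𝓡 3) ∞ (extChartAt (𝓡 3) x).symm z :=
        (contMDiffOn_extChartAt_symm x).contMDiffAt (hTo.mem_nhds hz)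
      have h3 : ContDiffAt ℝ ∞ (g i ∘ (extChartAt (𝓡 3) x).symm) z :=
        (h1.comp z h2).contDiffAt
      refine (h3.of_le ENat.LEInfty.out).congr_of_eventuallyEq ?_
      filter_upwards [hTo.mem_nhds hz] with w hw
      simp only [F, if_pos hw, Function.comp_apply]
    · refine (contDiffAt_const (c := (0 : ℝ))).congr_of_eventuallyEq ?_
      filter_upwards [hKc.isClosed.isOpen_compl.mem_nhds fun h => hz (hKT h)] with w hw
      exact hF0 i w hw
  have hFc : ∀ i, HasCompactSupport (F i) := fun i =>
    HasCompactSupport.intro hKc fun z hz => hF0 i z hz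
  have hsum : ∀ z ∈ T, coordDensity x ((extChartAt (𝓡 3) x).symm z)
      * divergence D V ((extChartAt (𝓡 3) x).symm z)
      = ∑ i, fderiv ℝ (F i) z (EuclideanSpace.single i (1 : ℝ)) := by
    intro z hz
    obtain ⟨d, hd, hds⟩ := hD.hasDerivAt_coord hz hV
    rw [← hds]
    refine Finset.sum_congr rfl fun i _ => ?_
    have h1 : HasDerivAt (fun t : ℝ => F i (z + t • (EuclideanSpace.single i (1 : ℝ) : E3))) (d i)
      0 := by
      refine (hd i).congr_of_eventuallyEq ?_
      have hc : Continuous fun t : ℝ => z + t • (EuclideanSpace.single i (1 : ℝ) : E3) := by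
        fun_prop
      have : ∀ᶠ t : ℝ in 𝓝 0, z + t • (EuclideanSpace.single i (1 : ℝ) : E3) ∈ T :=
        hc.continuousAt.eventually_mem (by simpa using hTo.mem_nhds hz)
      filter_upwards [this] with t ht
      simp only [F, if_pos ht, g]
    exact h1.unique (((hFs i).differentiable one_ne_zero z).hasFDerivAt.hasLineDerivAt _)
  rw [setIntegral_congr_fun hTo.measurableSet hsum,
    setIntegral_eq_integral_of_forall_compl_eq_zero]
  · rw [integral_finsetSum _ fun i _ => ?_]
    · exact Finset.sum_eq_zero fun i _ => integral_fderiv_apply_eq_zero (hFs i) (hFc i) _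
    · exact (((hFs i).continuous_fderiv one_ne_zero).clm_apply
        continuous_const).integrable_of_hasCompactSupport ((hFc i).fderiv_apply ℝ _)
  · intro z hz
    refine Finset.sum_eq_zero fun i _ => ?_
    have : F i =ᶠ[𝓝 z] fun _ => 0 := by
      filter_upwards [hKc.isClosed.isOpen_compl.mem_nhds fun h => hz (hKT h)] with w hw
      exact hF0 i w hw
    rw [this.fderiv_eq]
    simp

/-- The divergence theorem on the closed manifold `Y`. -/
theorem integral_divergence [T2Space Y] (hD : IsLeviCivita D) {n : ℕ}
    {X : Fin n → (p : Y) → TangentSpace (𝓡 3) p} (hX : IsParsevalFrame X)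
    {V : (p : Y) → TangentSpace (𝓡 3) p} (hV : IsSmoothVectorField V) :
    ∫ q, divergence D V q ∂(riemannianVolume Y) = 0 := by
  classical
  obtain ⟨t, f, hfs, hsum, hf⟩ := exists_chart_partition Y
  have hVx : ∀ x, IsSmoothVectorField (fun p => f x p • V p) := fun x => hV.smul (hfs x)
  -- `V` is the sum of the fields `f_x V`, each supported in a chart
  have hdiv : divergence D V = fun p => ∑ x, divergence D (fun q => f x q • V q) p := by
    funext p
    have h1 : V = fun p => ∑ x, f x p • V p := by
      funext q
      rw [← Finset.sum_smul, hsum, one_smul]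
    conv_lhs => rw [h1]
    unfold divergence
    rw [covariantDerivative_sum _ fun x _ => hVx x]
    simp [map_sum]
  rw [hdiv, integral_finsetSum _ fun x _ => Continuous.integrable_riemannianVolume
    (hD.smooth_divergence hX (hVx x)).2.continuous]
  refine Finset.sum_eq_zero fun x _ => integral_divergence_chart hD hX (hVx x)
    (isClosed_tsupport (f x)) (hf x) fun q hq => ?_
  rw [image_eq_zero_of_notMem_tsupport hq, zero_smul]

end Integration

end Measure

section Fibre

variable (o : ManifoldOrientation Y) (a : OneForm Y)

/-! ### Linear algebra of the fibre `ℂ ⊕ K⁻¹` -/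

theorem inner_dualVector (p : Y) (u : TangentSpace (𝓡 3) p) : ⟪dualVector a p, u⟫_ℝ = a p u := by
  simp [dualVector]

theorem norm_dualVector {p : Y} (h : ‖a p‖ = 1) : ‖dualVector a p‖ = 1 := by
  simp [dualVector, h]

theorem apply_dualVector {p : Y} (h : ‖a p‖ = 1) : a p (dualVector a p) = 1 := by
  rw [← inner_dualVector, real_inner_self_eq_norm_sq, norm_dualVector a h, one_pow]

theorem inner_rotate (p : Y) (v w : TangentSpace (𝓡 3) p) :
    ⟪rotate o a p v, w⟫_ℝ = (o.at' p).volumeForm ![dualVector a p, v, w] := by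
  have h : ∀ w : TangentSpace (𝓡 3) p, (o.at' p).volumeForm ![dualVector a p, v, w] =
      ((o.at' p).volumeForm.toMultilinearMap.toLinearMap ![dualVector a p, v, 0] 2) w := by
    intro w
    rw [MultilinearMap.toLinearMap_apply]
    change _ = (o.at' p).volumeForm _
    congr 1
    funext i
    fin_cases i <;> simp
  rw [rotate, sum_inner]
  simp only [h, inner_smul_left]
  conv_rhs => rw [← (orthoBasis p).sum_repr' w, map_sum]
  simp only [map_smul, smul_eq_mul]
  exact Finset.sum_congr rfl fun i _ => mul_comm _ _

/-- A complex coordinate on the contact plane: a real linear map `κ` that kills `e₃` and turns `J`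
into multiplication by `i` and the Hermitian product of `K⁻¹` into that of `ℂ`. -/
structure IsPlaneCoordinate (p : Y) (κ : TangentSpace (𝓡 3) p →ₗ[ℝ] ℂ) : Prop where
  inner_eq : ∀ v w, ⟪v, w⟫_ℝ = (κ v * (starRingEnd ℂ) (κ w)).re + a p v * a p w
  rotate_eq : ∀ v, κ (rotate o a p v) = Complex.I * κ v
  herm_eq : ∀ v w, planeHerm o a p v w = κ v * (starRingEnd ℂ) (κ w) + (a p v * a p w : ℝ)
  dual_eq : κ (dualVector a p) = 0

/-- Complex coordinates on the contact plane exist, for either orientation. They reduce the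
identities in the fibre `ℂ ⊕ K⁻¹` to computations with complex numbers. -/
theorem exists_planeCoordinate {p : Y} (h : ‖a p‖ = 1) : ∃ κ, IsPlaneCoordinate o a p κ := by
  -- an orthonormal basis whose first vector is `e₃`
  obtain ⟨f, hf⟩ : ∃ f : OrthonormalBasis (Fin 3) ℝ (TangentSpace (𝓡 3) p),
      f 0 = dualVector a p := by
    have hc : Module.finrank ℝ (TangentSpace (𝓡 3) p) = Fintype.card (Fin 3) := by
      rw [Fintype.card_fin]; exact Fact.out
    have ho : Orthonormal ℝ (({0} : Set (Fin 3)).domRestrict fun _ => dualVector a p) := by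
      constructor
      · intro i; simpa using! norm_dualVector a h
      · intro i j hij; exact absurd (Subsingleton.elim i j) hij
    obtain ⟨f, hf⟩ := ho.exists_orthonormalBasis_extension_of_card_eq hc
    exact ⟨f, hf 0 rfl⟩
  -- the volume form is the determinant in this basis, up to the sign `ε`
  obtain ⟨ε, hε, hvol⟩ : ∃ ε : ℝ, ε * ε = 1 ∧
      ∀ v, (o.at' p).volumeForm v = ε * f.toBasis.det v := by
    rcases f.toBasis.orientation_eq_or_eq_neg (o.at' p) with h1 | h1
    · exact ⟨1, by norm_num, fun v => by rw [(o.at' p).volumeForm_robust f h1.symm, one_mul]⟩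
    · refine ⟨-1, by norm_num, fun v => ?_⟩
      rw [(o.at' p).volumeForm_robust_neg f (by rw [h1]; exact (Module.Ray.ne_neg_self _))]
      simp
  have hin : ∀ v w, ⟪v, w⟫_ℝ = ⟪f 0, v⟫_ℝ * ⟪f 0, w⟫_ℝ + ⟪f 1, v⟫_ℝ * ⟪f 1, w⟫_ℝ
      + ⟪f 2, v⟫_ℝ * ⟪f 2, w⟫_ℝ := by
    intro v w
    rw [← f.sum_inner_mul_inner v w, Fin.sum_univ_three]
    simp only [real_inner_comm]
  have ha : ∀ v, ⟪f 0, v⟫_ℝ = a p v := fun v => by rw [hf, inner_dualVector]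
  have hff : ∀ i j, ⟪f i, f j⟫_ℝ = if i = j then 1 else 0 := fun i j => f.inner_eq_ite i j
  have hJ : ∀ v w, ⟪rotate o a p v, w⟫_ℝ =
      ε * (⟪f 1, v⟫_ℝ * ⟪f 2, w⟫_ℝ - ⟪f 2, v⟫_ℝ * ⟪f 1, w⟫_ℝ) := by
    intro v w
    rw [inner_rotate, hvol, Module.Basis.det_apply, Matrix.det_fin_three, ← hf]
    simp [Module.Basis.toMatrix_apply, f.repr_apply_apply]
    exact Or.inl (mul_comm _ _)
  have hJ1 : ∀ v, ⟪f 1, rotate o a p v⟫_ℝ = - ε * ⟪f 2, v⟫_ℝ := by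
    intro v; rw [real_inner_comm, hJ]; simp [hff]
  have hJ2 : ∀ v, ⟪f 2, rotate o a p v⟫_ℝ = ε * ⟪f 1, v⟫_ℝ := by
    intro v; rw [real_inner_comm, hJ]; simp [hff]
  refine ⟨((innerₗ _ (f 1)).smulRight (1 : ℂ)) + (innerₗ _ (f 2)).smulRight (ε * Complex.I : ℂ),
    ⟨?_, ?_, ?_, ?_⟩⟩
  · intro v w
    rw [hin, ha, ha]
    simp
    linear_combination (-⟪f 2, v⟫_ℝ * ⟪f 2, w⟫_ℝ) * hε
  · intro v
    apply Complex.ext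
    · simp [hJ1, hJ2, mul_comm]
    · simp [hJ1, hJ2]
      linear_combination (⟪f 1, v⟫_ℝ) * hε
  · intro v w
    rw [planeHerm, real_inner_comm (rotate o a p w) v, hin, ha, ha, hJ]
    apply Complex.ext
    · simp
      linear_combination (-⟪f 2, v⟫_ℝ * ⟪f 2, w⟫_ℝ) * hε
    · simp
      ring
  · rw [← hf]
    simp [hff]

/-- The real inner product of two elements of the fibre `ℂ ⊕ K⁻¹`, the real part of the Hermitian
one. -/
def sInner (p : Y) (s t : SpinorAt p) : ℝ := ⟪s.1, t.1⟫_ℝ + ⟪s.2, t.2⟫_ℝ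

section sInner

variable (p : Y)

theorem sInner_add_left (s s' t : SpinorAt p) :
    sInner p (s + s') t = sInner p s t + sInner p s' t := by
  simp only [sInner, Prod.fst_add, Prod.snd_add, inner_add_left]; ring

theorem sInner_smul_left (c : ℝ) (s t : SpinorAt p) : sInner p (c • s) t = c * sInner p s t := by
  simp only [sInner, Prod.smul_fst, Prod.smul_snd, inner_smul_left]
  simp; ring

theorem sInner_comm (s t : SpinorAt p) : sInner p s t = sInner p t s := by
  simp only [sInner, real_inner_comm]

theorem sInner_add_right (s t t' : SpinorAt p) :
    sInner p s (t + t') = sInner p s t + sInner p s t' := by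
  simp only [sInner_comm p s, sInner_add_left]

theorem sInner_smul_right (c : ℝ) (s t : SpinorAt p) : sInner p s (c • t) = c * sInner p s t := by
  simp only [sInner_comm p s, sInner_smul_left]

theorem sInner_neg_left (s t : SpinorAt p) : sInner p (-s) t = - sInner p s t := by
  rw [← neg_one_smul ℝ, sInner_smul_left]; ring

theorem sInner_neg_right (s t : SpinorAt p) : sInner p s (-t) = - sInner p s t := by
  rw [sInner_comm, sInner_neg_left, sInner_comm]

theorem sInner_sub_left (s s' t : SpinorAt p) :
    sInner p (s - s') t = sInner p s t - sInner p s' t := by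
  rw [sub_eq_add_neg, sInner_add_left, sInner_neg_left]; ring

theorem sInner_sub_right (s t t' : SpinorAt p) :
    sInner p s (t - t') = sInner p s t - sInner p s t' := by
  rw [sInner_comm, sInner_sub_left, sInner_comm p t, sInner_comm p t']

theorem sInner_zero_left (t : SpinorAt p) : sInner p 0 t = 0 := by simp [sInner]

theorem sInner_sum_left {ι : Type*} (S : Finset ι) (s : ι → SpinorAt p) (t : SpinorAt p) :
    sInner p (∑ i ∈ S, s i) t = ∑ i ∈ S, sInner p (s i) t := by
  classical
  induction S using Finset.induction_on with
  | empty => simp [sInner]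
  | insert i S hi ih => rw [Finset.sum_insert hi, Finset.sum_insert hi, sInner_add_left, ih]

theorem sInner_sum_right {ι : Type*} (S : Finset ι) (s : SpinorAt p) (t : ι → SpinorAt p) :
    sInner p s (∑ i ∈ S, t i) = ∑ i ∈ S, sInner p s (t i) := by
  simp only [sInner_comm p s, sInner_sum_left]

theorem sInner_self (s : SpinorAt p) : sInner p s s = spinorNormSq p s := by
  simp only [sInner, spinorNormSq, real_inner_self_eq_norm_sq]

theorem spinorNormSq_nonneg (s : SpinorAt p) : 0 ≤ spinorNormSq p s := by
  unfold spinorNormSq; positivity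

theorem two_mul_abs_sInner_le (s t : SpinorAt p) :
    2 * |sInner p s t| ≤ spinorNormSq p s + spinorNormSq p t := by
  have h1 := spinorNormSq_nonneg p (s - t)
  have h2 := spinorNormSq_nonneg p (s + t)
  rw [← sInner_self] at h1 h2 ⊢
  rw [← sInner_self]
  rw [sInner_sub_left, sInner_sub_right, sInner_sub_right, sInner_comm p t s] at h1
  rw [sInner_add_left, sInner_add_right, sInner_add_right, sInner_comm p t s] at h2
  rcases abs_cases (sInner p s t) with h | h <;> rw [h.1] <;> linarith

/-- Young's inequality with a weight. -/
theorem two_mul_abs_sInner_le_of_pos {c : ℝ} (hc : 0 < c) (s t : SpinorAt p) :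
    2 * |sInner p s t| ≤ c * spinorNormSq p s + c⁻¹ * spinorNormSq p t := by
  have h := two_mul_abs_sInner_le p (Real.sqrt c • s) ((Real.sqrt c)⁻¹ • t)
  have hs : Real.sqrt c ≠ 0 := (Real.sqrt_pos.2 hc).ne'
  rw [← sInner_self, ← sInner_self, sInner_smul_left, sInner_smul_right, sInner_smul_left,
    sInner_smul_right, sInner_smul_left, sInner_smul_right, ← mul_assoc, mul_inv_cancel₀ hs,
    one_mul, ← mul_assoc, ← mul_assoc, ← mul_inv, Real.mul_self_sqrt hc.le, sInner_self,
    sInner_self] at h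
  exact h

end sInner

section Clifford

variable {o a} {p : Y} {κ : TangentSpace (𝓡 3) p →ₗ[ℝ] ℂ}

theorem IsPlaneCoordinate.ext (hκ : IsPlaneCoordinate o a p κ) {v w : TangentSpace (𝓡 3) p}
    (h1 : κ v = κ w) (h2 : a p v = a p w) : v = w := by
  rw [← sub_eq_zero, ← inner_self_eq_zero (𝕜 := ℝ), hκ.inner_eq]
  simp [h1, h2]

theorem apply_rotate (v : TangentSpace (𝓡 3) p) : a p (rotate o a p v) = 0 := by
  rw [← inner_dualVector, real_inner_comm, inner_rotate]
  exact (o.at' p).volumeForm.map_eq_zero_of_eq _ (i := 0) (j := 2) rfl (by decide)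

theorem IsPlaneCoordinate.planePart_eq (hκ : IsPlaneCoordinate o a p κ) (v : TangentSpace (𝓡 3) p) :
    κ (planePart a p v) = κ v := by
  simp [planePart, hκ.dual_eq]

theorem apply_planePart (h : ‖a p‖ = 1) (v : TangentSpace (𝓡 3) p) : a p (planePart a p v) = 0 := by
  simp [planePart, apply_dualVector a h]

theorem IsPlaneCoordinate.complexSmul_eq (hκ : IsPlaneCoordinate o a p κ) (z : ℂ)
    (v : TangentSpace (𝓡 3) p) : κ (complexSmul o a p z v) = z * κ v := by
  simp only [complexSmul, map_add, map_smul, hκ.rotate_eq, Complex.real_smul]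
  conv_rhs => rw [← Complex.re_add_im z]
  ring

theorem apply_complexSmul (z : ℂ) (v : TangentSpace (𝓡 3) p) :
    a p (complexSmul o a p z v) = z.re * a p v := by
  simp [complexSmul, apply_rotate]

theorem IsPlaneCoordinate.clifford_fst (hκ : IsPlaneCoordinate o a p κ) (h : ‖a p‖ = 1)
    (u : TangentSpace (𝓡 3) p) (s : SpinorAt p) : (clifford o a p u s).1 =
      Complex.I * (a p u : ℂ) * s.1 - κ s.2 * (starRingEnd ℂ) (κ u) := by
  simp [clifford, hκ.herm_eq, hκ.planePart_eq, apply_planePart h]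

theorem IsPlaneCoordinate.clifford_snd (hκ : IsPlaneCoordinate o a p κ)
    (u : TangentSpace (𝓡 3) p) (s : SpinorAt p) : κ (clifford o a p u s).2 =
      s.1 * κ u - Complex.I * (a p u : ℂ) * κ s.2 := by
  simp [clifford, hκ.complexSmul_eq, hκ.planePart_eq]

theorem apply_clifford (h : ‖a p‖ = 1) (u : TangentSpace (𝓡 3) p) (s : SpinorAt p) :
    a p (clifford o a p u s).2 = 0 := by
  simp [clifford, apply_complexSmul, apply_planePart h]

theorem IsPlaneCoordinate.spinor_ext (hκ : IsPlaneCoordinate o a p κ) {s t : SpinorAt p}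
    (h1 : s.1 = t.1) (h2 : κ s.2 = κ t.2) (h3 : a p s.2 = a p t.2) : s = t :=
  Prod.ext h1 (hκ.ext h2 h3)

theorem IsPlaneCoordinate.sInner_eq (hκ : IsPlaneCoordinate o a p κ) (s t : SpinorAt p) :
    sInner p s t = (s.1 * (starRingEnd ℂ) t.1).re + (κ s.2 * (starRingEnd ℂ) (κ t.2)).re
      + a p s.2 * a p t.2 := by
  rw [sInner, hκ.inner_eq, real_inner_comm]
  simp; ring

theorem re_spinorHerm (s t : SpinorAt p) : (spinorHerm o a p s t).re = sInner p s t := by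
  rw [spinorHerm, planeHerm, sInner, real_inner_comm]
  simp; ring

theorem clifford_add_left (h : ‖a p‖ = 1) (u v : TangentSpace (𝓡 3) p) (s : SpinorAt p) :
    clifford o a p (u + v) s = clifford o a p u s + clifford o a p v s := by
  obtain ⟨κ, hκ⟩ := exists_planeCoordinate o a h
  refine hκ.spinor_ext ?_ ?_ ?_
  · simp [hκ.clifford_fst h]; ring
  · simp [hκ.clifford_snd]; ring
  · simp [apply_clifford h]

theorem clifford_smul_left (h : ‖a p‖ = 1) (c : ℝ) (u : TangentSpace (𝓡 3) p) (s : SpinorAt p) :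
    clifford o a p (c • u) s = c • clifford o a p u s := by
  obtain ⟨κ, hκ⟩ := exists_planeCoordinate o a h
  refine hκ.spinor_ext ?_ ?_ ?_
  · simp [hκ.clifford_fst h]; ring
  · simp [hκ.clifford_snd]; ring
  · simp [apply_clifford h]

theorem clifford_add_right (h : ‖a p‖ = 1) (u : TangentSpace (𝓡 3) p) (s t : SpinorAt p) :
    clifford o a p u (s + t) = clifford o a p u s + clifford o a p u t := by
  obtain ⟨κ, hκ⟩ := exists_planeCoordinate o a h
  refine hκ.spinor_ext ?_ ?_ ?_
  · simp [hκ.clifford_fst h]; ring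
  · simp [hκ.clifford_snd]; ring
  · simp [apply_clifford h]

theorem clifford_smul_right (h : ‖a p‖ = 1) (c : ℝ) (u : TangentSpace (𝓡 3) p) (s : SpinorAt p) :
    clifford o a p u (c • s) = c • clifford o a p u s := by
  obtain ⟨κ, hκ⟩ := exists_planeCoordinate o a h
  refine hκ.spinor_ext ?_ ?_ ?_
  · simp [hκ.clifford_fst h]; ring
  · simp [hκ.clifford_snd]; ring
  · simp [apply_clifford h]

variable (o) in
/-- Clifford multiplication as a bilinear map. -/
def cliffordₗ (h : ‖a p‖ = 1) : TangentSpace (𝓡 3) p →ₗ[ℝ] SpinorAt p →ₗ[ℝ] SpinorAt p :=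
  LinearMap.mk₂ ℝ (clifford o a p) (clifford_add_left h) (clifford_smul_left h)
    (clifford_add_right h) (clifford_smul_right h)

/-- Clifford multiplication is skew for the real inner product. -/
theorem sInner_clifford (h : ‖a p‖ = 1) (u : TangentSpace (𝓡 3) p) (s t : SpinorAt p) :
    sInner p (clifford o a p u s) t = - sInner p s (clifford o a p u t) := by
  obtain ⟨κ, hκ⟩ := exists_planeCoordinate o a h
  simp [hκ.sInner_eq, apply_clifford h, hκ.clifford_fst h, hκ.clifford_snd]
  ring

/-- The Clifford relation. -/
theorem clifford_clifford_add (h : ‖a p‖ = 1) (u v : TangentSpace (𝓡 3) p) {s : SpinorAt p}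
    (hs : a p s.2 = 0) :
    clifford o a p u (clifford o a p v s) + clifford o a p v (clifford o a p u s)
      = (-2 * ⟪u, v⟫_ℝ) • s := by
  obtain ⟨κ, hκ⟩ := exists_planeCoordinate o a h
  refine hκ.spinor_ext ?_ ?_ ?_
  · rw [hκ.inner_eq]
    simp only [Prod.fst_add, Prod.smul_fst, hκ.clifford_fst h, hκ.clifford_snd]
    apply Complex.ext <;> simp <;> ring
  · rw [hκ.inner_eq]
    simp only [Prod.snd_add, Prod.smul_snd, map_add, map_smul, hκ.clifford_fst h, hκ.clifford_snd]
    apply Complex.ext <;> simp <;> ring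
  · simp [apply_clifford h, hs]

theorem spinorNormSq_clifford (h : ‖a p‖ = 1) (u : TangentSpace (𝓡 3) p) {s : SpinorAt p}
    (hs : a p s.2 = 0) :
    spinorNormSq p (clifford o a p u s) = ‖u‖ ^ 2 * spinorNormSq p s := by
  have h1 := clifford_clifford_add (o := o) h u u hs
  have h2 := sInner_clifford (o := o) h u s (clifford o a p u s)
  have h3 := congrArg (sInner p s) h1
  rw [sInner_add_right, sInner_smul_right, real_inner_self_eq_norm_sq, sInner_self] at h3
  rw [sInner_self] at h2
  linarith

theorem clifford_spinorSmul (h : ‖a p‖ = 1) (u : TangentSpace (𝓡 3) p) (z : ℂ)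
    (s : SpinorAt p) :
    clifford o a p u (spinorSmul o a p z s) = spinorSmul o a p z (clifford o a p u s) := by
  obtain ⟨κ, hκ⟩ := exists_planeCoordinate o a h
  refine hκ.spinor_ext ?_ ?_ ?_
  · simp [spinorSmul, hκ.clifford_fst h, hκ.complexSmul_eq]; ring
  · simp [spinorSmul, hκ.clifford_snd, hκ.complexSmul_eq]; ring
  · simp [spinorSmul, apply_clifford h, apply_complexSmul]

theorem spinorSmul_add (h : ‖a p‖ = 1) (z : ℂ) (s t : SpinorAt p) :
    spinorSmul o a p z (s + t) = spinorSmul o a p z s + spinorSmul o a p z t := by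
  obtain ⟨κ, hκ⟩ := exists_planeCoordinate o a h
  refine hκ.spinor_ext ?_ ?_ ?_
  · simp [spinorSmul]; ring
  · simp [spinorSmul, hκ.complexSmul_eq]; ring
  · simp [spinorSmul, apply_complexSmul]; ring

theorem spinorSmul_mul (h : ‖a p‖ = 1) (z w : ℂ) {s : SpinorAt p} (hs : a p s.2 = 0) :
    spinorSmul o a p (z * w) s = spinorSmul o a p z (spinorSmul o a p w s) := by
  obtain ⟨κ, hκ⟩ := exists_planeCoordinate o a h
  refine hκ.spinor_ext ?_ ?_ ?_
  · simp [spinorSmul]; ring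
  · simp [spinorSmul, hκ.complexSmul_eq]; ring
  · simp [spinorSmul, apply_complexSmul, hs]

theorem spinorSmul_ofReal (c : ℝ) (s : SpinorAt p) : spinorSmul o a p (c : ℂ) s = c • s := by
  simp [spinorSmul, complexSmul, Prod.ext_iff]

theorem apply_spinorSmul (z : ℂ) {s : SpinorAt p} (hs : a p s.2 = 0) :
    a p (spinorSmul o a p z s).2 = 0 := by
  simp [spinorSmul, apply_complexSmul, hs]

theorem sInner_spinorSmul_I (h : ‖a p‖ = 1) (s t : SpinorAt p) :
    sInner p (spinorSmul o a p Complex.I s) t = - sInner p s (spinorSmul o a p Complex.I t) := by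
  obtain ⟨κ, hκ⟩ := exists_planeCoordinate o a h
  simp [hκ.sInner_eq, spinorSmul, hκ.complexSmul_eq, apply_complexSmul]
  ring

theorem spinorNormSq_spinorSmul (h : ‖a p‖ = 1) (z : ℂ) {s : SpinorAt p} (hs : a p s.2 = 0) :
    spinorNormSq p (spinorSmul o a p z s) = ‖z‖ ^ 2 * spinorNormSq p s := by
  obtain ⟨κ, hκ⟩ := exists_planeCoordinate o a h
  rw [← sInner_self, ← sInner_self, hκ.sInner_eq, hκ.sInner_eq]
  simp [spinorSmul, hκ.complexSmul_eq, apply_complexSmul, hs, Complex.sq_norm,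
    Complex.normSq_apply]
  ring

/-- `cl(e₃)` is `i` on the first and `-i` on the second summand. -/
theorem clifford_dualVector (h : ‖a p‖ = 1) (s : SpinorAt p) :
    clifford o a p (dualVector a p) s = spinorSmul o a p Complex.I (s.1, -s.2) := by
  obtain ⟨κ, hκ⟩ := exists_planeCoordinate o a h
  refine hκ.spinor_ext ?_ ?_ ?_
  · simp [spinorSmul, hκ.clifford_fst h, hκ.dual_eq, apply_dualVector a h]
  · simp [spinorSmul, hκ.clifford_snd, hκ.complexSmul_eq, hκ.dual_eq, apply_dualVector a h]
  · simp [spinorSmul, apply_clifford h, apply_complexSmul]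

/-- `cl(-(i/2) a)` is `1/2` on the first and `-1/2` on the second summand. -/
theorem halfClifford_eq (h : ‖a p‖ = 1) {s : SpinorAt p} (hs : a p s.2 = 0) :
    halfClifford o a p s = (1 / 2 : ℝ) • (s.1, -s.2) := by
  have hs' : a p ((s.1, -s.2) : SpinorAt p).2 = 0 := by simp [hs]
  rw [halfClifford, clifford_dualVector h, ← spinorSmul_mul h _ _ hs', ← spinorSmul_ofReal]
  congr 1
  push_cast
  linear_combination (-1 / 2 : ℂ) * Complex.I_mul_I

theorem clifford_fst_of_apply_eq_zero (h : ‖a p‖ = 1) {u : TangentSpace (𝓡 3) p} (hu : a p u = 0)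
    (z : ℂ) : (clifford o a p u (z, 0)).1 = 0 := by
  obtain ⟨κ, hκ⟩ := exists_planeCoordinate o a h
  simp [hκ.clifford_fst h, hu]

theorem clifford_snd_of_apply_eq_zero (h : ‖a p‖ = 1) {u : TangentSpace (𝓡 3) p} (hu : a p u = 0)
    (v : TangentSpace (𝓡 3) p) : (clifford o a p u (0, v)).2 = 0 := by
  obtain ⟨κ, hκ⟩ := exists_planeCoordinate o a h
  refine hκ.ext ?_ ?_
  · simp [hκ.clifford_snd, hu]
  · simp [apply_clifford h]

/-- For `u` in the contact plane, `⟨i cl(u) (0, v), cl(w) (0, v)⟩ = |v|² ⟨J w, u⟩`. -/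
theorem sInner_I_clifford_clifford (h : ‖a p‖ = 1) {u : TangentSpace (𝓡 3) p} (hu : a p u = 0)
    (w v : TangentSpace (𝓡 3) p) (hv : a p v = 0) :
    sInner p (spinorSmul o a p Complex.I (clifford o a p u (0, v))) (clifford o a p w (0, v))
      = ‖v‖ ^ 2 * ⟪rotate o a p w, u⟫_ℝ := by
  obtain ⟨κ, hκ⟩ := exists_planeCoordinate o a h
  rw [hκ.sInner_eq, ← real_inner_self_eq_norm_sq, hκ.inner_eq, hκ.inner_eq]
  simp [spinorSmul, hκ.complexSmul_eq, apply_complexSmul, hκ.clifford_fst h, hκ.clifford_snd,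
    hκ.rotate_eq, apply_rotate, hu, hv, apply_clifford h]
  ring

theorem inner_rotate_rotate (h : ‖a p‖ = 1) (v w : TangentSpace (𝓡 3) p) :
    ⟪rotate o a p v, rotate o a p w⟫_ℝ = ⟪v, w⟫_ℝ - a p v * a p w := by
  obtain ⟨κ, hκ⟩ := exists_planeCoordinate o a h
  rw [hκ.inner_eq, hκ.inner_eq]
  simp [hκ.rotate_eq, apply_rotate]

theorem inner_rotate_left (h : ‖a p‖ = 1) (v w : TangentSpace (𝓡 3) p) :
    ⟪rotate o a p v, w⟫_ℝ = -⟪v, rotate o a p w⟫_ℝ := by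
  obtain ⟨κ, hκ⟩ := exists_planeCoordinate o a h
  rw [hκ.inner_eq, hκ.inner_eq]
  simp [hκ.rotate_eq, apply_rotate]
  ring

end Clifford

end Fibre

variable {o : ManifoldOrientation Y} {a : OneForm Y}
  {D : TangentConnection Y} {n : ℕ} {X : Fin n → (p : Y) → TangentSpace (𝓡 3) p}

/-! ### The Reeb field of an adapted metric -/

theorem IsSmoothOneForm.apply (ha : IsSmoothOneForm a) {V : (p : Y) → TangentSpace (𝓡 3) p}
    (hV : IsSmoothVectorField V) : SmoothFun (fun p => a p (V p)) := by
  have h := ContMDiff.clm_bundle_apply (F₁ := E3) (F₂ := ℝ)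
    (E₂ := fun p : Y => Bundle.Trivial Y ℝ p) ha hV
  intro p
  exact (Bundle.contMDiffAt_section _).1 (h p)

theorem IsParsevalFrame.smooth_dualVector (hX : IsParsevalFrame X) (ha : IsSmoothOneForm a) :
    IsSmoothVectorField (dualVector a) :=
  hX.smooth_of_inner fun k => by
    simp only [inner_dualVector]
    exact ha.apply (hX.smooth k)

/-- The exterior derivative of `a` is twice the skew part of the covariant derivative of its dual
field. -/
theorem IsLeviCivita.extDerivAt_eq (hD : IsLeviCivita D) (he : IsSmoothVectorField (dualVector a))
    (p : Y) (u v : TangentSpace (𝓡 3) p) : extDerivAt a p u v =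
      ⟪D (dualVector a) p u, v⟫_ℝ - ⟪D (dualVector a) p v, u⟫_ℝ := by
  have hu := FiberBundle.mdifferentiableAt_extend (𝓡 3) E3 u
  have hv := FiberBundle.mdifferentiableAt_extend (𝓡 3) E3 v
  have e : ∀ Z : (p : Y) → TangentSpace (𝓡 3) p,
      (fun q => a q (Z q)) = fun q => ⟪dualVector a q, Z q⟫_ℝ := fun Z => by
    simp only [inner_dualVector]
  rw [extDerivAt, cartanDeriv, e, e, ← inner_dualVector a, hD.mvfderiv_inner (he.mdiff p) hu,
    hD.mvfderiv_inner (he.mdiff p) hv, ← hD.sub_eq hu hv]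
  simp only [inner_sub_right, FiberBundle.extend_apply_self]
  ring

/-- The equation `da = 2 * a`, in terms of the covariant derivative of the Reeb field. -/
theorem IsAdapted.inner_sub (hadapted : IsAdapted o a) (hD : IsLeviCivita D)
    (he : IsSmoothVectorField (dualVector a)) (p : Y) (u v : TangentSpace (𝓡 3) p) :
    ⟪D (dualVector a) p u, v⟫_ℝ - ⟪D (dualVector a) p v, u⟫_ℝ = 2 * ⟪rotate o a p u, v⟫_ℝ := by
  rw [← hD.extDerivAt_eq he, hadapted.extDeriv_eq, hodgeStar, inner_rotate]

theorem IsAdapted.apply_covariantDerivative (hadapted : IsAdapted o a) (hD : IsLeviCivita D)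
    (he : IsSmoothVectorField (dualVector a)) (p : Y) (u : TangentSpace (𝓡 3) p) :
    a p (D (dualVector a) p u) = 0 := by
  have h := hD.mvfderiv_inner (he.mdiff p) (he.mdiff p) u
  have h1 : (fun q => ⟪dualVector a q, dualVector a q⟫_ℝ) = fun _ => (1 : ℝ) := by
    funext q
    rw [inner_dualVector, apply_dualVector a (hadapted.unit_length q)]
  rw [h1, mvfderiv_const, real_inner_comm, inner_dualVector] at h
  simp only [zero_apply] at h
  linarith

/-- The Reeb field is geodesic. -/
theorem IsAdapted.covariantDerivative_dualVector (hadapted : IsAdapted o a) (hD : IsLeviCivita D)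
    (he : IsSmoothVectorField (dualVector a)) (p : Y) :
    D (dualVector a) p (dualVector a p) = 0 := by
  rw [← inner_self_eq_zero (𝕜 := ℝ)]
  have h := hadapted.inner_sub hD he p (dualVector a p) (D (dualVector a) p (dualVector a p))
  rw [inner_rotate_left (hadapted.unit_length p), inner_dualVector,
    real_inner_comm _ (D _ p (D _ p _)), inner_dualVector,
    hadapted.apply_covariantDerivative hD he, apply_rotate] at h
  linarith

/-- The smoothness of `J` is read off from `da = 2 * a`, which expresses `J` by `∇ e₃`. -/
theorem IsAdapted.smooth_rotate (hadapted : IsAdapted o a) (hD : IsLeviCivita D)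
    (hX : IsParsevalFrame X) (he : IsSmoothVectorField (dualVector a))
    {V : (p : Y) → TangentSpace (𝓡 3) p} (hV : IsSmoothVectorField V) :
    IsSmoothVectorField (fun p => rotate o a p (V p)) := by
  refine hX.smooth_of_inner fun k => ?_
  have h : (fun p => ⟪rotate o a p (V p), X k p⟫_ℝ) = fun p =>
      2⁻¹ * (⟪D (dualVector a) p (V p), X k p⟫_ℝ - ⟪D (dualVector a) p (X k p), V p⟫_ℝ) := by
    funext p
    rw [hadapted.inner_sub hD he]
    ring
  rw [h]
  exact contMDiff_const.mul (((hD.smooth hX hV he).inner (hX.smooth k)).sub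
    ((hD.smooth hX (hX.smooth k) he).inner hV))

/-- The trace identity behind the curvature term of the twisted Weitzenböck formula. -/
theorem IsAdapted.sum_inner_rotate (hadapted : IsAdapted o a) (hD : IsLeviCivita D)
    (hX : IsParsevalFrame X) (he : IsSmoothVectorField (dualVector a)) (p : Y) :
    ∑ k, ⟪rotate o a p (X k p), D (dualVector a) p (X k p)⟫_ℝ = 2 := by
  have h1 := hadapted.unit_length p
  have hs := hadapted.inner_sub hD he p
  set b := orthoBasis p
  obtain ⟨κ, hκ⟩ := exists_planeCoordinate o a h1
  let J : TangentSpace (𝓡 3) p →ₗ[ℝ] TangentSpace (𝓡 3) p :=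
    { toFun := rotate o a p
      map_add' := fun u v => hκ.ext (by simp [hκ.rotate_eq]; ring) (by simp [apply_rotate])
      map_smul' := fun c v => hκ.ext (by simp [hκ.rotate_eq]; ring) (by simp [apply_rotate]) }
  let B : TangentSpace (𝓡 3) p →ₗ[ℝ] TangentSpace (𝓡 3) p →ₗ[ℝ] ℝ :=
    ((innerₗ (TangentSpace (𝓡 3) p)).comp J).compl₂ (D (dualVector a) p : _ →ₗ[ℝ] _)
  have e1 : ∑ k, ⟪rotate o a p (X k p), D (dualVector a) p (X k p)⟫_ℝ =
      ∑ i, ⟪rotate o a p (b i), D (dualVector a) p (b i)⟫_ℝ := (hX.sum_orthonormalBasis b B).symm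
  have e2 : ∀ i, ⟪rotate o a p (b i), D (dualVector a) p (b i)⟫_ℝ =
      ∑ j, ⟪rotate o a p (b i), b j⟫_ℝ * ⟪D (dualVector a) p (b i), b j⟫_ℝ := by
    intro i
    rw [← b.sum_inner_mul_inner]
    exact Finset.sum_congr rfl fun j _ => by rw [real_inner_comm (b j) (D _ p _)]
  -- since `J` is skew, only the skew part of `∇ e₃` contributes, and that is `J` itself
  have e3 : ∑ i, ∑ j, ⟪rotate o a p (b i), b j⟫_ℝ * ⟪D (dualVector a) p (b i), b j⟫_ℝ =
      - ∑ i, ∑ j, ⟪rotate o a p (b i), b j⟫_ℝ * ⟪D (dualVector a) p (b j), b i⟫_ℝ := by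
    rw [Finset.sum_comm, ← Finset.sum_neg_distrib]
    refine Finset.sum_congr rfl fun i _ => ?_
    rw [← Finset.sum_neg_distrib]
    refine Finset.sum_congr rfl fun j _ => ?_
    rw [inner_rotate_left h1, real_inner_comm]
    ring
  -- the squared norm of `J`, the rotation of a plane
  have e4 : ∑ i, ∑ j, ⟪rotate o a p (b i), b j⟫_ℝ * ⟪rotate o a p (b i), b j⟫_ℝ = 2 := by
    have : ∀ i, ∑ j, ⟪rotate o a p (b i), b j⟫_ℝ * ⟪rotate o a p (b i), b j⟫_ℝ =
        1 - a p (b i) * a p (b i) := by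
      intro i
      have := b.sum_inner_mul_inner (rotate o a p (b i)) (rotate o a p (b i))
      rw [inner_rotate_rotate h1, real_inner_self_eq_norm_sq, b.norm_eq_one] at this
      rw [← one_pow 2, ← this]
      exact Finset.sum_congr rfl fun j _ => by rw [real_inner_comm (b j)]
    simp only [this, Finset.sum_sub_distrib]
    have h2 := b.sum_inner_mul_inner (dualVector a p) (dualVector a p)
    simp only [inner_dualVector, apply_dualVector a h1] at h2
    have h3 : ∀ i, a p (b i) * ⟪b i, dualVector a p⟫_ℝ = a p (b i) * a p (b i) := fun i => by
      rw [real_inner_comm, inner_dualVector]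
    simp only [h3] at h2
    rw [h2]
    norm_num
  have e5 : ∑ i, ∑ j, ⟪rotate o a p (b i), b j⟫_ℝ * ⟪D (dualVector a) p (b i), b j⟫_ℝ
      - ∑ i, ∑ j, ⟪rotate o a p (b i), b j⟫_ℝ * ⟪D (dualVector a) p (b j), b i⟫_ℝ =
      2 * ∑ i, ∑ j, ⟪rotate o a p (b i), b j⟫_ℝ * ⟪rotate o a p (b i), b j⟫_ℝ := by
    rw [← Finset.sum_sub_distrib, Finset.mul_sum]
    refine Finset.sum_congr rfl fun i _ => ?_
    rw [← Finset.sum_sub_distrib, Finset.mul_sum]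
    refine Finset.sum_congr rfl fun j _ => ?_
    rw [← mul_sub, hs]
    ring
  rw [e4] at e5
  rw [e1, Finset.sum_congr rfl fun i _ => e2 i]
  linarith

/-! ### Divergences and integration by parts -/

section Integral

variable [CompactSpace Y] [Nonempty Y] [MeasurableSpace Y] [BorelSpace Y]

theorem IsLeviCivita.divergence_smul (hD : IsLeviCivita D) (hX : IsParsevalFrame X)
    {V : (p : Y) → TangentSpace (𝓡 3) p} (hV : IsSmoothVectorField V) {f : Y → ℝ}
    (hf : SmoothFun f) (p : Y) :
    divergence D (fun q => f q • V q) p = lieD V f p + f p * divergence D V p := by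
  have h1 := congrFun (hD.smooth_divergence hX (hV.smul hf)).1 p
  have h2 := congrFun (hD.smooth_divergence hX hV).1 p
  rw [h1, h2]
  simp only [covariantDerivative_smul hV hf, inner_add_left, inner_smul_left]
  rw [Finset.sum_add_distrib, Finset.mul_sum, add_comm]
  congr 1
  rw [lieD]
  conv_rhs => rw [← hX.sum_eq p (V p), map_sum]
  exact Finset.sum_congr rfl fun k _ => by rw [map_smul, smul_eq_mul, mul_comm]; rfl

theorem divergence_sum {ι : Type*} (s : Finset ι) {V : ι → (p : Y) → TangentSpace (𝓡 3) p}
    (hV : ∀ i ∈ s, IsSmoothVectorField (V i)) (p : Y) :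
    divergence D (fun q => ∑ i ∈ s, V i q) p = ∑ i ∈ s, divergence D (V i) p := by
  simp only [divergence, covariantDerivative_sum s hV, ← map_sum]
  congr 1
  ext u
  simp

/-- The divergence of the frame: `∑ₖ (div Xₖ) Xₖ + ∇_{Xₖ} Xₖ = 0`. -/
theorem IsLeviCivita.sum_divergence_frame (hD : IsLeviCivita D) (hX : IsParsevalFrame X) (p : Y) :
    ∑ k, (divergence D (X k) p • X k p + D (X k) p (X k p)) = 0 := by
  -- compute `div Z` for `Z = ∑ₖ ⟨Z, Xₖ⟩ Xₖ`, and compare with the trace of `∇ Z`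
  refine ext_inner_left ℝ fun z => ?_
  obtain ⟨Z, hZ, rfl⟩ := hX.exists_field p z
  have h : divergence D Z p = ∑ k, divergence D (fun q => ⟪Z q, X k q⟫_ℝ • X k q) p := by
    rw [← divergence_sum _ fun k _ => (hX.smooth k).smul (hZ.inner (hX.smooth k))]
    simp only [hX.sum_eq]
  simp only [hD.divergence_smul hX (hX.smooth _) (hZ.inner (hX.smooth _)), lieD,
    hD.mvfderiv_inner (hZ.mdiff p) ((hX.smooth _).mdiff p)] at h
  have h1 := congrFun (hD.smooth_divergence hX hZ).1 p
  rw [h1] at h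
  simp only [Finset.sum_add_distrib] at h
  rw [inner_zero_right, inner_sum]
  simp only [inner_add_right, inner_smul_right, Finset.sum_add_distrib]
  simp only [mul_comm] at h ⊢
  linarith

/-- Integration by parts for the derivative of a function along a vector field. -/
theorem integral_lieD [T2Space Y] (hD : IsLeviCivita D) (hX : IsParsevalFrame X)
    {V : (p : Y) → TangentSpace (𝓡 3) p} (hV : IsSmoothVectorField V) {f : Y → ℝ}
    (hf : SmoothFun f) :
    ∫ p, (lieD V f p + f p * divergence D V p) ∂(riemannianVolume Y) = 0 := by
  rw [← integral_divergence hD hX (hV.smul hf)]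
  exact integral_congr_ae (Eventually.of_forall fun p => (hD.divergence_smul hX hV hf p).symm)

end Integral

/-! ### Spinor fields -/

theorem mvfderiv_clm_comp {F G : Type*} [NormedAddCommGroup F] [NormedSpace ℝ F]
    [NormedAddCommGroup G] [NormedSpace ℝ G] (L : F →L[ℝ] G) {f : Y → F} {p : Y}
    (hf : MDifferentiableAt (𝓡 3) 𝓘(ℝ, F) f p) (u : TangentSpace (𝓡 3) p) :
    mvfderiv (𝓡 3) (fun q => L (f q)) p u = L (mvfderiv (𝓡 3) f p u) := by
  have hL : MDifferentiableAt 𝓘(ℝ, F) 𝓘(ℝ, G) L (f p) := L.mdifferentiableAt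
  have h := mfderiv_comp p hL hf
  have h2 : mfderiv 𝓘(ℝ, F) 𝓘(ℝ, G) L (f p) = L := by
    rw [mfderiv_eq_fderiv]; exact L.fderiv
  rw [h2] at h
  exact congrArg (fun T : E3 →L[ℝ] G => T u) h

theorem contMDiff_complex_mul {f g : Y → ℂ} (hf : ContMDiff (𝓡 3) 𝓘(ℝ, ℂ) ∞ f)
    (hg : ContMDiff (𝓡 3) 𝓘(ℝ, ℂ) ∞ g) : ContMDiff (𝓡 3) 𝓘(ℝ, ℂ) ∞ (fun p => f p * g p) :=
  (contDiff_mul (𝕜 := ℝ) (𝔸 := ℂ)).comp_contMDiff (hf.prodMk_space hg)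

/-- The hypotheses on the geometry, together with a global Parseval frame to compute in. -/
structure IsAdaptedFrame (o : ManifoldOrientation Y) (a : OneForm Y) (D : TangentConnection Y)
    (X : Fin n → (p : Y) → TangentSpace (𝓡 3) p) : Prop where
  adapted : IsAdapted o a
  leviCivita : IsLeviCivita D
  parseval : IsParsevalFrame X
  smooth_dual : IsSmoothVectorField (dualVector a)

theorem IsAdaptedFrame.unit (F : IsAdaptedFrame o a D X) (p : Y) : ‖a p‖ = 1 :=
  F.adapted.unit_length p

theorem IsAdaptedFrame.smooth_rotate (F : IsAdaptedFrame o a D X)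
    {V : (p : Y) → TangentSpace (𝓡 3) p} (hV : IsSmoothVectorField V) :
    IsSmoothVectorField (fun p => rotate o a p (V p)) :=
  F.adapted.smooth_rotate F.leviCivita F.parseval F.smooth_dual hV

theorem IsAdaptedFrame.smooth_apply (F : IsAdaptedFrame o a D X)
    {V : (p : Y) → TangentSpace (𝓡 3) p} (hV : IsSmoothVectorField V) :
    SmoothFun (fun p => a p (V p)) := by
  simp only [← inner_dualVector]
  exact F.smooth_dual.inner hV

/-- A family of elements of the fibres of `ℂ ⊕ K⁻¹` is a smooth section. -/
structure IsSmoothSection (a : OneForm Y) (s : (p : Y) → SpinorAt p) : Prop where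
  smooth_fst : ContMDiff (𝓡 3) 𝓘(ℝ, ℂ) ∞ (fun p => (s p).1)
  smooth_snd : IsSmoothVectorField (fun p => (s p).2)
  tangent_snd : ∀ p, a p (s p).2 = 0

/-- A smooth section as a spinor field. -/
def IsSmoothSection.toField {s : (p : Y) → SpinorAt p} (hs : IsSmoothSection a s) :
    SpinorField a where
  fst p := (s p).1
  snd p := (s p).2
  smooth_fst := hs.smooth_fst
  smooth_snd := hs.smooth_snd
  tangent_snd := hs.tangent_snd

theorem SpinorField.isSmoothSection (ψ : SpinorField a) : IsSmoothSection a ψ.val :=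
  ⟨ψ.smooth_fst, ψ.smooth_snd, ψ.tangent_snd⟩

theorem SpinorField.apply_val (ψ : SpinorField a) (p : Y) : a p (ψ.val p).2 = 0 :=
  ψ.tangent_snd p

theorem SpinorField.ext_val {ψ φ : SpinorField a} (h : ∀ p, ψ.val p = φ.val p) : ψ = φ := by
  cases ψ
  cases φ
  simp only [SpinorField.val, Prod.ext_iff] at h
  congr
  · exact funext fun p => (h p).1
  · exact funext fun p => (h p).2

theorem IsSmoothSection.zero : IsSmoothSection a (fun _ => 0) :=
  ⟨contMDiff_const, isSmoothVectorField_zero, fun p => map_zero (a p)⟩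

theorem IsSmoothSection.add {s t : (p : Y) → SpinorAt p} (hs : IsSmoothSection a s)
    (ht : IsSmoothSection a t) : IsSmoothSection a (fun p => s p + t p) :=
  ⟨hs.smooth_fst.add ht.smooth_fst, hs.smooth_snd.add ht.smooth_snd, fun p => by
    simp [hs.tangent_snd, ht.tangent_snd]⟩

theorem IsSmoothSection.smul {s : (p : Y) → SpinorAt p} (hs : IsSmoothSection a s) {f : Y → ℝ}
    (hf : SmoothFun f) : IsSmoothSection a (fun p => f p • s p) :=
  ⟨hf.smul hs.smooth_fst, hs.smooth_snd.smul hf, fun p => by simp [hs.tangent_snd]⟩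

theorem IsAdaptedFrame.smooth_spinorSmul (F : IsAdaptedFrame o a D X) {s : (p : Y) → SpinorAt p}
    (hs : IsSmoothSection a s) {f : Y → ℂ} (hf : ContMDiff (𝓡 3) 𝓘(ℝ, ℂ) ∞ f) :
    IsSmoothSection a (fun p => spinorSmul o a p (f p) (s p)) :=
  ⟨contMDiff_complex_mul hf hs.smooth_fst,
    (hs.smooth_snd.smul (Complex.reCLM.contDiff.comp_contMDiff hf)).add
      ((F.smooth_rotate hs.smooth_snd).smul (Complex.imCLM.contDiff.comp_contMDiff hf)),
    fun p => apply_spinorSmul _ (hs.tangent_snd p)⟩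

theorem IsAdaptedFrame.smooth_planeHerm (F : IsAdaptedFrame o a D X)
    {V W : (p : Y) → TangentSpace (𝓡 3) p} (hV : IsSmoothVectorField V)
    (hW : IsSmoothVectorField W) :
    ContMDiff (𝓡 3) 𝓘(ℝ, ℂ) ∞ (fun p => planeHerm o a p (V p) (W p)) :=
  (Complex.ofRealCLM.contDiff.comp_contMDiff (hV.inner hW)).add
    (contMDiff_complex_mul contMDiff_const (Complex.ofRealCLM.contDiff.comp_contMDiff
      (hV.inner (F.smooth_rotate hW))))

theorem IsAdaptedFrame.smooth_clifford (F : IsAdaptedFrame o a D X) {s : (p : Y) → SpinorAt p}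
    (hs : IsSmoothSection a s) {V : (p : Y) → TangentSpace (𝓡 3) p} (hV : IsSmoothVectorField V) :
    IsSmoothSection a (fun p => clifford o a p (V p) (s p)) := by
  have hP : IsSmoothVectorField (fun p => planePart a p (V p)) :=
    hV.sub (F.smooth_dual.smul (F.smooth_apply hV))
  have hI : ContMDiff (𝓡 3) 𝓘(ℝ, ℂ) ∞ (fun p => Complex.I * (a p (V p) : ℂ)) :=
    contMDiff_complex_mul contMDiff_const (Complex.ofRealCLM.contDiff.comp_contMDiff
      (F.smooth_apply hV))
  have h1 : IsSmoothSection a (fun p => ((0 : ℂ), planePart a p (V p))) :=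
    ⟨contMDiff_const, hP, fun p => apply_planePart (F.unit p) _⟩
  exact ⟨(contMDiff_complex_mul hI hs.smooth_fst).sub (F.smooth_planeHerm hs.smooth_snd hP),
    (F.smooth_spinorSmul h1 hs.smooth_fst).smooth_snd.sub (F.smooth_spinorSmul hs hI).smooth_snd,
    fun p => apply_clifford (F.unit p) _ _⟩

theorem SpincConnection.smooth_cov (A : SpincConnection o a D) (ψ : SpinorField a)
    {V : (p : Y) → TangentSpace (𝓡 3) p} (hV : IsSmoothVectorField V) :
    IsSmoothSection a (fun p => A.cov ψ p (V p)) :=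
  ⟨A.smooth_fst ψ V hV, A.smooth_snd ψ V hV, fun p => A.tangent ψ p (V p)⟩

instance : Zero (SpinorField a) := ⟨(IsSmoothSection.zero (a := a)).toField⟩

instance : Add (SpinorField a) := ⟨fun ψ φ => (ψ.isSmoothSection.add φ.isSmoothSection).toField⟩

instance : AddCommMonoid (SpinorField a) where
  add_assoc ψ φ χ := SpinorField.ext_val fun p => add_assoc (ψ.val p) (φ.val p) (χ.val p)
  zero_add ψ := SpinorField.ext_val fun p => zero_add (ψ.val p)
  add_zero ψ := SpinorField.ext_val fun p => add_zero (ψ.val p)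
  add_comm ψ φ := SpinorField.ext_val fun p => add_comm (ψ.val p) (φ.val p)
  nsmul := nsmulRec

/-- The value of a spinor field at a point, as a homomorphism of monoids. -/
def SpinorField.valHom (a : OneForm Y) (p : Y) : SpinorField a →+ SpinorAt p where
  toFun ψ := ψ.val p
  map_zero' := rfl
  map_add' _ _ := rfl

@[simp]
theorem SpinorField.add_val (ψ φ : SpinorField a) (p : Y) : (ψ + φ).val p = ψ.val p + φ.val p := rfl

@[simp]
theorem SpinorField.sum_val {ι : Type*} (s : Finset ι) (ψ : ι → SpinorField a) (p : Y) :
    (∑ i ∈ s, ψ i).val p = ∑ i ∈ s, (ψ i).val p :=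
  map_sum (SpinorField.valHom a p) ψ s

/-- The product of a smooth real function and a spinor field. -/
def SpinorField.smul {f : Y → ℝ} (hf : SmoothFun f) (ψ : SpinorField a) : SpinorField a :=
  (ψ.isSmoothSection.smul hf).toField

@[simp]
theorem SpinorField.smul_val {f : Y → ℝ} (hf : SmoothFun f) (ψ : SpinorField a) (p : Y) :
    (ψ.smul hf).val p = f p • ψ.val p := rfl

/-- The first component of a spinor field, seen as the spinor field `(α, 0)`. -/
def SpinorField.fstPart (ψ : SpinorField a) : SpinorField a where
  fst := ψ.fst
  snd _ := 0
  smooth_fst := ψ.smooth_fst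
  smooth_snd := isSmoothVectorField_zero
  tangent_snd p := map_zero (a p)

@[simp]
theorem SpinorField.fstPart_val (ψ : SpinorField a) (p : Y) : ψ.fstPart.val p = (ψ.fst p, 0) := rfl

@[simp]
theorem SpinorField.sndPart_val (ψ : SpinorField a) (p : Y) : ψ.sndPart.val p = (0, ψ.snd p) := rfl

/-- Multiplication of a spinor field by a complex constant. -/
def SpinorField.cmul (F : IsAdaptedFrame o a D X) (z : ℂ) (ψ : SpinorField a) : SpinorField a :=
  (F.smooth_spinorSmul ψ.isSmoothSection (f := fun _ => z) contMDiff_const).toField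

@[simp]
theorem SpinorField.cmul_val (F : IsAdaptedFrame o a D X) (z : ℂ) (ψ : SpinorField a) (p : Y) :
    (ψ.cmul F z).val p = spinorSmul o a p z (ψ.val p) := rfl

/-- Clifford multiplication of a spinor field by a smooth vector field. -/
def SpinorField.clifford (F : IsAdaptedFrame o a D X) {V : (p : Y) → TangentSpace (𝓡 3) p}
    (hV : IsSmoothVectorField V) (ψ : SpinorField a) : SpinorField a :=
  (F.smooth_clifford ψ.isSmoothSection hV).toField

@[simp]
theorem SpinorField.clifford_val (F : IsAdaptedFrame o a D X) {V : (p : Y) → TangentSpace (𝓡 3) p}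
    (hV : IsSmoothVectorField V) (ψ : SpinorField a) (p : Y) :
    (ψ.clifford F hV).val p = ContactDirac.clifford o a p (V p) (ψ.val p) := rfl

/-- The covariant derivative of a spinor field along a smooth vector field. -/
def SpincConnection.along (A : SpincConnection o a D) {V : (p : Y) → TangentSpace (𝓡 3) p}
    (hV : IsSmoothVectorField V) (ψ : SpinorField a) : SpinorField a :=
  (A.smooth_cov ψ hV).toField

@[simp]
theorem SpincConnection.along_val (A : SpincConnection o a D) {V : (p : Y) → TangentSpace (𝓡 3) p}
    (hV : IsSmoothVectorField V) (ψ : SpinorField a) (p : Y) :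
    (A.along hV ψ).val p = A.cov ψ p (V p) := rfl

theorem IsAdaptedFrame.smooth_sInner (F : IsAdaptedFrame o a D X) (ψ φ : SpinorField a) :
    SmoothFun (fun p => sInner p (ψ.val p) (φ.val p)) := by
  have h : ContMDiff (𝓡 3) 𝓘(ℝ, ℂ) ∞ (fun p => spinorHerm o a p (ψ.val p) (φ.val p)) :=
    (contMDiff_complex_mul ψ.smooth_fst (Complex.conjCLE.contDiff.comp_contMDiff φ.smooth_fst)).add
      (F.smooth_planeHerm ψ.smooth_snd φ.smooth_snd)
  simp only [← re_spinorHerm (o := o) (a := a)]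
  exact Complex.reCLM.contDiff.comp_contMDiff h

section Connection

variable (A : SpincConnection o a D)

/-- The covariant derivative at a point in a direction, as a homomorphism of monoids. -/
def SpincConnection.covHom (p : Y) (u : TangentSpace (𝓡 3) p) : SpinorField a →+ SpinorAt p where
  toFun ψ := A.cov ψ p u
  map_zero' := by
    have h := A.additive 0 0 0 (fun p => (add_zero (0 : SpinorAt p)).symm) p u
    simpa using h
  map_add' ψ φ := A.additive ψ φ _ (fun _ => rfl) p u

theorem SpincConnection.cov_add (ψ φ : SpinorField a) (p : Y) (u : TangentSpace (𝓡 3) p) :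
    A.cov (ψ + φ) p u = A.cov ψ p u + A.cov φ p u :=
  (A.covHom p u).map_add ψ φ

theorem SpincConnection.cov_smul {f : Y → ℝ} (hf : SmoothFun f) (ψ : SpinorField a) (p : Y)
    (u : TangentSpace (𝓡 3) p) :
    A.cov (ψ.smul hf) p u = mvfderiv (𝓡 3) f p u • ψ.val p + f p • A.cov ψ p u := by
  have h := A.leibniz (fun q => (f q : ℂ)) ψ (ψ.smul hf)
    (Complex.ofRealCLM.contDiff.comp_contMDiff hf)
    (fun q => by rw [spinorSmul_ofReal, SpinorField.smul_val]) p u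
  have h2 := mvfderiv_clm_comp Complex.ofRealCLM (hf.mdiff p) u
  simp only [Complex.ofRealCLM_apply] at h2
  rw [h, h2, spinorSmul_ofReal, spinorSmul_ofReal]

theorem SpincConnection.cov_cmul (F : IsAdaptedFrame o a D X) (z : ℂ) (ψ : SpinorField a) (p : Y)
    (u : TangentSpace (𝓡 3) p) :
    A.cov (ψ.cmul F z) p u = spinorSmul o a p z (A.cov ψ p u) := by
  have h := A.leibniz (fun _ => z) ψ (ψ.cmul F z) contMDiff_const (fun _ => rfl) p u
  rw [mvfderiv_const] at h
  have h0 : spinorSmul o a p ((0 : TangentSpace (𝓡 3) p →L[ℝ] ℂ) u) (ψ.val p) = 0 := by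
    have := spinorSmul_ofReal (o := o) (a := a) 0 (ψ.val p)
    simpa using this
  rw [h, h0, zero_add]

theorem SpincConnection.cov_clifford (F : IsAdaptedFrame o a D X)
    {V : (p : Y) → TangentSpace (𝓡 3) p} (hV : IsSmoothVectorField V) (ψ : SpinorField a) (p : Y)
    (u : TangentSpace (𝓡 3) p) : A.cov (ψ.clifford F hV) p u =
      clifford o a p (D V p u) (ψ.val p) + clifford o a p (V p) (A.cov ψ p u) :=
  A.clifford_compatible V hV ψ _ (fun _ => rfl) p u

/-- The connection is compatible with the real inner product. -/
theorem SpincConnection.mvfderiv_sInner (F : IsAdaptedFrame o a D X) (ψ φ : SpinorField a) (p : Y)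
    (u : TangentSpace (𝓡 3) p) :
    mvfderiv (𝓡 3) (fun q => sInner q (ψ.val q) (φ.val q)) p u =
      sInner p (A.cov ψ p u) (φ.val p) + sInner p (ψ.val p) (A.cov φ p u) := by
  have h : ContMDiff (𝓡 3) 𝓘(ℝ, ℂ) ∞ (fun p => spinorHerm o a p (ψ.val p) (φ.val p)) :=
    (contMDiff_complex_mul ψ.smooth_fst (Complex.conjCLE.contDiff.comp_contMDiff φ.smooth_fst)).add
      (F.smooth_planeHerm ψ.smooth_snd φ.smooth_snd)
  have h2 := mvfderiv_clm_comp Complex.reCLM (h.contMDiffAt.mdifferentiableAt (by simp) : _) u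
    (p := p)
  simp only [Complex.reCLM_apply, re_spinorHerm] at h2
  rw [h2, A.hermitian, Complex.add_re, re_spinorHerm, re_spinorHerm]

theorem SpincConnection.diracZero_eq (F : IsAdaptedFrame o a D X) (ψ : SpinorField a) (p : Y) :
    diracZero A ψ p = ∑ k, clifford o a p (X k p) (A.cov ψ p (X k p)) :=
  F.parseval.sum_orthonormalBasis (orthoBasis p)
    ((cliffordₗ o (F.unit p)).compl₂ (A.cov ψ p))

theorem IsSmoothSection.sum {ι : Type*} {S : Finset ι} {s : ι → (p : Y) → SpinorAt p}
    (hs : ∀ i ∈ S, IsSmoothSection a (s i)) : IsSmoothSection a (fun p => ∑ i ∈ S, s i p) := by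
  classical
  induction S using Finset.induction_on with
  | empty => simpa using IsSmoothSection.zero
  | insert i S hi ih =>
    simp only [Finset.sum_insert hi]
    exact (hs i (Finset.mem_insert_self i S)).add
      (ih fun j hj => hs j (Finset.mem_insert_of_mem hj))

/-- The Dirac operator `D₀` as an operator on spinor fields. -/
def SpincConnection.diracField (F : IsAdaptedFrame o a D X) (ψ : SpinorField a) : SpinorField a :=
  IsSmoothSection.toField (s := diracZero A ψ) (by
    rw [funext fun p => A.diracZero_eq F ψ p]
    exact IsSmoothSection.sum fun k _ =>
      F.smooth_clifford (A.smooth_cov ψ (F.parseval.smooth k)) (F.parseval.smooth k))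

@[simp]
theorem SpincConnection.diracField_val (F : IsAdaptedFrame o a D X) (ψ : SpinorField a) (p : Y) :
    (A.diracField F ψ).val p = diracZero A ψ p := rfl

end Connection

variable [CompactSpace Y] [Nonempty Y] [MeasurableSpace Y] [BorelSpace Y] [T2Space Y]

section SymmetricDirac

/-! ### The `L²` pairing and the symmetry of the Dirac operator -/

/-- The real `L²` inner product of two spinor fields. -/
def pairing (ψ φ : SpinorField a) : ℝ :=
  ∫ p, sInner p (ψ.val p) (φ.val p) ∂(riemannianVolume Y)

theorem IsAdaptedFrame.integrable_sInner (F : IsAdaptedFrame o a D X) (ψ φ : SpinorField a) :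
    Integrable (fun p => sInner p (ψ.val p) (φ.val p)) (riemannianVolume Y) :=
  Continuous.integrable_riemannianVolume (F.smooth_sInner ψ φ).continuous

theorem pairing_comm (ψ φ : SpinorField a) : pairing ψ φ = pairing φ ψ := by
  simp only [pairing, sInner_comm]

theorem IsAdaptedFrame.pairing_add_left (F : IsAdaptedFrame o a D X) (ψ φ χ : SpinorField a) :
    pairing (ψ + φ) χ = pairing ψ χ + pairing φ χ := by
  simp only [pairing, SpinorField.add_val, sInner_add_left]
  exact integral_add (F.integrable_sInner ψ χ) (F.integrable_sInner φ χ)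

theorem IsAdaptedFrame.pairing_add_right (F : IsAdaptedFrame o a D X) (ψ φ χ : SpinorField a) :
    pairing χ (ψ + φ) = pairing χ ψ + pairing χ φ := by
  simp only [pairing_comm χ, F.pairing_add_left]

theorem IsAdaptedFrame.pairing_sum_left {ι : Type*} (F : IsAdaptedFrame o a D X) (s : Finset ι)
    (ψ : ι → SpinorField a) (χ : SpinorField a) :
    pairing (∑ i ∈ s, ψ i) χ = ∑ i ∈ s, pairing (ψ i) χ := by
  simp only [pairing, SpinorField.sum_val, sInner_sum_left]
  exact integral_finsetSum _ fun i _ => F.integrable_sInner (ψ i) χ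

theorem IsAdaptedFrame.smooth_divergence (F : IsAdaptedFrame o a D X)
    {V : (p : Y) → TangentSpace (𝓡 3) p} (hV : IsSmoothVectorField V) :
    SmoothFun (divergence D V) :=
  (F.leviCivita.smooth_divergence F.parseval hV).2

variable (A : SpincConnection o a D)

/-- Integration by parts for the covariant derivative along a vector field. -/
theorem SpincConnection.pairing_along (F : IsAdaptedFrame o a D X)
    {V : (p : Y) → TangentSpace (𝓡 3) p} (hV : IsSmoothVectorField V) (ψ φ : SpinorField a) :
    pairing (A.along hV ψ) φ =
      - pairing ψ (A.along hV φ) - pairing (ψ.smul (F.smooth_divergence hV)) φ := by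
  have h := integral_lieD F.leviCivita F.parseval hV (F.smooth_sInner ψ φ)
  simp only [lieD, A.mvfderiv_sInner F] at h
  have e : ∀ p, sInner p (A.cov ψ p (V p)) (φ.val p) + sInner p (ψ.val p) (A.cov φ p (V p))
      + sInner p (ψ.val p) (φ.val p) * divergence D V p =
      sInner p ((A.along hV ψ).val p) (φ.val p) + sInner p (ψ.val p) ((A.along hV φ).val p)
        + sInner p ((ψ.smul (F.smooth_divergence hV)).val p) (φ.val p) := fun p => by
    rw [SpinorField.smul_val, sInner_smul_left, mul_comm (divergence D V p)]
    rfl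
  simp only [e] at h
  have hi : Integrable (fun p => sInner p ((A.along hV ψ).val p) (φ.val p)
      + sInner p (ψ.val p) ((A.along hV φ).val p)) (riemannianVolume Y) :=
    (F.integrable_sInner _ _).add (F.integrable_sInner _ _)
  rw [integral_add hi (F.integrable_sInner _ _), integral_add (F.integrable_sInner _ _)
    (F.integrable_sInner _ _)] at h
  unfold pairing
  linarith

/-- The Dirac operator is symmetric. The boundary term is the divergence of the vector field dual
to `u ↦ ⟨ψ, cl(u) χ⟩`. -/
theorem SpincConnection.pairing_diracField (F : IsAdaptedFrame o a D X) (ψ χ : SpinorField a) :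
    pairing (A.diracField F ψ) χ = pairing ψ (A.diracField F χ) := by
  have h : ∀ k, ∫ p, (lieD (X k) (fun q => sInner q (ψ.val q)
    ((χ.clifford F (F.parseval.smooth k)).val q)) p
      + sInner p (ψ.val p) ((χ.clifford F (F.parseval.smooth k)).val p) * divergence D (X k) p)
      ∂(riemannianVolume Y) = 0 := fun k =>
    integral_lieD F.leviCivita F.parseval (F.parseval.smooth k) (F.smooth_sInner _ _)
  have e : ∀ p, sInner p ((A.diracField F ψ).val p) (χ.val p)
      - sInner p (ψ.val p) ((A.diracField F χ).val p) =
      - ∑ k, (lieD (X k) (fun q => sInner q (ψ.val q) ((χ.clifford F (F.parseval.smooth k)).val q))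
        p + sInner p (ψ.val p) ((χ.clifford F (F.parseval.smooth k)).val p)
          * divergence D (X k) p) := by
    intro p
    -- the terms with a derivative of the frame cancel against the divergences of its members
    have h0 := congrArg (fun u => sInner p (ψ.val p) (cliffordₗ o (F.unit p) u (χ.val p)))
      (F.leviCivita.sum_divergence_frame F.parseval p)
    simp only [map_sum, map_add, map_smul, LinearMap.sum_apply, LinearMap.add_apply,
      LinearMap.smul_apply, sInner_sum_right, sInner_add_right, sInner_smul_right, map_zero,
      LinearMap.zero_apply] at h0
    rw [sInner_comm p _ 0, sInner_zero_left] at h0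
    have h1 : ∀ u, cliffordₗ o (F.unit p) u (χ.val p) = clifford o a p u (χ.val p) := fun u => rfl
    simp only [h1] at h0
    have h2 : ∀ k, lieD (X k)
        (fun q => sInner q (ψ.val q) ((χ.clifford F (F.parseval.smooth k)).val q)) p =
        - sInner p (clifford o a p (X k p) (A.cov ψ p (X k p))) (χ.val p)
        + (sInner p (ψ.val p) (clifford o a p (D (X k) p (X k p)) (χ.val p))
          + sInner p (ψ.val p) (clifford o a p (X k p) (A.cov χ p (X k p)))) := fun k => by
      rw [lieD, A.mvfderiv_sInner F, A.cov_clifford F, sInner_add_right, SpinorField.clifford_val,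
        sInner_clifford (F.unit p), neg_neg]
    simp only [h2]
    simp only [SpinorField.clifford_val, SpincConnection.diracField_val, A.diracZero_eq F,
      sInner_sum_left, sInner_sum_right]
    rw [← sub_eq_zero, ← h0, ← Finset.sum_neg_distrib, ← Finset.sum_sub_distrib,
      ← Finset.sum_sub_distrib]
    refine Finset.sum_congr rfl fun k _ => ?_
    ring
  have hs : ∀ k, Integrable (fun p =>
      (lieD (X k) (fun q => sInner q (ψ.val q) ((χ.clifford F (F.parseval.smooth k)).val q)) p
      + sInner p (ψ.val p) ((χ.clifford F (F.parseval.smooth k)).val p) * divergence D (X k) p))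
      (riemannianVolume Y) := fun k =>
    Continuous.integrable_riemannianVolume
      ((SmoothFun.lieD_smooth (F.smooth_sInner _ _) (F.parseval.smooth k)).add
        ((F.smooth_sInner _ _).mul (F.smooth_divergence (F.parseval.smooth k)))).continuous
  rw [← sub_eq_zero, pairing, pairing,
    ← integral_sub (F.integrable_sInner _ _) (F.integrable_sInner _ _)]
  simp only [e]
  rw [integral_neg, integral_finsetSum _ fun k _ => hs k, Finset.sum_eq_zero fun k _ => h k,
    neg_zero]

/-! ### The Weitzenböck operator -/

theorem SpincConnection.diracZero_smul (F : IsAdaptedFrame o a D X) {f : Y → ℝ} (hf : SmoothFun f)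
    (ψ : SpinorField a) (p : Y) : diracZero A (ψ.smul hf) p =
      f p • diracZero A ψ p + clifford o a p (gradient X f p) (ψ.val p) := by
  have h : clifford o a p (gradient X f p) (ψ.val p) =
      ∑ k, lieD (X k) f p • clifford o a p (X k p) (ψ.val p) := by
    change cliffordₗ o (F.unit p) (∑ k, lieD (X k) f p • X k p) (ψ.val p) = _
    simp only [map_sum, map_smul, LinearMap.sum_apply, LinearMap.smul_apply]
    rfl
  rw [h, A.diracZero_eq F, A.diracZero_eq F, Finset.smul_sum, ← Finset.sum_add_distrib]
  refine Finset.sum_congr rfl fun k _ => ?_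
  rw [A.cov_smul, clifford_add_right (F.unit p), clifford_smul_right (F.unit p),
    clifford_smul_right (F.unit p), add_comm]
  rfl

/-- For a bilinear map `B` and a symmetric endomorphism `S`, `∑ₖ B(Xₖ, S Xₖ) = ∑ₖ B(S Xₖ, Xₖ)`. -/
theorem IsParsevalFrame.sum_symm (hX : IsParsevalFrame X) {p : Y}
    {E : Type*} [AddCommGroup E] [Module ℝ E]
    (B : TangentSpace (𝓡 3) p →ₗ[ℝ] TangentSpace (𝓡 3) p →ₗ[ℝ] E)
    {S : TangentSpace (𝓡 3) p → TangentSpace (𝓡 3) p} (hS : ∀ u v, ⟪S u, v⟫_ℝ = ⟪u, S v⟫_ℝ) :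
    ∑ k, B (X k p) (S (X k p)) = ∑ k, B (S (X k p)) (X k p) := by
  have h1 : ∀ k, B (X k p) (S (X k p)) = ∑ j, ⟪S (X k p), X j p⟫_ℝ • B (X k p) (X j p) := by
    intro k
    conv_lhs => rw [← hX.sum_eq p (S (X k p))]
    simp only [map_sum, map_smul]
  have h2 : ∀ k, B (S (X k p)) (X k p) = ∑ j, ⟪S (X k p), X j p⟫_ℝ • B (X j p) (X k p) := by
    intro k
    conv_lhs => rw [← hX.sum_eq p (S (X k p))]
    simp only [map_sum, map_smul, LinearMap.sum_apply, LinearMap.smul_apply]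
  simp only [h1, h2]
  rw [Finset.sum_comm]
  refine Finset.sum_congr rfl fun j _ => Finset.sum_congr rfl fun k _ => ?_
  rw [hS, real_inner_comm]

/-- The Dirac operator and Clifford multiplication by a gradient field:
`D₀ (cl(V) ψ) = - (div V) ψ - 2 ∇_V ψ - cl(V) D₀ ψ`. -/
theorem SpincConnection.diracZero_clifford (F : IsAdaptedFrame o a D X)
    {V : (p : Y) → TangentSpace (𝓡 3) p} (hV : IsSmoothVectorField V) (p : Y)
    (hS : ∀ u v, ⟪D V p u, v⟫_ℝ = ⟪u, D V p v⟫_ℝ) (ψ : SpinorField a) :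
    diracZero A (ψ.clifford F hV) p = - (divergence D V p • ψ.val p)
      - (2 : ℝ) • A.cov ψ p (V p) - clifford o a p (V p) (diracZero A ψ p) := by
  have h1 := F.unit p
  -- symmetrize: the Clifford relation leaves only the trace of the symmetric endomorphism `∇ V`
  have e1 : ∑ k, clifford o a p (X k p) (clifford o a p (D V p (X k p)) (ψ.val p)) =
      - (divergence D V p • ψ.val p) := by
    have h := F.parseval.sum_symm (p := p) (S := D V p)
      (LinearMap.mk₂ ℝ (fun u v => clifford o a p u (clifford o a p v (ψ.val p)))
          (fun u v w => clifford_add_left h1 u v _) (fun c u v => clifford_smul_left h1 c u _)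
          (fun u v w => by rw [clifford_add_left h1, clifford_add_right h1])
          (fun c u v => by rw [clifford_smul_left h1, clifford_smul_right h1])) hS
    simp only [LinearMap.mk₂_apply] at h
    have h2 : (2 : ℝ) • ∑ k, clifford o a p (X k p) (clifford o a p (D V p (X k p)) (ψ.val p)) =
        (2 : ℝ) • - (divergence D V p • ψ.val p) := by
      conv_lhs => rw [two_smul]
      conv_lhs => enter [2]; rw [h]
      rw [← Finset.sum_add_distrib, congrFun (F.leviCivita.smooth_divergence F.parseval hV).1 p]
      simp only [clifford_clifford_add h1 _ _ (ψ.apply_val p)]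
      rw [← Finset.sum_smul, ← Finset.mul_sum, ← neg_smul, smul_smul]
      congr 1
      simp only [real_inner_comm]
      ring
    exact smul_right_injective _ (two_ne_zero' ℝ) h2
  have e2 : ∑ k, clifford o a p (X k p) (clifford o a p (V p) (A.cov ψ p (X k p))) =
      - (2 : ℝ) • A.cov ψ p (V p) - clifford o a p (V p) (diracZero A ψ p) := by
    have e3 : A.cov ψ p (V p) = ∑ k, ⟪X k p, V p⟫_ℝ • A.cov ψ p (X k p) := by
      conv_lhs => rw [← F.parseval.sum_eq p (V p), map_sum]
      simp only [map_smul, real_inner_comm]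
    have e4 : clifford o a p (V p) (diracZero A ψ p) =
        ∑ k, clifford o a p (V p) (clifford o a p (X k p) (A.cov ψ p (X k p))) := by
      rw [A.diracZero_eq F]
      exact map_sum (cliffordₗ o h1 (V p)) _ _
    rw [e3, e4, Finset.smul_sum, ← Finset.sum_sub_distrib]
    refine Finset.sum_congr rfl fun k _ => ?_
    rw [eq_sub_iff_add_eq, clifford_clifford_add h1 _ _ (A.tangent ψ p (X k p)), smul_smul]
  rw [A.diracZero_eq F]
  simp only [A.cov_clifford F, clifford_add_right h1, Finset.sum_add_distrib]
  rw [e1, e2]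
  module

/-- The difference `D₀² - ∇*∇` of the two Laplacians of the spinor bundle, with
`∇*∇ = - ∑ₖ (∇_{Xₖ} ∇_{Xₖ} + (div Xₖ) ∇_{Xₖ})` in a Parseval frame. -/
def SpincConnection.weitz (F : IsAdaptedFrame o a D X) (ψ : SpinorField a) : SpinorField a :=
  A.diracField F (A.diracField F ψ) +
    ∑ k, ((A.along (F.parseval.smooth k) ψ).smul (F.smooth_divergence (F.parseval.smooth k)) +
      A.along (F.parseval.smooth k) (A.along (F.parseval.smooth k) ψ))

/-- The Weitzenböck formula, integrated. -/
theorem SpincConnection.pairing_weitz (F : IsAdaptedFrame o a D X) (φ χ : SpinorField a) :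
    pairing (A.diracField F φ) (A.diracField F χ) = pairing (A.weitz F φ) χ +
      ∑ k, pairing (A.along (F.parseval.smooth k) φ) (A.along (F.parseval.smooth k) χ) := by
  rw [weitz, F.pairing_add_left, A.pairing_diracField F (A.diracField F φ), F.pairing_sum_left,
    add_assoc, ← Finset.sum_add_distrib, Finset.sum_eq_zero, add_zero]
  intro k _
  rw [F.pairing_add_left, A.pairing_along F (F.parseval.smooth k) (A.along _ φ)]
  ring

theorem SpincConnection.weitz_val (F : IsAdaptedFrame o a D X) (ψ : SpinorField a) (p : Y) :
    (A.weitz F ψ).val p = diracZero A (A.diracField F ψ) p +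
      ∑ k, (divergence D (X k) p • A.cov ψ p (X k p) +
        A.cov (A.along (F.parseval.smooth k) ψ) p (X k p)) := by
  simp [weitz]

theorem SpincConnection.diracZero_add (F : IsAdaptedFrame o a D X) (ψ φ : SpinorField a) (p : Y) :
    diracZero A (ψ + φ) p = diracZero A ψ p + diracZero A φ p := by
  simp only [diracZero, A.cov_add, clifford_add_right (F.unit p), Finset.sum_add_distrib]

theorem SpincConnection.weitz_add (F : IsAdaptedFrame o a D X) (ψ φ : SpinorField a) :
    A.weitz F (ψ + φ) = A.weitz F ψ + A.weitz F φ := by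
  have h1 : A.diracField F (ψ + φ) = A.diracField F ψ + A.diracField F φ :=
    SpinorField.ext_val fun p => A.diracZero_add F ψ φ p
  have h2 : ∀ k, A.along (F.parseval.smooth k) (ψ + φ) =
      A.along (F.parseval.smooth k) ψ + A.along (F.parseval.smooth k) φ := fun k =>
    SpinorField.ext_val fun p => A.cov_add ψ φ p _
  refine SpinorField.ext_val fun p => ?_
  simp only [SpinorField.add_val, weitz_val, h1, h2, A.diracZero_add F, A.cov_add, smul_add,
    Finset.sum_add_distrib]
  abel

/-- The operator `D₀² - ∇*∇` has order zero: the first order terms in the commutators of `D₀²` and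
`∇*∇` with `f` are both `-2 ∇_{grad f}`, and the terms without derivatives of `ψ` are both
`-(div grad f)`. -/
theorem SpincConnection.weitz_smul (F : IsAdaptedFrame o a D X) {f : Y → ℝ} (hf : SmoothFun f)
    (ψ : SpinorField a) : A.weitz F (ψ.smul hf) = (A.weitz F ψ).smul hf := by
  have hG := F.parseval.smooth_gradient hf
  have hXf : ∀ k, SmoothFun (lieD (X k) f) := fun k =>
    SmoothFun.lieD_smooth hf (F.parseval.smooth k)
  have h1 : A.diracField F (ψ.smul hf) = (A.diracField F ψ).smul hf + ψ.clifford F hG :=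
    SpinorField.ext_val fun p => A.diracZero_smul F hf ψ p
  have h2 : ∀ k, A.along (F.parseval.smooth k) (ψ.smul hf) =
      ψ.smul (hXf k) + (A.along (F.parseval.smooth k) ψ).smul hf := fun k =>
    SpinorField.ext_val fun p => A.cov_smul hf ψ p _
  refine SpinorField.ext_val fun p => ?_
  have hdiv : divergence D (gradient X f) p =
      ∑ k, (lieD (X k) (lieD (X k) f) p + lieD (X k) f p * divergence D (X k) p) := by
    have : gradient X f = fun q => ∑ k, lieD (X k) f q • X k q := rfl
    rw [this, divergence_sum _ fun k _ => (F.parseval.smooth k).smul (hXf k)]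
    exact Finset.sum_congr rfl fun k _ =>
      F.leviCivita.divergence_smul F.parseval (F.parseval.smooth k) (hXf k) p
  have hcov : A.cov ψ p (gradient X f p) = ∑ k, lieD (X k) f p • A.cov ψ p (X k p) := by
    simp only [gradient, map_sum, map_smul]
  have hL : ∀ k, mvfderiv (𝓡 3) f p (X k p) = lieD (X k) f p := fun k => rfl
  have hLL : ∀ k, mvfderiv (𝓡 3) (lieD (X k) f) p (X k p) = lieD (X k) (lieD (X k) f) p :=
    fun k => rfl
  simp only [SpinorField.smul_val, weitz_val, h1, h2, A.diracZero_add F, A.cov_add,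
    A.diracZero_smul F, A.cov_smul, A.diracField_val, A.along_val, hL, hLL,
    A.diracZero_clifford F hG p (F.leviCivita.hessian_symm F.parseval hf p), hdiv, hcov]
  simp only [smul_add, Finset.sum_add_distrib, Finset.smul_sum, Finset.sum_smul, add_smul,
    smul_smul]
  have e1 : ∑ k, (divergence D (X k) p * lieD (X k) f p) • ψ.val p =
      ∑ k, (lieD (X k) f p * divergence D (X k) p) • ψ.val p := by simp only [mul_comm]
  have e2 : ∑ k, (divergence D (X k) p * f p) • A.cov ψ p (X k p) =
      ∑ k, (f p * divergence D (X k) p) • A.cov ψ p (X k p) := by simp only [mul_comm]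
  have e3 : ∑ k, ((2 : ℝ) * lieD (X k) f p) • A.cov ψ p (X k p) =
      ∑ k, lieD (X k) f p • A.cov ψ p (X k p) + ∑ k, lieD (X k) f p • A.cov ψ p (X k p) := by
    rw [← Finset.sum_add_distrib]
    exact Finset.sum_congr rfl fun k _ => by rw [two_mul, add_smul]
  rw [e1, e2, e3]
  abel

end SymmetricDirac

section Estimates

variable (A : SpincConnection o a D)

/-! ### Bounds for zeroth order operators -/

theorem exists_forall_le_of_continuous {f : Y → ℝ} (hf : Continuous f) :
    ∃ C, 0 ≤ C ∧ ∀ p, f p ≤ C := by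
  obtain ⟨C, hC⟩ := (isCompact_range hf).bddAbove
  exact ⟨max C 0, le_max_right _ _, fun p => (hC (mem_range_self p)).trans (le_max_left _ _)⟩

theorem spinorNormSq_add_le (p : Y) (s t : SpinorAt p) :
    spinorNormSq p (s + t) ≤ 2 * spinorNormSq p s + 2 * spinorNormSq p t := by
  have h := two_mul_abs_sInner_le p s t
  have h2 := le_abs_self (sInner p s t)
  rw [← sInner_self, sInner_add_left, sInner_add_right, sInner_add_right, sInner_self, sInner_self,
    sInner_comm p t s]
  linarith

theorem spinorNormSq_smul (p : Y) (c : ℝ) (s : SpinorAt p) :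
    spinorNormSq p (c • s) = c ^ 2 * spinorNormSq p s := by
  rw [← sInner_self, sInner_smul_left, sInner_smul_right, sInner_self]
  ring

/-- The Cauchy–Schwarz inequality for a linear combination of spinors. -/
theorem spinorNormSq_sum_smul_le {ι : Type*} (S : Finset ι) (p : Y) (f : ι → ℝ)
    (s : ι → SpinorAt p) : spinorNormSq p (∑ i ∈ S, f i • s i) ≤
      (∑ i ∈ S, f i ^ 2) * ∑ i ∈ S, spinorNormSq p (s i) := by
  have key : ∀ {V : Type _} [NormedAddCommGroup V] [NormedSpace ℝ V] (v : ι → V),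
      ‖∑ i ∈ S, f i • v i‖ ^ 2 ≤ (∑ i ∈ S, f i ^ 2) * ∑ i ∈ S, ‖v i‖ ^ 2 := by
    intro V _ _ v
    calc ‖∑ i ∈ S, f i • v i‖ ^ 2 ≤ (∑ i ∈ S, |f i| * ‖v i‖) ^ 2 := by
          gcongr
          refine (norm_sum_le _ _).trans (le_of_eq ?_)
          simp only [norm_smul, Real.norm_eq_abs]
      _ ≤ (∑ i ∈ S, |f i| ^ 2) * ∑ i ∈ S, ‖v i‖ ^ 2 := Finset.sum_mul_sq_le_sq_mul_sq _ _ _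
      _ = _ := by simp only [sq_abs]
  have h1 := key fun i => (s i).1
  have h2 := key fun i => (s i).2
  simp only [spinorNormSq, Finset.sum_add_distrib, mul_add, Prod.fst_sum, Prod.snd_sum,
    Prod.smul_fst, Prod.smul_snd]
  exact add_le_add h1 h2

theorem IsAdaptedFrame.continuous_spinorNormSq (F : IsAdaptedFrame o a D X) (ψ : SpinorField a) :
    Continuous (fun p => spinorNormSq p (ψ.val p)) := by
  simp only [← sInner_self]
  exact (F.smooth_sInner ψ ψ).continuous

/-- The field `(0, Xₖ - a(Xₖ) e₃)`. -/
def IsAdaptedFrame.planeField (F : IsAdaptedFrame o a D X) (k : Fin n) : SpinorField a :=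
  IsSmoothSection.toField (s := fun p => (0, planePart a p (X k p)))
    ⟨contMDiff_const, (F.parseval.smooth k).sub
      (F.smooth_dual.smul (F.smooth_apply (F.parseval.smooth k))),
      fun p => apply_planePart (F.unit p) _⟩

theorem SpincConnection.weitz_sum {ι : Type*} (F : IsAdaptedFrame o a D X) (s : Finset ι)
    (ψ : ι → SpinorField a) : A.weitz F (∑ i ∈ s, ψ i) = ∑ i ∈ s, A.weitz F (ψ i) := by
  classical
  induction s using Finset.induction_on with
  | empty =>
    have h : (0 : SpinorField a) = (0 : SpinorField a).smul (f := fun _ => 0) contMDiff_const :=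
      SpinorField.ext_val fun p => (zero_smul ℝ _).symm
    rw [Finset.sum_empty, Finset.sum_empty, h, A.weitz_smul]
    exact SpinorField.ext_val fun p => by simp
  | insert i s hi ih => rw [Finset.sum_insert hi, Finset.sum_insert hi, A.weitz_add, ih]

/-- Since `D₀² - ∇*∇` is linear over the smooth functions and the spinor fields are spanned by
finitely many of them, it is bounded pointwise. -/
theorem SpincConnection.exists_weitz_bound (F : IsAdaptedFrame o a D X) :
    ∃ C, 0 ≤ C ∧ ∀ ψ p, spinorNormSq p ((A.weitz F ψ).val p) ≤ C * spinorNormSq p (ψ.val p) := by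
  -- the fields `(1, 0)`, `(i, 0)` and `(0, Xₖ - a(Xₖ) e₃)` span
  let E₁ := unitSpinor a
  let E₂ := E₁.cmul F Complex.I
  let E := F.planeField
  obtain ⟨M, hM0, hM⟩ := exists_forall_le_of_continuous
    (((F.continuous_spinorNormSq (A.weitz F E₁)).add
      (F.continuous_spinorNormSq (A.weitz F E₂))).add
      (continuous_finsetSum Finset.univ fun k _ => F.continuous_spinorNormSq (A.weitz F (E k))))
  refine ⟨4 * M, by positivity, fun ψ p => ?_⟩
  have hre : SmoothFun (fun p => (ψ.fst p).re) := Complex.reCLM.contDiff.comp_contMDiff ψ.smooth_fst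
  have him : SmoothFun (fun p => (ψ.fst p).im) := Complex.imCLM.contDiff.comp_contMDiff ψ.smooth_fst
  have hk : ∀ k, SmoothFun (fun p => ⟪ψ.snd p, X k p⟫_ℝ) := fun k =>
    ψ.smooth_snd.inner (F.parseval.smooth k)
  have hψ : ψ = E₁.smul hre + E₂.smul him + ∑ k, (E k).smul (hk k) := by
    refine SpinorField.ext_val fun q => ?_
    have h1 : ∑ k, ⟪ψ.snd q, X k q⟫_ℝ • planePart a q (X k q) = ψ.snd q := by
      simp only [planePart, smul_sub, Finset.sum_sub_distrib, F.parseval.sum_eq, smul_smul,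
        ← Finset.sum_smul]
      have h2 : ∑ k, ⟪ψ.snd q, X k q⟫_ℝ * a q (X k q) = 0 := by
        rw [← ψ.tangent_snd q]
        conv_rhs => rw [← F.parseval.sum_eq q (ψ.snd q), map_sum]
        simp only [map_smul, smul_eq_mul]
      rw [h2, zero_smul, sub_zero]
    have e1 : E₁.val q = (1, 0) := rfl
    have e2 : E₂.val q = (Complex.I, 0) := by
      obtain ⟨κ, hκ⟩ := exists_planeCoordinate o a (F.unit q)
      rw [SpinorField.cmul_val, e1]
      exact Prod.ext (mul_one _) (hκ.ext (by simp [spinorSmul, hκ.complexSmul_eq])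
        (by simp [spinorSmul, apply_complexSmul]))
    have e3 : ∀ k, (E k).val q = (0, planePart a q (X k q)) := fun k => rfl
    simp only [SpinorField.add_val, SpinorField.sum_val, SpinorField.smul_val, e1, e2, e3]
    refine Prod.ext ?_ ?_
    · simp [Prod.fst_sum, SpinorField.val]
    · simp [Prod.snd_sum, SpinorField.val, h1]
  have hW : (A.weitz F ψ).val p = (ψ.fst p).re • (A.weitz F E₁).val p
      + (ψ.fst p).im • (A.weitz F E₂).val p
      + ∑ k, ⟪ψ.snd p, X k p⟫_ℝ • (A.weitz F (E k)).val p := by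
    conv_lhs => rw [hψ]
    simp only [A.weitz_add, A.weitz_sum, A.weitz_smul, SpinorField.add_val, SpinorField.sum_val,
      SpinorField.smul_val]
  have h1 := spinorNormSq_add_le p ((ψ.fst p).re • (A.weitz F E₁).val p
      + (ψ.fst p).im • (A.weitz F E₂).val p) (∑ k, ⟪ψ.snd p, X k p⟫_ℝ • (A.weitz F (E k)).val p)
  have h2 := spinorNormSq_add_le p ((ψ.fst p).re • (A.weitz F E₁).val p)
      ((ψ.fst p).im • (A.weitz F E₂).val p)
  have h3 := spinorNormSq_sum_smul_le Finset.univ p (fun k => ⟪ψ.snd p, X k p⟫_ℝ)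
    (fun k => (A.weitz F (E k)).val p)
  rw [← hW] at h1
  rw [spinorNormSq_smul, spinorNormSq_smul] at h2
  have h4 : ∑ k, ⟪ψ.snd p, X k p⟫_ℝ ^ 2 = ‖ψ.snd p‖ ^ 2 := by
    rw [← real_inner_self_eq_norm_sq, F.parseval.inner_eq]
    simp only [sq]
  rw [h4] at h3
  have hMp : spinorNormSq p ((A.weitz F E₁).val p) + spinorNormSq p ((A.weitz F E₂).val p)
      + ∑ k, spinorNormSq p ((A.weitz F (E k)).val p) ≤ M := hM p
  have n1 := spinorNormSq_nonneg p ((A.weitz F E₁).val p)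
  have n2 := spinorNormSq_nonneg p ((A.weitz F E₂).val p)
  have n3 : 0 ≤ ∑ k, spinorNormSq p ((A.weitz F (E k)).val p) :=
    Finset.sum_nonneg fun k _ => spinorNormSq_nonneg p _
  have h5 : spinorNormSq p (ψ.val p) = (ψ.fst p).re ^ 2 + (ψ.fst p).im ^ 2 + ‖ψ.snd p‖ ^ 2 := by
    simp only [spinorNormSq, SpinorField.val, Complex.sq_norm, Complex.normSq_apply]
    ring
  have m1 : (ψ.fst p).re ^ 2 * spinorNormSq p ((A.weitz F E₁).val p) ≤ (ψ.fst p).re ^ 2 * M :=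
    mul_le_mul_of_nonneg_left (by linarith) (sq_nonneg _)
  have m2 : (ψ.fst p).im ^ 2 * spinorNormSq p ((A.weitz F E₂).val p) ≤ (ψ.fst p).im ^ 2 * M :=
    mul_le_mul_of_nonneg_left (by linarith) (sq_nonneg _)
  have m3 : ‖ψ.snd p‖ ^ 2 * ∑ k, spinorNormSq p ((A.weitz F (E k)).val p) ≤ ‖ψ.snd p‖ ^ 2 * M :=
    mul_le_mul_of_nonneg_left (by linarith) (sq_nonneg _)
  have m4 : 0 ≤ ‖ψ.snd p‖ ^ 2 * M := by positivity
  rw [h5]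
  linarith

/-! ### The off-diagonal part of the connection -/

variable (o a D) in
/-- The endomorphism `(i/2) cl(∇_u e₃)`, the off-diagonal part of the connection up to sign. -/
def twist (p : Y) (u : TangentSpace (𝓡 3) p) (s : SpinorAt p) : SpinorAt p :=
  spinorSmul o a p (Complex.I / 2) (clifford o a p (D (dualVector a) p u) s)

theorem sInner_half_I {p : Y} (h : ‖a p‖ = 1) (s : SpinorAt p) {t : SpinorAt p} :
    sInner p (spinorSmul o a p (Complex.I / 2) s) t =
      2⁻¹ * sInner p (spinorSmul o a p Complex.I s) t := by
  obtain ⟨κ, hκ⟩ := exists_planeCoordinate o a h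
  simp [hκ.sInner_eq, spinorSmul, hκ.complexSmul_eq, apply_complexSmul]
  ring

theorem sInner_twist {p : Y} (h : ‖a p‖ = 1) (u : TangentSpace (𝓡 3) p) (s t : SpinorAt p) :
    sInner p (twist o a D p u s) t = sInner p s (twist o a D p u t) := by
  rw [twist, twist, sInner_half_I h, sInner_spinorSmul_I h, sInner_clifford h,
    clifford_spinorSmul h, neg_neg, sInner_comm p s (spinorSmul o a p (Complex.I / 2) _),
    sInner_half_I h, sInner_comm p s]

theorem spinorNormSq_twist {p : Y} (h : ‖a p‖ = 1) (u : TangentSpace (𝓡 3) p) {s : SpinorAt p}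
    (hs : a p s.2 = 0) : spinorNormSq p (twist o a D p u s) =
      4⁻¹ * ‖D (dualVector a) p u‖ ^ 2 * spinorNormSq p s := by
  rw [twist, spinorNormSq_spinorSmul h _ (apply_clifford h _ _), spinorNormSq_clifford h _ hs]
  simp
  ring

/-- For `φ = (0, β)`, the first component of `∇_u φ` is that of `(i/2) cl(∇_u e₃) φ`: differentiate
`cl(e₃) φ = - i φ`. -/
theorem SpincConnection.cov_fst (F : IsAdaptedFrame o a D X) {φ : SpinorField a}
    (hφ : ∀ p, φ.fst p = 0) (p : Y) (u : TangentSpace (𝓡 3) p) :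
    (A.cov φ p u).1 = (twist o a D p u (φ.val p)).1 := by
  have hz : φ.clifford F F.smooth_dual = φ.cmul F (-Complex.I) := by
    refine SpinorField.ext_val fun q => ?_
    obtain ⟨κ, hκ⟩ := exists_planeCoordinate o a (F.unit q)
    have h0 : (φ.val q).1 = 0 := hφ q
    rw [SpinorField.clifford_val, SpinorField.cmul_val, clifford_dualVector (F.unit q)]
    refine hκ.spinor_ext ?_ ?_ ?_
    · simp [spinorSmul, h0]
    · simp [spinorSmul, hκ.complexSmul_eq]
    · simp [spinorSmul, apply_complexSmul]
  have h := A.cov_clifford F F.smooth_dual φ p u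
  rw [hz, A.cov_cmul, clifford_dualVector (F.unit p)] at h
  have h1 := congrArg Prod.fst h
  simp only [spinorSmul, Prod.fst_add, twist] at h1 ⊢
  linear_combination (Complex.I / 2) * h1 + (A.cov φ p u).1 * Complex.I_mul_I

/-- For `η = (α, 0)`, the second component of `∇_u η` is that of `- (i/2) cl(∇_u e₃) η`:
differentiate `cl(e₃) η = i η`. -/
theorem SpincConnection.cov_snd (F : IsAdaptedFrame o a D X) {η : SpinorField a}
    (hη : ∀ p, η.snd p = 0) (p : Y) (u : TangentSpace (𝓡 3) p) :
    (A.cov η p u).2 = - (twist o a D p u (η.val p)).2 := by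
  have hz : η.clifford F F.smooth_dual = η.cmul F Complex.I := by
    refine SpinorField.ext_val fun q => ?_
    have h0 : (η.val q).2 = 0 := hη q
    rw [SpinorField.clifford_val, SpinorField.cmul_val, clifford_dualVector (F.unit q)]
    congr 1
    exact Prod.ext rfl (by rw [h0, neg_zero])
  have h := A.cov_clifford F F.smooth_dual η p u
  rw [hz, A.cov_cmul, clifford_dualVector (F.unit p)] at h
  obtain ⟨κ, hκ⟩ := exists_planeCoordinate o a (F.unit p)
  have h1 := congrArg (fun s => κ s.2) h
  simp only [spinorSmul, Prod.snd_add, map_add, hκ.complexSmul_eq, map_neg] at h1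
  refine hκ.ext ?_ ?_
  · simp only [twist, spinorSmul, map_neg, hκ.complexSmul_eq]
    linear_combination (-Complex.I / 2) * h1 + κ (A.cov η p u).2 * Complex.I_mul_I
  · rw [A.tangent, map_neg, twist, apply_spinorSmul _ (apply_clifford (F.unit p) _ _),
      neg_zero]

theorem twist_snd_of_fst (F : IsAdaptedFrame o a D X) {p : Y} (u v : TangentSpace (𝓡 3) p) :
    (twist o a D p u (0, v)).2 = 0 := by
  have h := clifford_snd_of_apply_eq_zero (o := o) (F.unit p)
    (F.adapted.apply_covariantDerivative F.leviCivita F.smooth_dual p u) v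
  obtain ⟨κ, hκ⟩ := exists_planeCoordinate o a (F.unit p)
  refine hκ.ext ?_ ?_
  · simp [twist, spinorSmul, hκ.complexSmul_eq, h]
  · simp [twist, spinorSmul, apply_complexSmul, h]

theorem twist_fst_of_snd (F : IsAdaptedFrame o a D X) {p : Y} (u : TangentSpace (𝓡 3) p) (z : ℂ) :
    (twist o a D p u (z, 0)).1 = 0 := by
  have h := clifford_fst_of_apply_eq_zero (o := o) (F.unit p)
    (F.adapted.apply_covariantDerivative F.leviCivita F.smooth_dual p u) z
  simp [twist, spinorSmul, h]

/-! ### The twisted Weitzenböck formula on `K⁻¹` -/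

theorem IsAdaptedFrame.sum_apply_smul (F : IsAdaptedFrame o a D X) (p : Y) :
    ∑ k, a p (X k p) • X k p = dualVector a p := by
  conv_rhs => rw [← F.parseval.sum_eq p (dualVector a p)]
  simp only [inner_dualVector]

theorem IsAdaptedFrame.sum_apply_sq (F : IsAdaptedFrame o a D X) (p : Y) :
    ∑ k, a p (X k p) ^ 2 = 1 := by
  have h := congrArg (a p) (F.sum_apply_smul p)
  rw [apply_dualVector a (F.unit p), map_sum] at h
  simpa only [map_smul, smul_eq_mul, sq] using h

theorem IsPlaneCoordinate.rotate_planePart {p : Y} {κ : TangentSpace (𝓡 3) p →ₗ[ℝ] ℂ}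
    (hκ : IsPlaneCoordinate o a p κ) (u : TangentSpace (𝓡 3) p) :
    rotate o a p (planePart a p u) = rotate o a p u :=
  hκ.ext (by rw [hκ.rotate_eq, hκ.rotate_eq, hκ.planePart_eq])
    (by rw [apply_rotate, apply_rotate])

/-- The term of `|D_r φ|² - |∇_r φ|²` that is linear in `r`, for `φ = (0, β)`. -/
theorem SpincConnection.sInner_diracZero (F : IsAdaptedFrame o a D X) {φ : SpinorField a}
    (hφ : ∀ p, φ.fst p = 0) (p : Y) :
    sInner p (A.cov φ p (dualVector a p)) (spinorSmul o a p Complex.I (φ.val p))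
      - sInner p (diracZero A φ p) (φ.val p) = ‖φ.snd p‖ ^ 2 := by
  have h := F.unit p
  obtain ⟨κ, hκ⟩ := exists_planeCoordinate o a h
  have hv : φ.val p = (0, φ.snd p) := Prod.ext (hφ p) rfl
  -- for `u` in the plane, `cl(u) φ` lies in `ℂ`, so only the off-diagonal part of `∇_u φ` is seen
  have h1 : ∀ u, sInner p (A.cov φ p u) (clifford o a p (planePart a p u) (φ.val p)) =
      2⁻¹ * (‖φ.snd p‖ ^ 2 * ⟪rotate o a p u, D (dualVector a) p u⟫_ℝ) := by
    intro u
    have e1 : (clifford o a p (planePart a p u) (φ.val p)).2 = 0 := by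
      rw [hv, clifford_snd_of_apply_eq_zero h (apply_planePart h u)]
    have e2 : sInner p (A.cov φ p u) (clifford o a p (planePart a p u) (φ.val p)) =
        sInner p (twist o a D p u (φ.val p)) (clifford o a p (planePart a p u) (φ.val p)) := by
      rw [sInner, sInner, e1, A.cov_fst F hφ]
      simp
    rw [e2, twist, sInner_half_I h, hv, sInner_I_clifford_clifford h
      (F.adapted.apply_covariantDerivative F.leviCivita F.smooth_dual p u) _ _ (φ.tangent_snd p),
      hκ.rotate_planePart]
  -- along `e₃`, Clifford multiplication is `-i` on `φ`
  have h2 : ∀ u, clifford o a p u (φ.val p) = clifford o a p (planePart a p u) (φ.val p)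
      - a p u • spinorSmul o a p Complex.I (φ.val p) := by
    intro u
    have e1 : u = planePart a p u + a p u • dualVector a p := by simp [planePart]
    conv_lhs => rw [e1]
    rw [clifford_add_left h, clifford_smul_left h, clifford_dualVector h, sub_eq_add_neg,
      ← smul_neg]
    congr 2
    refine hκ.spinor_ext ?_ ?_ ?_
    · simp [spinorSmul, hv]
    · simp [spinorSmul, hκ.complexSmul_eq]
    · simp [spinorSmul, apply_complexSmul]
  have h3 : sInner p (A.cov φ p (dualVector a p)) (spinorSmul o a p Complex.I (φ.val p)) =
      ∑ k, a p (X k p) * sInner p (A.cov φ p (X k p)) (spinorSmul o a p Complex.I (φ.val p)) := by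
    rw [← F.sum_apply_smul p, map_sum, sInner_sum_left]
    simp only [map_smul, sInner_smul_left]
  rw [A.diracZero_eq F, sInner_sum_left, h3, ← Finset.sum_sub_distrib]
  have h4 := F.adapted.sum_inner_rotate F.leviCivita F.parseval F.smooth_dual p
  calc _ = ∑ k, 2⁻¹ * (‖φ.snd p‖ ^ 2 * ⟪rotate o a p (X k p), D (dualVector a) p (X k p)⟫_ℝ) := by
        refine Finset.sum_congr rfl fun k _ => ?_
        rw [sInner_clifford h, h2, sInner_sub_right, sInner_smul_right, h1]
        ring
    _ = _ := by
        rw [← Finset.mul_sum, ← Finset.mul_sum, h4]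
        ring

theorem IsAdaptedFrame.covR_eq (F : IsAdaptedFrame o a D X) (r : ℝ) (φ : SpinorField a) (p : Y)
    (u : TangentSpace (𝓡 3) p) : covR A r φ p u =
      A.cov φ p u + (-(r / 2) * a p u) • spinorSmul o a p Complex.I (φ.val p) := by
  rw [covR, ← spinorSmul_ofReal (o := o) (a := a),
    ← spinorSmul_mul (F.unit p) _ _ (φ.apply_val p)]
  congr 2
  push_cast
  ring

theorem IsAdaptedFrame.dirac_eq (F : IsAdaptedFrame o a D X) (r : ℝ) (φ : SpinorField a) (p : Y) :
    dirac A r φ p = diracZero A φ p + (r / 2) • ((φ.fst p, -φ.snd p) : SpinorAt p) := by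
  rw [dirac, halfClifford_eq (F.unit p) (φ.apply_val p), smul_smul]
  congr 2
  ring

theorem spinorNormSq_I {p : Y} (h : ‖a p‖ = 1) {s : SpinorAt p} (hs : a p s.2 = 0) :
    spinorNormSq p (spinorSmul o a p Complex.I s) = spinorNormSq p s := by
  rw [spinorNormSq_spinorSmul h _ hs]
  simp

theorem IsAdaptedFrame.covNormSq_eq (F : IsAdaptedFrame o a D X) (r : ℝ) (φ : SpinorField a)
    (p : Y) : covNormSq A r φ p = ∑ k, spinorNormSq p (covR A r φ p (X k p)) := by
  let L : TangentSpace (𝓡 3) p →ₗ[ℝ] SpinorAt p :=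
    A.cov φ p + ((-(r / 2)) • (a p : TangentSpace (𝓡 3) p →ₗ[ℝ] ℝ)).smulRight
      (spinorSmul o a p Complex.I (φ.val p))
  have hL : ∀ u, covR A r φ p u = L u := fun u => F.covR_eq A r φ p u
  simp only [covNormSq, hL, ← sInner_self]
  exact F.parseval.sum_orthonormalBasis (orthoBasis p) (LinearMap.mk₂ ℝ
    (fun u v => sInner p (L u) (L v))
    (fun u v w => by rw [map_add, sInner_add_left])
    (fun c u v => by rw [map_smul, sInner_smul_left]; rfl)
    (fun u v w => by rw [map_add, sInner_add_right])
    (fun c u v => by rw [map_smul, sInner_smul_right]; rfl))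

/-- The twisted Weitzenböck formula, pointwise, up to terms independent of `r`: the curvature of
`∇_r` contributes `r |β|²`. -/
theorem SpincConnection.spinorNormSq_dirac_sub (F : IsAdaptedFrame o a D X) (r : ℝ)
    {φ : SpinorField a} (hφ : ∀ p, φ.fst p = 0) (p : Y) :
    spinorNormSq p (dirac A r φ p) - covNormSq A r φ p =
      spinorNormSq p (diracZero A φ p) - ∑ k, spinorNormSq p (A.cov φ p (X k p))
        + r * ‖φ.snd p‖ ^ 2 := by
  have h := F.unit p
  have h0 := A.sInner_diracZero F hφ p
  have hn : spinorNormSq p (φ.val p) = ‖φ.snd p‖ ^ 2 := by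
    simp [spinorNormSq, SpinorField.val, hφ p]
  have h1 : spinorNormSq p (dirac A r φ p) = spinorNormSq p (diracZero A φ p)
      - r * sInner p (diracZero A φ p) (φ.val p) + r ^ 2 / 4 * ‖φ.snd p‖ ^ 2 := by
    have e : ((φ.fst p, -φ.snd p) : SpinorAt p) = - φ.val p :=
      Prod.ext (by simp [SpinorField.val, hφ p]) rfl
    rw [F.dirac_eq, e, ← sInner_self, sInner_add_left, sInner_add_right, sInner_add_right,
      sInner_smul_right, sInner_smul_left, sInner_smul_left, sInner_smul_right, sInner_neg_right,
      sInner_neg_right, sInner_neg_left, sInner_neg_left, sInner_self, sInner_self, hn,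
      sInner_comm p (φ.val p)]
    ring
  have h2 : ∀ u, spinorNormSq p (covR A r φ p u) = spinorNormSq p (A.cov φ p u)
      - r * (a p u * sInner p (A.cov φ p u) (spinorSmul o a p Complex.I (φ.val p)))
      + a p u ^ 2 * (r ^ 2 / 4 * ‖φ.snd p‖ ^ 2) := by
    intro u
    rw [F.covR_eq, ← sInner_self, sInner_add_left, sInner_add_right, sInner_add_right,
      sInner_smul_right, sInner_smul_left, sInner_smul_left, sInner_smul_right, sInner_self,
      sInner_self, spinorNormSq_I h (φ.apply_val p), hn,
      sInner_comm p (spinorSmul o a p Complex.I (φ.val p))]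
    ring
  have h3 : sInner p (A.cov φ p (dualVector a p)) (spinorSmul o a p Complex.I (φ.val p)) =
      ∑ k, a p (X k p) * sInner p (A.cov φ p (X k p)) (spinorSmul o a p Complex.I (φ.val p)) := by
    rw [← F.sum_apply_smul p, map_sum, sInner_sum_left]
    simp only [map_smul, sInner_smul_left]
  rw [h1, F.covNormSq_eq A]
  simp only [h2]
  rw [Finset.sum_add_distrib, Finset.sum_sub_distrib, ← Finset.mul_sum, ← Finset.sum_mul,
    F.sum_apply_sq, ← h3]
  linear_combination r * h0

/-! ### The interaction of the two components -/

theorem IsAdaptedFrame.smooth_covariantDerivative (F : IsAdaptedFrame o a D X)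
    {U V : (p : Y) → TangentSpace (𝓡 3) p} (hU : IsSmoothVectorField U)
    (hV : IsSmoothVectorField V) : IsSmoothVectorField (fun p => D V p (U p)) :=
  F.leviCivita.smooth F.parseval hU hV

/-- The endomorphism `(i/2) cl(∇_{Xₖ} e₃)` on spinor fields. -/
def twistField (F : IsAdaptedFrame o a D X) (k : Fin n) (φ : SpinorField a) : SpinorField a :=
  (φ.clifford F (F.smooth_covariantDerivative (F.parseval.smooth k) F.smooth_dual)).cmul F
    (Complex.I / 2)

@[simp]
theorem twistField_val (F : IsAdaptedFrame o a D X) (k : Fin n) (φ : SpinorField a) (p : Y) :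
    (twistField F k φ).val p = twist o a D p (X k p) (φ.val p) := rfl

/-- The rough Laplacian of the Reeb field, up to sign. -/
def reebLaplacian (D : TangentConnection Y) (X : Fin n → (p : Y) → TangentSpace (𝓡 3) p)
    (a : OneForm Y) (p : Y) : TangentSpace (𝓡 3) p :=
  ∑ k, (divergence D (X k) p • D (dualVector a) p (X k p)
    + D (fun q => D (dualVector a) q (X k q)) p (X k p))

theorem IsAdaptedFrame.smooth_reebLaplacian (F : IsAdaptedFrame o a D X) :
    IsSmoothVectorField (reebLaplacian D X a) :=
  IsSmoothVectorField.sum fun k _ =>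
    ((F.smooth_covariantDerivative (F.parseval.smooth k) F.smooth_dual).smul
      (F.smooth_divergence (F.parseval.smooth k))).add
    (F.smooth_covariantDerivative (F.parseval.smooth k)
      (F.smooth_covariantDerivative (F.parseval.smooth k) F.smooth_dual))

theorem SpincConnection.cov_twistField (F : IsAdaptedFrame o a D X) (k : Fin n)
    (φ : SpinorField a) (p : Y) (u : TangentSpace (𝓡 3) p) :
    A.cov (twistField F k φ) p u = spinorSmul o a p (Complex.I / 2)
      (clifford o a p (D (fun q => D (dualVector a) q (X k q)) p u) (φ.val p))
      + twist o a D p (X k p) (A.cov φ p u) := by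
  rw [twistField, A.cov_cmul, A.cov_clifford, spinorSmul_add (F.unit p)]
  rfl

/-- Since the off-diagonal parts of `∇φ` and `∇η` have order zero, `⟨∇_u φ, ∇_u η⟩` contains no
product of derivatives of `φ` and `η`. -/
theorem SpincConnection.sInner_cov_cov (F : IsAdaptedFrame o a D X) (ψ : SpinorField a) (p : Y)
    (u : TangentSpace (𝓡 3) p) :
    sInner p (A.cov ψ.sndPart p u) (A.cov ψ.fstPart p u) =
      sInner p (twist o a D p u (ψ.sndPart.val p)) (A.cov ψ.fstPart p u)
        - sInner p (twist o a D p u (A.cov ψ.sndPart p u)) (ψ.fstPart.val p) := by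
  have h1 := A.cov_fst F (φ := ψ.sndPart) (fun _ => rfl) p u
  have h2 := A.cov_snd F (η := ψ.fstPart) (fun _ => rfl) p u
  have h3 := twist_snd_of_fst F u (ψ.snd p)
  have h4 := twist_fst_of_snd F u (ψ.fst p)
  rw [sInner_twist (F.unit p) u (A.cov ψ.sndPart p u)]
  simp only [SpinorField.sndPart_val, SpinorField.fstPart_val] at h1 h2 ⊢
  simp only [sInner, h1, h2, h3, h4]
  simp [sub_eq_add_neg]

/-- The interaction term after integration by parts, for a spinor field `ψ = φ + η` with
`φ = (0, β)` and `η = (α, 0)`; it does not depend on derivatives of `η`. -/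
theorem SpincConnection.sum_pairing_along (F : IsAdaptedFrame o a D X) (ψ : SpinorField a) :
    ∑ k, pairing (A.along (F.parseval.smooth k) ψ.sndPart) (A.along (F.parseval.smooth k) ψ.fstPart)
      = - pairing ((ψ.sndPart.clifford F F.smooth_reebLaplacian).cmul F (Complex.I / 2)) ψ.fstPart
        - 2 * ∑ k,
          pairing (twistField F k (A.along (F.parseval.smooth k) ψ.sndPart)) ψ.fstPart := by
  set φ := ψ.sndPart with hφ
  set η := ψ.fstPart with hη
  have h1 : ∀ k, pairing (A.along (F.parseval.smooth k) φ) (A.along (F.parseval.smooth k) η) =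
      pairing (twistField F k φ) (A.along (F.parseval.smooth k) η)
        - pairing (twistField F k (A.along (F.parseval.smooth k) φ)) η := by
    intro k
    simp only [pairing]
    rw [← integral_sub (F.integrable_sInner _ _) (F.integrable_sInner _ _)]
    exact integral_congr_ae (Eventually.of_forall fun p => A.sInner_cov_cov F ψ p (X k p))
  have h2 : ∀ k, pairing (twistField F k φ) (A.along (F.parseval.smooth k) η) =
      - pairing (A.along (F.parseval.smooth k) (twistField F k φ)) η
        - pairing ((twistField F k φ).smul (F.smooth_divergence (F.parseval.smooth k))) η := by
    intro k
    rw [A.pairing_along F (F.parseval.smooth k) (twistField F k φ)]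
    ring
  have h3 : (φ.clifford F F.smooth_reebLaplacian).cmul F (Complex.I / 2)
      + ∑ k, twistField F k (A.along (F.parseval.smooth k) φ) =
      ∑ k, (A.along (F.parseval.smooth k) (twistField F k φ)
        + (twistField F k φ).smul (F.smooth_divergence (F.parseval.smooth k))) := by
    refine SpinorField.ext_val fun p => ?_
    let L : TangentSpace (𝓡 3) p →ₗ[ℝ] SpinorAt p :=
      { toFun := fun u => spinorSmul o a p (Complex.I / 2) (clifford o a p u (φ.val p))
        map_add' := fun u v => by rw [clifford_add_left (F.unit p), spinorSmul_add (F.unit p)]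
        map_smul' := fun c u => by
          rw [clifford_smul_left (F.unit p), ← spinorSmul_ofReal (o := o) (a := a),
            ← spinorSmul_mul (F.unit p) _ _ (apply_clifford (F.unit p) _ _), mul_comm,
            spinorSmul_mul (F.unit p) _ _ (apply_clifford (F.unit p) _ _), spinorSmul_ofReal]
          rfl }
    have e1 : spinorSmul o a p (Complex.I / 2) (clifford o a p (reebLaplacian D X a p) (φ.val p)) =
        ∑ k, (divergence D (X k) p • twist o a D p (X k p) (φ.val p)
          + spinorSmul o a p (Complex.I / 2)
            (clifford o a p (D (fun q => D (dualVector a) q (X k q)) p (X k p)) (φ.val p))) := by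
      change L (∑ k, _) = _
      simp only [map_sum, map_add, map_smul]
      rfl
    simp only [SpinorField.add_val, SpinorField.sum_val, SpinorField.cmul_val,
      SpinorField.clifford_val, e1, twistField_val, A.along_val, A.cov_twistField F,
      SpinorField.smul_val]
    rw [← Finset.sum_add_distrib]
    exact Finset.sum_congr rfl fun k _ => by abel
  have h4 := congrArg (fun χ => pairing χ η) h3
  simp only [F.pairing_add_left, F.pairing_sum_left, Finset.sum_add_distrib] at h4
  simp only [h1, h2, Finset.sum_sub_distrib, Finset.sum_neg_distrib]
  linarith

/-- The left side in a form that is linear in `∇_u e₃` by the linearity of Clifford multiplication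
alone. -/
theorem twist_I {p : Y} (h : ‖a p‖ = 1) (u : TangentSpace (𝓡 3) p) (s : SpinorAt p) :
    twist o a D p u (spinorSmul o a p Complex.I s) =
      clifford o a p (D (dualVector a) p u) (spinorSmul o a p (Complex.I / 2)
        (spinorSmul o a p Complex.I s)) := by
  rw [twist, clifford_spinorSmul h (D (dualVector a) p u) (Complex.I / 2)]

/-- In the sum over the frame, `∇` may be replaced by `∇_r`, since the Reeb field is geodesic. -/
theorem SpincConnection.sum_twist_cov (F : IsAdaptedFrame o a D X) (r : ℝ) (φ : SpinorField a)
    (p : Y) : ∑ k, twist o a D p (X k p) (A.cov φ p (X k p)) =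
      ∑ k, twist o a D p (X k p) (covR A r φ p (X k p)) := by
  have h := F.unit p
  have e : ∀ k, twist o a D p (X k p) (covR A r φ p (X k p)) =
      twist o a D p (X k p) (A.cov φ p (X k p)) + (-(r / 2) * a p (X k p)) •
        clifford o a p (D (dualVector a) p (X k p)) (spinorSmul o a p (Complex.I / 2)
          (spinorSmul o a p Complex.I (φ.val p))) := by
    intro k
    rw [F.covR_eq, twist, clifford_add_right h, spinorSmul_add h, ← twist, ← twist_I h]
    congr 1
    rw [clifford_smul_right h, ← spinorSmul_ofReal (o := o) (a := a),
      ← spinorSmul_mul h _ _ (apply_clifford h _ _), mul_comm,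
      spinorSmul_mul h _ _ (apply_clifford h _ _), spinorSmul_ofReal]
    rfl
  -- the sum is a multiple of `cl(∇_{e₃} e₃)`
  have e2 : ∑ k, (-(r / 2) * a p (X k p)) • clifford o a p (D (dualVector a) p (X k p))
      (spinorSmul o a p (Complex.I / 2) (spinorSmul o a p Complex.I (φ.val p))) = 0 := by
    set s := spinorSmul o a p (Complex.I / 2) (spinorSmul o a p Complex.I (φ.val p))
    have h1 : cliffordₗ o h (D (dualVector a) p (∑ k, (-(r / 2) * a p (X k p)) • X k p)) s = 0 := by
      have : ∑ k, (-(r / 2) * a p (X k p)) • X k p = -(r / 2) • dualVector a p := by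
        rw [← F.sum_apply_smul p, Finset.smul_sum]
        simp only [smul_smul]
      rw [this, map_smul, F.adapted.covariantDerivative_dualVector F.leviCivita F.smooth_dual,
        smul_zero, map_zero, LinearMap.zero_apply]
    simp only [map_sum, map_smul, LinearMap.sum_apply, LinearMap.smul_apply] at h1
    exact h1
  simp only [e, Finset.sum_add_distrib]
  rw [e2, add_zero]

theorem IsAdaptedFrame.continuous_covNormSq (F : IsAdaptedFrame o a D X) (r : ℝ)
    (φ : SpinorField a) : Continuous (covNormSq A r φ) := by
  have hf : ∀ k, SmoothFun (fun p => -(r / 2) * a p (X k p)) := fun k =>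
    contMDiff_const.mul (F.smooth_apply (F.parseval.smooth k))
  have h : covNormSq A r φ = fun p => ∑ k, spinorNormSq p
      ((A.along (F.parseval.smooth k) φ + (φ.cmul F Complex.I).smul (hf k)).val p) := by
    funext p
    rw [F.covNormSq_eq]
    exact Finset.sum_congr rfl fun k _ => by rw [F.covR_eq]; rfl
  rw [h]
  exact continuous_finsetSum _ fun k _ => F.continuous_spinorNormSq _

/-- The pointwise bound for the integrand of the interaction term. The weights in Young's inequality
are chosen so that `|∇_r φ|²` and `|β|²` come with the factor `1/2`; the constant `K` collects the
factors left on `|α|²`. -/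
theorem SpincConnection.exists_interaction_bound (F : IsAdaptedFrame o a D X) :
    ∃ K, 0 ≤ K ∧ ∀ (r : ℝ) (ψ : SpinorField a) (p : Y),
      |sInner p ((A.weitz F ψ.sndPart).val p) (ψ.fstPart.val p)
      - sInner p (((ψ.sndPart.clifford F F.smooth_reebLaplacian).cmul F (Complex.I / 2)).val p)
          (ψ.fstPart.val p)
      - 2 * ∑ k, sInner p (twist o a D p (X k p) (A.cov ψ.sndPart p (X k p))) (ψ.fstPart.val p)|
      ≤ 1 / 2 * covNormSq A r ψ.sndPart p + 1 / 2 * ‖ψ.snd p‖ ^ 2 + K * ‖ψ.fst p‖ ^ 2 := by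
  obtain ⟨C, hC0, hC⟩ := A.exists_weitz_bound F
  obtain ⟨C₁, hC₁0, hC₁⟩ := exists_forall_le_of_continuous
    (F.smooth_reebLaplacian.inner F.smooth_reebLaplacian).continuous
  have hs := fun k => F.smooth_covariantDerivative (F.parseval.smooth k) F.smooth_dual
  obtain ⟨C₂, hC₂0, hC₂⟩ := exists_forall_le_of_continuous
    (continuous_finsetSum Finset.univ fun k _ => ((hs k).inner (hs k)).continuous)
  refine ⟨(C + 1) + (C₁ + 1) + C₂, by positivity, fun r ψ p => ?_⟩
  have h := F.unit p
  have hφ : spinorNormSq p (ψ.sndPart.val p) = ‖ψ.snd p‖ ^ 2 := by simp [spinorNormSq]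
  have hη : spinorNormSq p (ψ.fstPart.val p) = ‖ψ.fst p‖ ^ 2 := by simp [spinorNormSq]
  set φ := ψ.sndPart with hφ'
  set η := ψ.fstPart with hη'
  have b1 : 2 * |sInner p ((A.weitz F φ).val p) (η.val p)| ≤
      1 / 2 * ‖ψ.snd p‖ ^ 2 + 2 * (C + 1) * ‖ψ.fst p‖ ^ 2 := by
    have hc : (0 : ℝ) < (2 * (C + 1))⁻¹ := by positivity
    refine (two_mul_abs_sInner_le_of_pos p hc _ _).trans ?_
    rw [inv_inv, hη]
    refine add_le_add ?_ le_rfl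
    rw [inv_mul_le_iff₀ (by positivity)]
    have h1 := hC φ p
    rw [hφ] at h1
    nlinarith [sq_nonneg ‖ψ.snd p‖]
  have b2 : 2 * |sInner p (((φ.clifford F F.smooth_reebLaplacian).cmul F (Complex.I / 2)).val p)
      (η.val p)| ≤ 1 / 2 * ‖ψ.snd p‖ ^ 2 + 2 * (C₁ + 1) * ‖ψ.fst p‖ ^ 2 := by
    have hc : (0 : ℝ) < (2 * (C₁ + 1))⁻¹ := by positivity
    refine (two_mul_abs_sInner_le_of_pos p hc _ _).trans ?_
    rw [inv_inv, hη]
    refine add_le_add ?_ le_rfl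
    rw [inv_mul_le_iff₀ (by positivity), SpinorField.cmul_val, SpinorField.clifford_val,
      spinorNormSq_spinorSmul h _ (apply_clifford h _ _),
      spinorNormSq_clifford h _ (φ.apply_val p), hφ, ← real_inner_self_eq_norm_sq
        (reebLaplacian D X a p)]
    have h1 := mul_le_mul_of_nonneg_right (hC₁ p) (sq_nonneg ‖ψ.snd p‖)
    have h2 : ‖Complex.I / 2‖ ^ 2 = 1 / 4 := by simp; norm_num
    rw [h2]
    nlinarith [sq_nonneg ‖ψ.snd p‖]
  have b3 : |2 * ∑ k, sInner p (twist o a D p (X k p) (A.cov φ p (X k p))) (η.val p)| ≤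
      1 / 2 * covNormSq A r φ p + C₂ * ‖ψ.fst p‖ ^ 2 := by
    rw [← sInner_sum_left, A.sum_twist_cov F r, sInner_sum_left, Finset.mul_sum]
    refine (Finset.abs_sum_le_sum_abs _ _).trans ?_
    have hk : ∀ k, |2 * sInner p (twist o a D p (X k p) (covR A r φ p (X k p))) (η.val p)| ≤
        1 / 2 * spinorNormSq p (covR A r φ p (X k p))
          + 1 / 2 * (‖D (dualVector a) p (X k p)‖ ^ 2 * ‖ψ.fst p‖ ^ 2) := by
      intro k
      rw [abs_mul, abs_two, sInner_twist h]
      refine (two_mul_abs_sInner_le_of_pos p (c := 1 / 2) (by norm_num) _ _).trans ?_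
      rw [spinorNormSq_twist h _ (η.apply_val p), hη]
      apply le_of_eq
      ring
    refine (Finset.sum_le_sum fun k _ => hk k).trans ?_
    rw [Finset.sum_add_distrib, ← Finset.mul_sum, ← Finset.mul_sum, ← Finset.sum_mul,
      F.covNormSq_eq]
    refine add_le_add le_rfl ?_
    have h1 := mul_le_mul_of_nonneg_right (hC₂ p) (sq_nonneg ‖ψ.fst p‖)
    simp only [real_inner_self_eq_norm_sq] at h1
    have h2 : 0 ≤ C₂ * ‖ψ.fst p‖ ^ 2 := by positivity
    linarith
  have t1 := abs_sub (sInner p ((A.weitz F φ).val p) (η.val p)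
      - sInner p (((φ.clifford F F.smooth_reebLaplacian).cmul F (Complex.I / 2)).val p) (η.val p))
      (2 * ∑ k, sInner p (twist o a D p (X k p) (A.cov φ p (X k p))) (η.val p))
  have t2 := abs_sub (sInner p ((A.weitz F φ).val p) (η.val p))
      (sInner p (((φ.clifford F F.smooth_reebLaplacian).cmul F (Complex.I / 2)).val p) (η.val p))
  linarith

theorem integrable_of_continuous {f : Y → ℝ} (hf : Continuous f) :
    Integrable f (riemannianVolume Y) :=
  Continuous.integrable_riemannianVolume hf

theorem SpinorField.continuous_norm_fst (ψ : SpinorField a) : Continuous (fun p => ‖ψ.fst p‖ ^ 2) :=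
  ψ.smooth_fst.continuous.norm.pow 2

theorem SpinorField.continuous_norm_snd (ψ : SpinorField a) :
    Continuous fun p => ‖ψ.snd p‖ ^ 2 := by
  simp only [← real_inner_self_eq_norm_sq]
  exact (ψ.smooth_snd.inner ψ.smooth_snd).continuous

/-- The interaction `∫ ⟨D₀ φ, D₀ η⟩` of the components `φ = (0, β)` and `η = (α, 0)` is controlled
by `∇_r φ`, with a constant that does not depend on `r`. -/
theorem SpincConnection.exists_abs_pairing_le (F : IsAdaptedFrame o a D X) :
    ∃ K, 0 ≤ K ∧ ∀ (r : ℝ) (ψ : SpinorField a),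
      |pairing (A.diracField F ψ.sndPart) (A.diracField F ψ.fstPart)| ≤
        1 / 2 * ∫ p, covNormSq A r ψ.sndPart p ∂(riemannianVolume Y)
        + 1 / 2 * ∫ p, ‖ψ.snd p‖ ^ 2 ∂(riemannianVolume Y)
        + K * ∫ p, ‖ψ.fst p‖ ^ 2 ∂(riemannianVolume Y) := by
  obtain ⟨K, hK0, hK⟩ := A.exists_interaction_bound F
  refine ⟨K, hK0, fun r ψ => ?_⟩
  have h := A.pairing_weitz F ψ.sndPart ψ.fstPart
  rw [A.sum_pairing_along F] at h
  have hi := fun k => F.integrable_sInner (twistField F k (A.along (F.parseval.smooth k) ψ.sndPart))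
    ψ.fstPart
  have e : pairing (A.diracField F ψ.sndPart) (A.diracField F ψ.fstPart) =
      ∫ p, (sInner p ((A.weitz F ψ.sndPart).val p) (ψ.fstPart.val p)
      - sInner p (((ψ.sndPart.clifford F F.smooth_reebLaplacian).cmul F (Complex.I / 2)).val p)
          (ψ.fstPart.val p)
      - 2 * ∑ k, sInner p ((twistField F k (A.along (F.parseval.smooth k) ψ.sndPart)).val p)
          (ψ.fstPart.val p)) ∂(riemannianVolume Y) := by
    have h1 : Integrable (fun p => sInner p ((A.weitz F ψ.sndPart).val p) (ψ.fstPart.val p)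
      - sInner p (((ψ.sndPart.clifford F F.smooth_reebLaplacian).cmul F (Complex.I / 2)).val p)
          (ψ.fstPart.val p)) (riemannianVolume Y) :=
      (F.integrable_sInner _ _).sub (F.integrable_sInner _ _)
    rw [integral_sub h1 ((integrable_finsetSum _ fun k _ => hi k).const_mul 2),
      integral_sub (F.integrable_sInner _ _) (F.integrable_sInner _ _), integral_const_mul,
      integral_finsetSum _ fun k _ => hi k, h]
    unfold pairing
    ring
  have i1 := integrable_of_continuous (F.continuous_covNormSq A r ψ.sndPart)
  have i2 := integrable_of_continuous ψ.continuous_norm_snd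
  have i3 := integrable_of_continuous ψ.continuous_norm_fst
  have i12 : Integrable (fun p => 1 / 2 * covNormSq A r ψ.sndPart p + 1 / 2 * ‖ψ.snd p‖ ^ 2)
    (riemannianVolume Y) := (i1.const_mul _).add (i2.const_mul _)
  have i123 : Integrable (fun p => 1 / 2 * covNormSq A r ψ.sndPart p + 1 / 2 * ‖ψ.snd p‖ ^ 2
    + K * ‖ψ.fst p‖ ^ 2) (riemannianVolume Y) := i12.add (i3.const_mul _)
  rw [e, ← Real.norm_eq_abs]
  refine (norm_integral_le_of_norm_le i123 (Eventually.of_forall fun p => hK r ψ p)).trans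
    (le_of_eq ?_)
  rw [integral_add i12 (i3.const_mul _), integral_add (i1.const_mul _) (i2.const_mul _),
    integral_const_mul, integral_const_mul, integral_const_mul]

/-! ### Eigensections -/

/-- Multiplication of a spinor field by a real constant. -/
def SpinorField.rsmul (c : ℝ) (ψ : SpinorField a) : SpinorField a :=
  ψ.smul (f := fun _ => c) contMDiff_const

@[simp]
theorem SpinorField.rsmul_val (c : ℝ) (ψ : SpinorField a) (p : Y) :
    (ψ.rsmul c).val p = c • ψ.val p := rfl

theorem pairing_rsmul_left (c : ℝ) (ψ φ : SpinorField a) :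
    pairing (ψ.rsmul c) φ = c * pairing ψ φ := by
  simp only [pairing, SpinorField.rsmul_val, sInner_smul_left, integral_const_mul]

theorem pairing_rsmul_right (c : ℝ) (ψ φ : SpinorField a) :
    pairing ψ (φ.rsmul c) = c * pairing ψ φ := by
  rw [pairing_comm, pairing_rsmul_left, pairing_comm]

/-- The operator `cl(-(i/2) a)`, which is `1/2` on `ℂ` and `-1/2` on `K⁻¹`, on spinor fields. -/
def SpinorField.halfReeb (ψ : SpinorField a) : SpinorField a :=
  ψ.fstPart.rsmul (1 / 2) + ψ.sndPart.rsmul (-1 / 2)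

@[simp]
theorem SpinorField.halfReeb_val (ψ : SpinorField a) (p : Y) :
    ψ.halfReeb.val p = ((1 / 2 : ℝ) • ψ.fst p, (-1 / 2 : ℝ) • ψ.snd p) := by
  rw [halfReeb, add_val, rsmul_val, rsmul_val, fstPart_val, sndPart_val]
  exact Prod.ext (by simp) (by simp)

theorem IsAdaptedFrame.halfReeb_val (F : IsAdaptedFrame o a D X) (ψ : SpinorField a) (p : Y) :
    ψ.halfReeb.val p = halfClifford o a p (ψ.val p) := by
  rw [halfClifford_eq (F.unit p) (ψ.apply_val p), ψ.halfReeb_val]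
  refine Prod.ext rfl ?_
  simp only [SpinorField.val, Prod.smul_mk]
  module

/-- The Dirac operator `D_r` as an operator on spinor fields. -/
def SpincConnection.diracR (F : IsAdaptedFrame o a D X) (r : ℝ) (ψ : SpinorField a) :
    SpinorField a :=
  A.diracField F ψ + ψ.halfReeb.rsmul r

theorem SpincConnection.diracR_val (F : IsAdaptedFrame o a D X) (r : ℝ) (ψ : SpinorField a)
    (p : Y) : (A.diracR F r ψ).val p = dirac A r ψ p := by
  rw [diracR, SpinorField.add_val, SpinorField.rsmul_val, F.halfReeb_val]
  rfl

theorem pairing_halfReeb (ψ φ : SpinorField a) : pairing ψ.halfReeb φ = pairing ψ φ.halfReeb := by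
  simp only [pairing]
  congr 1
  funext p
  rw [ψ.halfReeb_val, φ.halfReeb_val]
  simp [sInner, SpinorField.val, real_inner_smul_left, real_inner_smul_right]
  ring

theorem SpincConnection.pairing_diracR (F : IsAdaptedFrame o a D X) (r : ℝ) (ψ φ : SpinorField a) :
    pairing (A.diracR F r ψ) φ = pairing ψ (A.diracR F r φ) := by
  rw [diracR, diracR, F.pairing_add_left, F.pairing_add_right, A.pairing_diracField F,
    pairing_rsmul_left, pairing_rsmul_right, pairing_halfReeb]

theorem SpinorField.fstPart_add_sndPart (ψ : SpinorField a) : ψ.fstPart + ψ.sndPart = ψ :=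
  SpinorField.ext_val fun _ => Prod.ext (add_zero _) (zero_add _)

theorem SpinorField.halfReeb_fstPart (ψ : SpinorField a) :
    ψ.fstPart.halfReeb = ψ.fstPart.rsmul (1 / 2) :=
  SpinorField.ext_val fun p => by
    rw [halfReeb_val, rsmul_val]
    exact Prod.ext rfl (by simp [val, fstPart])

theorem SpinorField.halfReeb_sndPart (ψ : SpinorField a) :
    ψ.sndPart.halfReeb = ψ.sndPart.rsmul (-1 / 2) :=
  SpinorField.ext_val fun p => by
    rw [halfReeb_val, rsmul_val]
    exact Prod.ext (by simp [val, sndPart]) rfl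

theorem pairing_sndPart_fstPart (ψ φ : SpinorField a) : pairing ψ.sndPart φ.fstPart = 0 := by
  simp [pairing, sInner]

theorem pairing_sndPart_self (ψ : SpinorField a) :
    pairing ψ.sndPart ψ.sndPart = ∫ p, ‖ψ.snd p‖ ^ 2 ∂(riemannianVolume Y) := by
  simp [pairing, sInner]

theorem pairing_fstPart_self (ψ : SpinorField a) :
    pairing ψ.fstPart ψ.fstPart = ∫ p, ‖ψ.fst p‖ ^ 2 ∂(riemannianVolume Y) := by
  simp only [pairing, sInner_self]
  simp [spinorNormSq]

/-- The components of a spinor field are orthogonal. -/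
theorem IsAdaptedFrame.pairing_self (F : IsAdaptedFrame o a D X) (ψ : SpinorField a) :
    pairing ψ ψ = ∫ p, ‖ψ.fst p‖ ^ 2 ∂(riemannianVolume Y)
      + ∫ p, ‖ψ.snd p‖ ^ 2 ∂(riemannianVolume Y) := by
  conv_lhs => rw [← ψ.fstPart_add_sndPart]
  rw [F.pairing_add_left, F.pairing_add_right, F.pairing_add_right, pairing_sndPart_fstPart,
    pairing_comm ψ.fstPart ψ.sndPart, pairing_sndPart_fstPart, pairing_fstPart_self,
    pairing_sndPart_self]
  ring

theorem IsAdaptedFrame.pairing_halfReeb_self (F : IsAdaptedFrame o a D X) (ψ : SpinorField a) :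
    pairing ψ ψ.halfReeb = 1 / 2 * ∫ p, ‖ψ.fst p‖ ^ 2 ∂(riemannianVolume Y)
      - 1 / 2 * ∫ p, ‖ψ.snd p‖ ^ 2 ∂(riemannianVolume Y) := by
  rw [SpinorField.halfReeb, F.pairing_add_right, pairing_rsmul_right, pairing_rsmul_right]
  conv_lhs => rw [← ψ.fstPart_add_sndPart]
  simp only [ψ.fstPart_add_sndPart]
  have h1 : pairing (ψ.fstPart + ψ.sndPart) ψ.fstPart = pairing ψ.fstPart ψ.fstPart := by
    rw [F.pairing_add_left, pairing_sndPart_fstPart, add_zero]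
  have h2 : pairing (ψ.fstPart + ψ.sndPart) ψ.sndPart = pairing ψ.sndPart ψ.sndPart := by
    rw [F.pairing_add_left, pairing_comm ψ.fstPart, pairing_sndPart_fstPart, zero_add]
  rw [ψ.fstPart_add_sndPart] at h1 h2
  rw [h1, h2, pairing_fstPart_self, pairing_sndPart_self]
  ring

/-- For an eigensection, `∫ |D_r φ|²` only involves the eigenvalue and the interaction of the two
components: the terms containing `r` cancel since `D₀` is symmetric. -/
theorem SpincConnection.pairing_diracR_sndPart (F : IsAdaptedFrame o a D X) {r lam : ℝ}
    {ψ : SpinorField a} (hψ : A.diracR F r ψ = ψ.rsmul lam) :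
    pairing (A.diracR F r ψ.sndPart) (A.diracR F r ψ.sndPart) =
      lam ^ 2 * ∫ p, ‖ψ.snd p‖ ^ 2 ∂(riemannianVolume Y)
        - pairing (A.diracField F ψ.sndPart) (A.diracField F ψ.fstPart) := by
  have h1 : A.diracR F r ψ = A.diracR F r ψ.fstPart + A.diracR F r ψ.sndPart := by
    refine SpinorField.ext_val fun p => ?_
    conv_lhs => rw [← ψ.fstPart_add_sndPart]
    simp only [diracR, SpinorField.add_val, A.diracField_val, A.diracZero_add F,
      SpinorField.rsmul_val, F.halfReeb_val]
    rw [halfClifford_eq (F.unit p) (ψ.fstPart.apply_val p),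
      halfClifford_eq (F.unit p) (ψ.sndPart.apply_val p),
      halfClifford_eq (F.unit p) (by simp [ψ.tangent_snd p])]
    refine Prod.ext ?_ ?_ <;> simp <;> abel
  have h2 : pairing (A.diracR F r ψ.sndPart) (A.diracR F r ψ) =
      lam ^ 2 * ∫ p, ‖ψ.snd p‖ ^ 2 ∂(riemannianVolume Y) := by
    rw [hψ, pairing_rsmul_right, A.pairing_diracR F, hψ, pairing_rsmul_right]
    have : pairing ψ.sndPart ψ = pairing ψ.sndPart ψ.sndPart := by
      conv_lhs => enter [2]; rw [← ψ.fstPart_add_sndPart]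
      rw [F.pairing_add_right, pairing_sndPart_fstPart, zero_add]
    rw [this, pairing_sndPart_self]
    ring
  rw [h1, F.pairing_add_right] at h2
  have h3 : pairing (A.diracR F r ψ.sndPart) (A.diracR F r ψ.fstPart) =
      pairing (A.diracField F ψ.sndPart) (A.diracField F ψ.fstPart) := by
    rw [diracR, diracR, ψ.halfReeb_sndPart, ψ.halfReeb_fstPart]
    simp only [F.pairing_add_left, F.pairing_add_right, pairing_rsmul_left, pairing_rsmul_right,
      pairing_sndPart_fstPart, A.pairing_diracField F ψ.sndPart ψ.fstPart]
    ring
  linarith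

/-- The integrated twisted Weitzenböck formula for `φ = (0, β)`. -/
theorem SpincConnection.pairing_diracR_self (F : IsAdaptedFrame o a D X) (r : ℝ)
    (ψ : SpinorField a) : pairing (A.diracR F r ψ.sndPart) (A.diracR F r ψ.sndPart) =
      ∫ p, covNormSq A r ψ.sndPart p ∂(riemannianVolume Y)
        + r * ∫ p, ‖ψ.snd p‖ ^ 2 ∂(riemannianVolume Y)
        + pairing (A.weitz F ψ.sndPart) ψ.sndPart := by
  have h := A.pairing_weitz F ψ.sndPart ψ.sndPart
  have hi := fun k => F.integrable_sInner (A.along (F.parseval.smooth k) ψ.sndPart)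
    (A.along (F.parseval.smooth k) ψ.sndPart)
  have i1 := F.integrable_sInner (A.diracR F r ψ.sndPart) (A.diracR F r ψ.sndPart)
  have i2 := integrable_of_continuous (F.continuous_covNormSq A r ψ.sndPart)
  have i3 := F.integrable_sInner (A.diracField F ψ.sndPart) (A.diracField F ψ.sndPart)
  have i4 := integrable_of_continuous ψ.continuous_norm_snd
  have e : ∀ p, sInner p ((A.diracR F r ψ.sndPart).val p) ((A.diracR F r ψ.sndPart).val p)
      - covNormSq A r ψ.sndPart p =
      sInner p ((A.diracField F ψ.sndPart).val p) ((A.diracField F ψ.sndPart).val p)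
      - ∑ k, sInner p ((A.along (F.parseval.smooth k) ψ.sndPart).val p)
        ((A.along (F.parseval.smooth k) ψ.sndPart).val p) + r * ‖ψ.snd p‖ ^ 2 := by
    intro p
    simp only [sInner_self, A.diracR_val, A.diracField_val, A.along_val]
    exact A.spinorNormSq_dirac_sub F r (fun _ => rfl) p
  have e2 := integral_congr_ae (μ := riemannianVolume Y) (Eventually.of_forall e)
  have i5 : Integrable (fun p =>
      sInner p ((A.diracField F ψ.sndPart).val p) ((A.diracField F ψ.sndPart).val p)
      - ∑ k, sInner p ((A.along (F.parseval.smooth k) ψ.sndPart).val p)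
        ((A.along (F.parseval.smooth k) ψ.sndPart).val p)) (riemannianVolume Y) :=
    i3.sub (integrable_finsetSum _ fun k _ => hi k)
  rw [integral_sub i1 i2, integral_add i5 (i4.const_mul r),
    integral_sub i3 (integrable_finsetSum _ fun k _ => hi k),
    integral_finsetSum _ fun k _ => hi k, integral_const_mul] at e2
  unfold pairing at h ⊢
  linarith

theorem IsEigensection.diracR_eq (F : IsAdaptedFrame o a D X) {r lam : ℝ} {ψ : SpinorField a}
    (h : IsEigensection A r lam ψ) : A.diracR F r ψ = ψ.rsmul lam :=
  SpinorField.ext_val fun p => by rw [A.diracR_val, h.eigen, SpinorField.rsmul_val]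

/-- The estimates for the second component of an eigensection. Comparing the two expressions for
`∫ |D_r φ|²`, the terms of size `∫ |β|²` are absorbed in `r ∫ |β|²` for `r ≥ 2 (δ₁² + C + 2)`, and
half of `∫ |∇_r φ|²` is absorbed in `∫ |∇_r φ|²`. -/
theorem SpincConnection.exists_eigensection_bound (F : IsAdaptedFrame o a D X) (δ₁ : ℝ) :
    ∃ c : ℝ, 0 < c ∧ ∀ r : ℝ, c ≤ r → ∀ (lam : ℝ) (ψ : SpinorField a),
      IsEigensection A r lam ψ → |lam| ≤ δ₁ →
        r * (∫ p, ‖ψ.snd p‖ ^ 2 ∂(riemannianVolume Y))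
            + ∫ p, covNormSq A r ψ.sndPart p ∂(riemannianVolume Y)
          ≤ c * ∫ p, ‖ψ.fst p‖ ^ 2 ∂(riemannianVolume Y) ∧
        ∫ p, spinorNormSq p (dirac A r ψ.sndPart p) ∂(riemannianVolume Y)
          ≤ c * ∫ p, ‖ψ.fst p‖ ^ 2 ∂(riemannianVolume Y) := by
  obtain ⟨C, hC0, hC⟩ := A.exists_weitz_bound F
  obtain ⟨K, hK0, hK⟩ := A.exists_abs_pairing_le F
  refine ⟨2 * (δ₁ ^ 2 + C + 2) + (2 * δ₁ ^ 2 + 3) * K, by positivity, fun r hr lam ψ hψ hlam => ?_⟩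
  have h1 := A.pairing_diracR_sndPart F (hψ.diracR_eq A F)
  have h2 := A.pairing_diracR_self F r ψ
  have h3 := hK r ψ
  have h4 : |pairing (A.weitz F ψ.sndPart) ψ.sndPart| ≤
      (C + 1) / 2 * ∫ p, ‖ψ.snd p‖ ^ 2 ∂(riemannianVolume Y) := by
    rw [← Real.norm_eq_abs, ← integral_const_mul]
    refine norm_integral_le_of_norm_le
      ((integrable_of_continuous ψ.continuous_norm_snd).const_mul _)
      (Eventually.of_forall fun p => ?_)
    have e1 := two_mul_abs_sInner_le p ((A.weitz F ψ.sndPart).val p) (ψ.sndPart.val p)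
    have e2 := hC ψ.sndPart p
    have e3 : spinorNormSq p (ψ.sndPart.val p) = ‖ψ.snd p‖ ^ 2 := by simp [spinorNormSq]
    rw [e3] at e1 e2
    rw [Real.norm_eq_abs]
    linarith
  have h5 : ∫ p, spinorNormSq p (dirac A r ψ.sndPart p) ∂(riemannianVolume Y) =
      pairing (A.diracR F r ψ.sndPart) (A.diracR F r ψ.sndPart) := by
    simp only [pairing, sInner_self, A.diracR_val]
  rw [h5]
  have hA : 0 ≤ ∫ p, ‖ψ.fst p‖ ^ 2 ∂(riemannianVolume Y) := integral_nonneg fun _ => by positivity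
  have hB : 0 ≤ ∫ p, ‖ψ.snd p‖ ^ 2 ∂(riemannianVolume Y) := integral_nonneg fun _ => by positivity
  have hG : 0 ≤ ∫ p, covNormSq A r ψ.sndPart p ∂(riemannianVolume Y) :=
    integral_nonneg fun p => Finset.sum_nonneg fun i _ => spinorNormSq_nonneg p _
  have hl : lam ^ 2 ≤ δ₁ ^ 2 := sq_le_sq' (by linarith [neg_abs_le lam])
    ((le_abs_self lam).trans hlam)
  set a₀ := ∫ p, ‖ψ.fst p‖ ^ 2 ∂(riemannianVolume Y)
  set b₀ := ∫ p, ‖ψ.snd p‖ ^ 2 ∂(riemannianVolume Y)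
  set g₀ := ∫ p, covNormSq A r ψ.sndPart p ∂(riemannianVolume Y)
  set P := pairing (A.diracField F ψ.sndPart) (A.diracField F ψ.fstPart)
  set W := pairing (A.weitz F ψ.sndPart) ψ.sndPart
  set S := pairing (A.diracR F r ψ.sndPart) (A.diracR F r ψ.sndPart)
  have hP := (neg_abs_le P)
  have hW := (neg_abs_le W)
  have hlb : lam ^ 2 * b₀ ≤ δ₁ ^ 2 * b₀ := mul_le_mul_of_nonneg_right hl hB
  have hKd : 0 ≤ (2 * δ₁ ^ 2 + 3) * K := by positivity
  have hrb : 2 * (δ₁ ^ 2 + C + 2) * b₀ ≤ r * b₀ :=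
    mul_le_mul_of_nonneg_right (by linarith) hB
  have hCb : 0 ≤ C * b₀ := by positivity
  have hδb : 0 ≤ δ₁ ^ 2 * b₀ := by positivity
  have key : r * b₀ + g₀ ≤ 2 * K * a₀ := by nlinarith
  have hδK : 0 ≤ δ₁ ^ 2 * K * a₀ := by positivity
  have hKa : 0 ≤ K * a₀ := by positivity
  have hCa : 0 ≤ C * a₀ := by positivity
  have hδa : 0 ≤ δ₁ ^ 2 * a₀ := by positivity
  refine ⟨by nlinarith, ?_⟩
  -- `λ² b₀` is bounded through the estimate just proved, as `r ≥ 1`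
  have key2 : δ₁ ^ 2 * b₀ ≤ δ₁ ^ 2 * (2 * K * a₀) :=
    mul_le_mul_of_nonneg_left (by nlinarith) (sq_nonneg _)
  nlinarith

/-! ### Families of eigensections -/

theorem IsAdaptedFrame.pairing_self_pos (F : IsAdaptedFrame o a D X) {ψ : SpinorField a}
    (h : ∃ p, ψ.val p ≠ 0) : 0 < pairing ψ ψ := by
  simp only [pairing, sInner_self]
  obtain ⟨p, hp⟩ := h
  refine (F.continuous_spinorNormSq ψ).integral_pos_of_hasCompactSupport_nonneg_nonzero
    (.of_compactSpace _) (fun q => spinorNormSq_nonneg q _) (x := p) fun h0 => hp ?_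
  rw [spinorNormSq, add_eq_zero_iff_of_nonneg (by positivity) (by positivity)] at h0
  exact Prod.ext (by simpa using h0.1) (by simpa using h0.2)

/-- Continuity suffices here: the derivative of a `C¹` family of sections is only assumed to be
continuous on `Y`. -/
theorem continuous_sInner {α α' : Y → ℂ} {β β' : (p : Y) → TangentSpace (𝓡 3) p}
    (hα : Continuous α) (hα' : Continuous α')
    (hβ : Continuous (fun p => (⟨p, β p⟩ : TangentBundle (𝓡 3) Y)))
    (hβ' : Continuous (fun p => (⟨p, β' p⟩ : TangentBundle (𝓡 3) Y))) :
    Continuous (fun p => sInner p (α p, β p) (α' p, β' p)) := by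
  have : IsContinuousRiemannianBundle E3 (fun p : Y => TangentSpace (𝓡 3) p) := by
    obtain ⟨g, hg, h⟩ := IsContMDiffRiemannianBundle.exists_contMDiff (IB := 𝓡 3) (n := ∞)
      (F := E3) (E := fun p : Y => TangentSpace (𝓡 3) p)
    exact ⟨g, hg.continuous, h⟩
  exact (hα.inner hα').add (hβ.inner_bundle hβ')

/-- An `L²`-differentiable family of spinor fields is weakly continuous. -/
theorem IsAdaptedFrame.tendsto_pairing (F : IsAdaptedFrame o a D X) {ψ : ℝ → SpinorField a}
    {ε : ℝ} (hε : 0 < ε) (hψ : IsC1Family ψ ε) (χ : SpinorField a) :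
    Tendsto (fun t => pairing (ψ t) χ) (𝓝[≠] 0) (𝓝 (pairing (ψ 0) χ)) := by
  obtain ⟨α', β', hc, hd, -⟩ := hψ
  have h0 : (0 : ℝ) ∈ Ioo (-ε) ε := ⟨by linarith, hε⟩
  obtain ⟨hα, hβ⟩ := hc 0 h0
  have hd := hd 0 h0
  simp only [zero_add] at hd
  set σ : (p : Y) → SpinorAt p := fun p => (α' 0 p, β' 0 p)
  set N : ℝ → ℝ := fun h => ∫ p, spinorNormSq p
      (h⁻¹ • ((ψ h).val p - (ψ 0).val p) - σ p) ∂(riemannianVolume Y)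
  have iσ : ∀ φ : SpinorField a, Integrable (fun p => sInner p (φ.val p) (σ p))
      (riemannianVolume Y) := fun φ => integrable_of_continuous
    (continuous_sInner φ.smooth_fst.continuous hα φ.smooth_snd.continuous hβ)
  have iσσ : Integrable (fun p => sInner p (σ p) (σ p)) (riemannianVolume Y) :=
    integrable_of_continuous (continuous_sInner hα hα hβ hβ)
  set C : ℝ := 1 / 2 * pairing χ χ + |∫ p, sInner p (χ.val p) (σ p) ∂(riemannianVolume Y)|
  -- the difference is `h` times the pairing with a difference quotient, and the difference
  -- quotients are bounded in `L²`
  have hb : ∀ h : ℝ, h ≠ 0 →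
      |pairing (ψ h) χ - pairing (ψ 0) χ| ≤ |h| * (1 / 2 * N h + C) := by
    intro h hh
    let φ : SpinorField a := (ψ h + (ψ 0).rsmul (-1)).rsmul h⁻¹
    have hφ : ∀ p, φ.val p = h⁻¹ • ((ψ h).val p - (ψ 0).val p) := fun p => by
      simp [φ, sub_eq_add_neg]
    have e1 : pairing (ψ h) χ - pairing (ψ 0) χ = h * pairing φ χ := by
      simp only [φ, pairing_rsmul_left, F.pairing_add_left]
      field_simp
      ring
    have iN : Integrable (fun p => spinorNormSq p (φ.val p - σ p)) (riemannianVolume Y) := by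
      have := ((F.integrable_sInner φ φ).sub ((iσ φ).const_mul 2)).add iσσ
      refine this.congr (Eventually.of_forall fun p => ?_)
      simp only [Pi.add_apply, Pi.sub_apply]
      rw [← sInner_self, sInner_sub_left, sInner_sub_right, sInner_sub_right,
        sInner_comm p (σ p) (φ.val p)]
      ring
    have e2 : pairing φ χ - ∫ p, sInner p (χ.val p) (σ p) ∂(riemannianVolume Y) =
        ∫ p, sInner p (φ.val p - σ p) (χ.val p) ∂(riemannianVolume Y) := by
      rw [pairing, ← integral_sub (F.integrable_sInner φ χ) (iσ χ)]
      simp only [sInner_sub_left]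
      simp only [sInner_comm _ (σ _)]
    have e3 : |∫ p, sInner p (φ.val p - σ p) (χ.val p) ∂(riemannianVolume Y)| ≤
        1 / 2 * N h + 1 / 2 * pairing χ χ := by
      simp only [N, ← hφ, pairing]
      rw [← integral_const_mul, ← integral_const_mul, ← integral_add (iN.const_mul _)
        ((F.integrable_sInner χ χ).const_mul _), ← Real.norm_eq_abs]
      refine norm_integral_le_of_norm_le ((iN.const_mul _).add
        ((F.integrable_sInner χ χ).const_mul _)) (Eventually.of_forall fun p => ?_)
      have := two_mul_abs_sInner_le p (φ.val p - σ p) (χ.val p)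
      rw [Real.norm_eq_abs, sInner_self]
      linarith
    rw [e1, abs_mul]
    refine mul_le_mul_of_nonneg_left ?_ (abs_nonneg h)
    rw [← e2] at e3
    have := abs_sub_abs_le_abs_sub (pairing φ χ)
      (∫ p, sInner p (χ.val p) (σ p) ∂(riemannianVolume Y))
    simp only [C]
    linarith
  rw [tendsto_iff_norm_sub_tendsto_zero]
  have hlim : Tendsto (fun h : ℝ => |h| * (1 / 2 * N h + C)) (𝓝[≠] 0) (𝓝 0) := by
    have h1 : Tendsto (fun h : ℝ => |h|) (𝓝[≠] 0) (𝓝 0) := by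
      have := (continuous_abs.tendsto (0 : ℝ)).mono_left (nhdsWithin_le_nhds (s := {0}ᶜ))
      simpa using this
    have h2 := h1.mul ((hd.const_mul (1 / 2)).add_const C)
    rwa [zero_mul] at h2
  refine squeeze_zero' (Eventually.of_forall fun _ => norm_nonneg _) ?_ hlim
  filter_upwards [self_mem_nhdsWithin] with h hh
  rw [Real.norm_eq_abs]
  exact hb h hh

theorem IsEigenBranch.hasDerivAt {A : SpincConnection o a D} {r ε : ℝ} {lam : ℝ → ℝ}
    {ψ : ℝ → SpinorField a} (h : IsEigenBranch A r ε lam ψ) :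
    HasDerivAt lam (deriv lam 0) 0 :=
  ((h.smooth_eigenvalue.contDiffAt (Ioo_mem_nhds (by linarith [h.pos]) h.pos)).differentiableAt
    (by simp)).hasDerivAt

/-- The first variation formula for eigenvalues. By the symmetry of `D_r`, the pairing of the
difference quotient of the eigenvalue equation with `ψ(0)` contains no derivative of `ψ`, so weak
continuity of the family is enough to pass to the limit. -/
theorem IsEigenBranch.deriv_mul_pairing (F : IsAdaptedFrame o a D X) {r ε : ℝ} {lam : ℝ → ℝ}
    {ψ : ℝ → SpinorField a} (h : IsEigenBranch A r ε lam ψ) :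
    deriv lam 0 * pairing (ψ 0) (ψ 0) = pairing (ψ 0) (ψ 0).halfReeb := by
  have h1 := (hasDerivAt_iff_tendsto_slope_zero.1 h.hasDerivAt).mul
    (F.tendsto_pairing h.pos h.smooth_section (ψ 0))
  refine tendsto_nhds_unique (h1.congr' ?_)
    (F.tendsto_pairing h.pos h.smooth_section (ψ 0).halfReeb)
  have hI : Ioo (-ε) ε ∈ 𝓝[≠] (0 : ℝ) :=
    mem_nhdsWithin_of_mem_nhds (Ioo_mem_nhds (by linarith [h.pos]) h.pos)
  filter_upwards [self_mem_nhdsWithin, hI] with t ht htI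
  have ht : t ≠ 0 := ht
  have et := congrArg (pairing · (ψ 0)) ((h.eigen t htI).diracR_eq A F)
  have e0 := congrArg (pairing (ψ t)) ((h.eigen 0 ⟨by linarith [h.pos], h.pos⟩).diracR_eq A F)
  simp only [A.pairing_diracR F, pairing_rsmul_left] at et
  rw [SpincConnection.diracR, F.pairing_add_right, pairing_rsmul_right] at et
  rw [SpincConnection.diracR, F.pairing_add_right, pairing_rsmul_right, pairing_rsmul_right] at e0
  simp only [zero_add, smul_eq_mul]
  field_simp
  linarith

theorem IsAdaptedFrame.crossingForm_eq (F : IsAdaptedFrame o a D X) (ψ : SpinorField a) :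
    crossingForm o ψ = pairing ψ ψ.halfReeb := by
  simp only [crossingForm, pairing, F.halfReeb_val]
  exact integral_congr_ae (Eventually.of_forall fun _ => re_spinorHerm _ _)

/-- A function with a positive derivative at a zero changes its sign from negative to positive. -/
theorem eventually_sign_of_hasDerivAt_pos {f : ℝ → ℝ} {f' : ℝ} (hf : HasDerivAt f f' 0)
    (h0 : f 0 = 0) (hf' : 0 < f') :
    (∀ᶠ s in 𝓝[<] (0 : ℝ), f s < 0) ∧ (∀ᶠ s in 𝓝[>] (0 : ℝ), 0 < f s) := by
  have h := (hasDerivAt_iff_tendsto_slope_zero.1 hf).eventually (lt_mem_nhds hf')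
  simp only [zero_add, h0, sub_zero, smul_eq_mul] at h
  constructor
  · filter_upwards [h.filter_mono (nhdsWithin_mono _ fun s hs => ne_of_lt hs),
      self_mem_nhdsWithin] with s hs hs0
    exact neg_of_mul_pos_right hs (inv_nonpos.2 (le_of_lt hs0))
  · filter_upwards [h.filter_mono (nhdsWithin_mono _ fun s hs => ne_of_gt hs),
      self_mem_nhdsWithin] with s hs hs0
    exact (pos_iff_pos_of_mul_pos hs).1 (inv_pos.2 hs0)

end Estimates

end ContactDirac

end

theorem mainTheorem6 {Y : Type*} [TopologicalSpace Y] [ChartedSpace ContactDirac.E3 Y]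
    [IsManifold (𝓡 3) ∞ Y] [T2Space Y] [CompactSpace Y] [ConnectedSpace Y]
    [MeasurableSpace Y] [BorelSpace Y]
    [RiemannianBundle (fun p : Y => TangentSpace (𝓡 3) p)]
    [IsContMDiffRiemannianBundle (𝓡 3) ∞ ContactDirac.E3 (fun p : Y => TangentSpace (𝓡 3) p)]
    (o : ContactDirac.ManifoldOrientation Y) (a : ContactDirac.OneForm Y)
    (ha : ContactDirac.IsContactForm a) (hadapted : ContactDirac.IsAdapted o a)
    (D : CovariantDerivative (𝓡 3) ContactDirac.E3 (fun p : Y => TangentSpace (𝓡 3) p))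
    (hD : ContactDirac.IsLeviCivita D)
    (A : ContactDirac.SpincConnection o a D) (hA : ContactDirac.IsCanonical A)
    (δ₁ : ℝ) (hδ₁ : 0 ≤ δ₁) :
    ∃ c : ℝ, 0 < c ∧
      -- estimates for a single eigensection
      (∀ r : ℝ, c ≤ r → ∀ (lam : ℝ) (ψ : ContactDirac.SpinorField a),
        ContactDirac.IsEigensection A r lam ψ → |lam| ≤ δ₁ →
          (∫ p, ‖ψ.snd p‖ ^ 2 ∂(ContactDirac.riemannianVolume Y))
              + r⁻¹ * ∫ p, ContactDirac.covNormSq A r ψ.sndPart p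
                  ∂(ContactDirac.riemannianVolume Y)
            ≤ c * r⁻¹ * ∫ p, ‖ψ.fst p‖ ^ 2 ∂(ContactDirac.riemannianVolume Y) ∧
          ∫ p, ContactDirac.spinorNormSq p (ContactDirac.dirac A r ψ.sndPart p)
              ∂(ContactDirac.riemannianVolume Y)
            ≤ c * ∫ p, ‖ψ.fst p‖ ^ 2 ∂(ContactDirac.riemannianVolume Y)) ∧
      -- the slope of a family of eigenvalues
      (∀ r : ℝ, c ≤ r → ∀ (ε : ℝ) (lam : ℝ → ℝ) (ψ : ℝ → ContactDirac.SpinorField a),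
        ContactDirac.IsEigenBranch A r ε lam ψ → |lam 0| ≤ δ₁ → |deriv lam 0 - 1 / 2| ≤ c / r) ∧
      -- every zero crossing of a family of eigenvalues is from negative to positive values
      (∀ r : ℝ, c ≤ r → ∀ (ε : ℝ) (lam : ℝ → ℝ) (ψ : ℝ → ContactDirac.SpinorField a),
        ContactDirac.IsEigenBranch A r ε lam ψ → lam 0 = 0 →
          (∀ᶠ s in 𝓝[<] (0 : ℝ), lam s < 0) ∧ (∀ᶠ s in 𝓝[>] (0 : ℝ), 0 < lam s)) ∧
      -- every zero mode contributes to the spectral flow with a positive sign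
      (∀ r : ℝ, c ≤ r → ∀ ψ : ContactDirac.SpinorField a,
        ContactDirac.IsEigensection A r 0 ψ → 0 < ContactDirac.crossingForm o ψ) := by
  obtain ⟨n, X, hX⟩ := ContactDirac.exists_parsevalFrame (Y := Y)
  have F : ContactDirac.IsAdaptedFrame o a D X :=
    ⟨hadapted, hD, hX, hX.smooth_dualVector ha.smooth⟩
  obtain ⟨c, hc, hbound⟩ := A.exists_eigensection_bound F δ₁
  -- with the constant `4 c` in place of `c`, the slopes are at least `1/2 - 1/4` and
  -- `∫ |β|² ≤ ¼ ∫ |α|²` for zero modes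
  have hle : ∀ r, 4 * c ≤ r → c ≤ r := fun r hr => by linarith
  have ha0 : ∀ ψ : ContactDirac.SpinorField a,
      0 ≤ ∫ p, ‖ψ.fst p‖ ^ 2 ∂(ContactDirac.riemannianVolume Y) :=
    fun ψ => integral_nonneg fun _ => by positivity
  have hb0 : ∀ ψ : ContactDirac.SpinorField a,
      0 ≤ ∫ p, ‖ψ.snd p‖ ^ 2 ∂(ContactDirac.riemannianVolume Y) :=
    fun ψ => integral_nonneg fun _ => by positivity
  have hg0 : ∀ r (ψ : ContactDirac.SpinorField a),
      0 ≤ ∫ p, ContactDirac.covNormSq A r ψ.sndPart p ∂(ContactDirac.riemannianVolume Y) :=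
    fun r ψ => integral_nonneg fun p =>
      Finset.sum_nonneg fun i _ => ContactDirac.spinorNormSq_nonneg p _
  have hsnd : ∀ r, 4 * c ≤ r → ∀ (lam : ℝ) (ψ : ContactDirac.SpinorField a),
      ContactDirac.IsEigensection A r lam ψ → |lam| ≤ δ₁ →
      r * (∫ p, ‖ψ.snd p‖ ^ 2 ∂(ContactDirac.riemannianVolume Y)) ≤
        c * ∫ p, ‖ψ.fst p‖ ^ 2 ∂(ContactDirac.riemannianVolume Y) := by
    intro r hr lam ψ hψ hlam
    linarith [(hbound r (hle r hr) lam ψ hψ hlam).1, hg0 r ψ]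
  have hslope : ∀ r : ℝ, 4 * c ≤ r → ∀ (ε : ℝ) (lam : ℝ → ℝ) (ψ : ℝ → ContactDirac.SpinorField a),
      ContactDirac.IsEigenBranch A r ε lam ψ → |lam 0| ≤ δ₁ → |deriv lam 0 - 1 / 2| ≤ c / r := by
    intro r hr ε lam ψ h hlam
    have hr0 : 0 < r := by linarith
    have hE := h.eigen 0 ⟨by linarith [h.pos], h.pos⟩
    rw [add_zero] at hE
    have h1 := h.deriv_mul_pairing A F
    have h2 := F.pairing_self_pos hE.nonzero
    have h3 := hsnd r hr _ _ hE hlam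
    rw [F.pairing_halfReeb_self] at h1
    rw [F.pairing_self] at h1 h2
    have h4 := ha0 (ψ 0)
    have h5 := hb0 (ψ 0)
    generalize (∫ p, ‖(ψ 0).fst p‖ ^ 2 ∂(ContactDirac.riemannianVolume Y)) = x at *
    generalize (∫ p, ‖(ψ 0).snd p‖ ^ 2 ∂(ContactDirac.riemannianVolume Y)) = y at *
    -- the derivative differs from `1/2` by the fraction of the mass carried by the second component
    have h6 : deriv lam 0 - 1 / 2 = -(y / (x + y)) := by
      field_simp
      linarith
    rw [h6, abs_neg, abs_of_nonneg (by positivity), div_le_div_iff₀ h2 hr0]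
    nlinarith
  refine ⟨4 * c, by positivity, fun r hr lam ψ hψ hlam => ?_, fun r hr ε lam ψ h hlam => ?_,
    fun r hr ε lam ψ h h0 => ?_, fun r hr ψ hψ => ?_⟩
  · have hr0 : 0 < r := by linarith
    obtain ⟨h1, h2⟩ := hbound r (hle r hr) lam ψ hψ hlam
    have h3 := ha0 ψ
    refine ⟨?_, h2.trans (by nlinarith)⟩
    generalize (∫ p, ‖ψ.fst p‖ ^ 2 ∂(ContactDirac.riemannianVolume Y)) = x at *
    generalize (∫ p, ‖ψ.snd p‖ ^ 2 ∂(ContactDirac.riemannianVolume Y)) = y at *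
    generalize (∫ p, ContactDirac.covNormSq A r ψ.sndPart p
      ∂(ContactDirac.riemannianVolume Y)) = z at *
    calc y + r⁻¹ * z = r⁻¹ * (r * y + z) := by field_simp
      _ ≤ r⁻¹ * (4 * c * x) := by gcongr; nlinarith
      _ = 4 * c * r⁻¹ * x := by ring
  · exact (hslope r hr ε lam ψ h hlam).trans (div_le_div_of_nonneg_right (by linarith)
      (by linarith))
  · have h1 := hslope r hr ε lam ψ h (by rwa [h0, abs_zero])
    have h2 : c / r ≤ 1 / 4 := by
      rw [div_le_div_iff₀ (by linarith) (by norm_num)]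
      linarith
    have h3 := neg_abs_le (deriv lam 0 - 1 / 2)
    exact ContactDirac.eventually_sign_of_hasDerivAt_pos h.hasDerivAt h0 (by linarith)
  · have h1 := hsnd r hr 0 ψ hψ (by rwa [abs_zero])
    have h2 := F.pairing_self_pos hψ.nonzero
    rw [F.crossingForm_eq, F.pairing_halfReeb_self]
    rw [F.pairing_self] at h2
    have h3 := hb0 ψ
    have h4 := mul_le_mul_of_nonneg_right hr h3
    generalize (∫ p, ‖ψ.fst p‖ ^ 2 ∂(ContactDirac.riemannianVolume Y)) = x at *
    generalize (∫ p, ‖ψ.snd p‖ ^ 2 ∂(ContactDirac.riemannianVolume Y)) = y at *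
    have h5 : 4 * y ≤ x := le_of_mul_le_mul_left (by linarith) hc
    linarith
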